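/- Let $d\ge 1$ and let $\Omega\subseteq\mathbb{R}^d$ be a bounded (polyhedral) Lipschitz domain. A mesh $\mathcal{T}$ on $\Omega$ is a finite set of open simplices $T\subseteq\Omega$ (the elements), each of the form $T=F_T(\hat T)$ with one fixed open reference simplex $\hat T\subseteq\mathbb{R}^d$ and affine bijections $F_T:\mathbb{R}^d\to\mathbb{R}^d$, with pairwise intersections of measure zero, with $\bigcup_{T\in\mathcal{T}}\overline T=\overline\Omega$, and without hanging nodes (every closed facet of an element either lies in $\partial\Omega$ or is a facet of another element). Let $h_T$ be the diameter of $T$ and $x_T$ its incenter. The mesh is shape-regular with constant $\sigma\ge 1$ if, for every $T\in\mathcal{T}$, $B(x_T,\sigma^{-1}h_T)\subseteq T$ and $\bigcup\{S\in\mathcal{T} : \overline S\cap\overline T\ne\emptyset\}\subseteq B(x_T,\sigma h_T)$, where $B(x,r)$ denotes the open Euclidean ball. For $p\ge 0$ let $S^0_p(\mathcal{T})$ be the space of all real-valued $v\in L^2(\Omega)$ such that, for every $T\in\mathcal{T}$, $v\circ F_T$ is on $\hat T$ a polynomial of total degree at most $p$, and let $S^1_{p,0}(\mathcal{T}):=S^0_p(\mathcal{T})\cap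 H^1_0(\Omega)$. Put $\sigma_{\mathrm{red}}:=d(d+1)/4+2$. Then there is a constant $C>0$ depending only on $d$, $\Omega$ and $\sigma$ (in particular not on $p$ and not on the individual mesh) such that, for every mesh $\mathcal{T}$ on $\Omega$ that is shape-regular with constant $\sigma$ and for every integer $p\ge 1$, there exists a linear operator $J^p_{\mathcal{T}}:S^0_{p+2}(\mathcal{T})\to S^0_p(\mathcal{T})$ that acts elementwise (for every $T \in \mathcal{T}$, $(J^p_{\mathcal{T}}v)|_T$ depends only on $v|_T$) and has the following properties. 1. Continuity and boundary values: $J^p_{\mathcal{T}}v\in S^1_{p,0}(\mathcal{T})$ for all $v\in S^1_{p+2,0}(\mathcal{T})$. 2. Supports: $\operatorname{supp}(J^p_{\mathcal{T}}v)\subseteq\operatorname{supp}(v)$ for all $v\in S^0_{p+2}(\mathcal{T})$. 3. Error bound: for all $\kappa\in S^0_1(\mathcal{T})$, all $u\in S^0_p(\mathcal{T})$ and all $T\in\mathcal{T}$, $$\sum_{l=0}^{1} h_T^l\,\big|(\mathrm{id}-J^p_{\mathcal{T}})(\kappa^2u)\big|_{H^l(T)}\le C\,p^{\sigma_{\mathrm{red}}}\,h_T\,|\kappa^2|_{W^{1,\infty}(T)}\,\|u\|_{L^2(T)}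 .$$ -/

import Mathlib

open MeasureTheory Set Metric
open scoped ENNReal NNReal Topology ContDiff

namespace HpFem

/-- `ℝ^d` with the Euclidean norm. -/
abbrev E (d : ℕ) : Type := EuclideanSpace ℝ (Fin d)

/-- A bounded Lipschitz domain: a bounded, open, connected, non-empty set that near each of its
boundary points lies, in the direction of a suitable unit vector `e`, strictly above the graph of a
Lipschitz function on the hyperplane `e^⊥`. (Only the values of `g` on `e^⊥` enter.) -/
structure IsLipschitzDomain {d : ℕ} (Ω : Set (E d)) : Prop where
  isOpen : IsOpen Ω
  isConnected : IsConnected Ω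
  isBounded : Bornology.IsBounded Ω
  graph : ∀ x ∈ frontier Ω, ∃ r : ℝ, 0 < r ∧ ∃ e : E d, ‖e‖ = 1 ∧
    ∃ (K : ℝ≥0) (g : E d → ℝ), LipschitzWith K g ∧
      ∀ y ∈ ball x r, (y ∈ Ω ↔ g (y - inner ℝ e y • e) < inner ℝ e y)

/-! ### Weak gradients, Sobolev seminorms and `H¹₀` -/

/-- Test functions `φ ∈ C_c^∞(U)`. -/
structure IsTestFunction {d : ℕ} (U : Set (E d)) (φ : E d → ℝ) : Prop where
  contDiff : ContDiff ℝ ∞ φ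
  hasCompactSupport : HasCompactSupport φ
  tsupport_subset : tsupport φ ⊆ U

/-- `g` is a weak gradient of `v` on the open set `U`. -/
structure HasWeakGradient {d : ℕ} (U : Set (E d)) (v : E d → ℝ) (g : E d → E d) : Prop where
  locallyIntegrableOn : LocallyIntegrableOn v U
  grad_locallyIntegrableOn : LocallyIntegrableOn g U
  integral_eq : ∀ φ : E d → ℝ, IsTestFunction U φ →
    ∫ x in U, v x • gradient φ x = - ∫ x in U, φ x • g x

/-- The seminorm `|v|_{W^{1,q}(U)} = ‖∇v‖_{L^q(U)}`, with `|v|_{H^1(U)}` the case `q = 2`. The weak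
gradient is unique almost everywhere, so the infimum is over a single value; it is `∞` if `v` has no
weak gradient on `U`. -/
noncomputable def gradSeminorm {d : ℕ} (q : ℝ≥0∞) (U : Set (E d)) (v : E d → ℝ) : ℝ≥0∞ :=
  ⨅ (g : E d → E d) (_ : HasWeakGradient U v g), eLpNorm g q (volume.restrict U)

/-- `u ∈ H¹₀(Ω)`: `u` is in `H¹(Ω)` and is a limit, in the norm of `H¹(Ω)`, of test functions. -/
def MemH10 {d : ℕ} (Ω : Set (E d)) (u : E d → ℝ) : Prop :=
  MemLp u 2 (volume.restrict Ω) ∧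
    ∃ g : E d → E d, HasWeakGradient Ω u g ∧ MemLp g 2 (volume.restrict Ω) ∧
      ∀ ε : ℝ≥0∞, 0 < ε → ∃ φ : E d → ℝ, IsTestFunction Ω φ ∧
        eLpNorm (fun x => u x - φ x) 2 (volume.restrict Ω) ≤ ε ∧
        eLpNorm (fun x => g x - gradient φ x) 2 (volume.restrict Ω) ≤ ε

/-- The (essential) support of a function on `Ω` that is given up to null sets: the points all of
whose neighbourhoods `U` meet `{v ≠ 0}` in a set of positive measure. -/
def essSupport {d : ℕ} (Ω : Set (E d)) (v : E d → ℝ) : Set (E d) :=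
  {x | ∀ U ∈ 𝓝 x, volume ({y ∈ U ∩ Ω | v y ≠ 0}) ≠ 0}

/-! ### Meshes -/

/-- A regular simplicial mesh on `Ω`. The reference element is the open simplex with vertices
`refVertex`; `map T` is the affine bijection `F_T` (its values at sets that are not elements are
irrelevant). The last condition says that there are no hanging nodes: every (closed) facet of an
element lies in the boundary of `Ω` or is a facet of another element. -/
structure Mesh {d : ℕ} (Ω : Set (E d)) where
  elements : Set (Set (E d))
  refVertex : Fin (d + 1) → E d
  map : Set (E d) → (E d ≃ᵃ[ℝ] E d)
  finite : elements.Finite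
  affineIndependent : AffineIndependent ℝ refVertex
  map_image : ∀ T ∈ elements, map T '' interior (convexHull ℝ (range refVertex)) = T
  subset : ∀ T ∈ elements, T ⊆ Ω
  disjoint : ∀ T ∈ elements, ∀ S ∈ elements, T ≠ S → volume (T ∩ S) = 0
  cover : ⋃ T ∈ elements, closure T = closure Ω
  regular : ∀ T ∈ elements, ∀ i : Fin (d + 1),
    map T '' convexHull ℝ (refVertex '' {i}ᶜ) ⊆ frontier Ω ∨
    ∃ S ∈ elements, S ≠ T ∧ ∃ j : Fin (d + 1),
      map S '' convexHull ℝ (refVertex '' {j}ᶜ) = map T '' convexHull ℝ (refVertex '' {i}ᶜ)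

namespace Mesh

variable {d : ℕ} {Ω : Set (E d)}

/-- The reference element, an open simplex. -/
def ref (𝒯 : Mesh Ω) : Set (E d) := interior (convexHull ℝ (range 𝒯.refVertex))

/-- The patch of `T`: all elements whose closure meets the closure of `T`. -/
def patch (𝒯 : Mesh Ω) (T : Set (E d)) : Set (Set (E d)) :=
  {S ∈ 𝒯.elements | (closure S ∩ closure T).Nonempty}

end Mesh

/-- `x` is the centre of a largest ball contained in `T`. -/
def IsIncenter {d : ℕ} (T : Set (E d)) (x : E d) : Prop :=
  x ∈ T ∧ ∀ (y : E d) (r : ℝ), ball y r ⊆ T → ball x r ⊆ T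

/-- Shape regularity with constant `σ`. The mesh width `h_T` is the diameter of `T`. -/
def Mesh.IsShapeRegular {d : ℕ} {Ω : Set (E d)} (𝒯 : Mesh Ω) (σ : ℝ) : Prop :=
  ∀ T ∈ 𝒯.elements, ∃ x : E d, IsIncenter T x ∧
    ball x (σ⁻¹ * diam T) ⊆ T ∧ ⋃ S ∈ 𝒯.patch T, S ⊆ ball x (σ * diam T)

/-! ### Spline spaces -/

section Spline

variable {d : ℕ} {Ω : Set (E d)}

/-- An affine bijection pulls null sets back to null sets. -/
theorem ae_comp_affine (F : E d ≃ᵃ[ℝ] E d) {A B : Set (E d)} (hAB : F '' A ⊆ B)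
    {P : E d → Prop} (hP : ∀ᵐ y ∂volume.restrict B, P y)
    (hA : MeasurableSet A) (hB : MeasurableSet B) :
    ∀ᵐ x ∂volume.restrict A, P (F x) := by
  rw [ae_restrict_iff' hB, ae_iff] at hP
  rw [ae_restrict_iff' hA, ae_iff]
  have hdiff : Differentiable ℝ F.symm := by
    exact (AffineEquiv.toContinuousAffineEquiv F.symm).toContinuousAffineMap.differentiable
  have h0 := addHaar_image_eq_zero_of_differentiableOn_of_addHaar_eq_zero
    (μ := (volume : Measure (E d))) hdiff.differentiableOn hP
  refine measure_mono_null ?_ h0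
  intro x hx
  simp only [mem_ofPred_eq, Classical.not_imp] at hx
  exact ⟨F x, by simpa using ⟨hAB ⟨x, hx.1, rfl⟩, hx.2⟩, by simp⟩

theorem Mesh.measurableSet_ref (𝒯 : Mesh Ω) : MeasurableSet 𝒯.ref :=
  isOpen_interior.measurableSet

theorem Mesh.ae_comp_map (𝒯 : Mesh Ω) {T : Set (E d)} (hT : T ∈ 𝒯.elements)
    {P : E d → Prop} (hP : ∀ᵐ y ∂volume.restrict Ω, P y) :
    ∀ᵐ x ∂volume.restrict 𝒯.ref, P (𝒯.map T x) := by
  have hm : 𝒯.map T '' 𝒯.ref = T := 𝒯.map_image T hT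
  have hTm : MeasurableSet T := by
    rw [← hm]
    exact ((AffineEquiv.toContinuousAffineEquiv (𝒯.map T)).toHomeomorph.isOpenMap _ isOpen_interior).measurableSet
  exact ae_comp_affine (𝒯.map T) hm.subset
    (ae_mono (Measure.restrict_mono (𝒯.subset T hT) le_rfl) hP) 𝒯.measurableSet_ref hTm

/-- `S^0_p(𝒯)`: the functions `v ∈ L²(Ω)` for which, on every element `T`, the pull-back
`v ∘ F_T` is a polynomial of total degree at most `p` on the reference element. -/
noncomputable def Mesh.spline (𝒯 : Mesh Ω) (p : ℕ) : Submodule ℝ (Lp ℝ 2 (volume.restrict Ω)) where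
  carrier := {v | ∀ T ∈ 𝒯.elements, ∃ q : MvPolynomial (Fin d) ℝ, q.totalDegree ≤ p ∧
    ∀ᵐ x ∂volume.restrict 𝒯.ref, v (𝒯.map T x) = MvPolynomial.eval (fun i => x i) q}
  zero_mem' := by
    intro T hT
    refine ⟨0, by simp, ?_⟩
    filter_upwards [𝒯.ae_comp_map hT (Lp.coeFn_zero ℝ 2 (volume.restrict Ω))] with x hx
    exact hx.trans (by simp)
  add_mem' := by
    intro v w hv hw T hT
    obtain ⟨q, hq, hvq⟩ := hv T hT
    obtain ⟨s, hs, hws⟩ := hw T hT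
    refine ⟨q + s, (MvPolynomial.totalDegree_add q s).trans (max_le hq hs), ?_⟩
    filter_upwards [𝒯.ae_comp_map hT (Lp.coeFn_add v w), hvq, hws] with x hx h1 h2
    exact hx.trans (by rw [Pi.add_apply, h1, h2, map_add])
  smul_mem' := by
    intro c v hv T hT
    obtain ⟨q, hq, hvq⟩ := hv T hT
    refine ⟨c • q, (MvPolynomial.totalDegree_smul_le c q).trans hq, ?_⟩
    filter_upwards [𝒯.ae_comp_map hT (Lp.coeFn_smul c v), hvq] with x hx h1
    exact hx.trans (by simp [h1])

/-- `S^1_{p,0}(𝒯)`: the functions in `H¹₀(Ω)` that are elementwise polynomial of degree at most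
`p`. -/
def Mesh.spline10 (𝒯 : Mesh Ω) (p : ℕ) : Set (Lp ℝ 2 (volume.restrict Ω)) :=
  {v | MemH10 Ω v ∧ v ∈ 𝒯.spline p}

theorem Mesh.memLp_sq_mul (𝒯 : Mesh Ω) {p : ℕ} (κ : 𝒯.spline 1) (u : 𝒯.spline p) :
    MemLp (fun x => (κ : Lp ℝ 2 (volume.restrict Ω)) x ^ 2 *
      (u : Lp ℝ 2 (volume.restrict Ω)) x) 2 (volume.restrict Ω) := by
  have hms : AEStronglyMeasurable (fun x => (κ : Lp ℝ 2 (volume.restrict Ω)) x ^ 2 *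
      (u : Lp ℝ 2 (volume.restrict Ω)) x) (volume.restrict Ω) :=
    ((Lp.aestronglyMeasurable _).pow 2).mul (Lp.aestronglyMeasurable _)
  rw [memLp_two_iff_integrable_sq hms]
  suffices h : IntegrableOn (fun x => ((κ : Lp ℝ 2 (volume.restrict Ω)) x ^ 2 *
      (u : Lp ℝ 2 (volume.restrict Ω)) x) ^ 2) (⋃ T ∈ 𝒯.elements, closure T) volume by
    rw [𝒯.cover] at h
    exact h.mono_set subset_closure
  rw [integrableOn_finite_biUnion 𝒯.finite]
  intro T hT
  obtain ⟨q, -, hq⟩ := κ.2 T hT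
  obtain ⟨s, -, hs⟩ := u.2 T hT
  set F := 𝒯.map T with hF
  have hm : F '' 𝒯.ref = T := 𝒯.map_image T hT
  have hTo : IsOpen T := by
    rw [← hm]
    exact (AffineEquiv.toContinuousAffineEquiv F).toHomeomorph.isOpenMap _ isOpen_interior
  have hconv : Convex ℝ T := by
    rw [← hm]
    exact (convex_convexHull ℝ _).interior.affine_image F.toAffineMap
  have hbdd : Bornology.IsBounded T := by
    have hc : IsCompact (F '' convexHull ℝ (range 𝒯.refVertex)) :=
      ((Set.finite_range _).isCompact_convexHull ℝ).image
        (AffineEquiv.toContinuousAffineEquiv F).continuous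
    refine hc.isBounded.subset ?_
    rw [← hm]
    exact image_mono interior_subset
  have hae : (closure T : Set (E d)) =ᵐ[volume] T := by
    refine Filter.EventuallyEq.symm ?_
    have hd : volume (closure T \ T) = 0 := by
      have := hconv.addHaar_frontier (volume : Measure (E d))
      rwa [frontier, hTo.interior_eq] at this
    exact (ae_le_set.2 (by simp [sdiff_eq_empty.2 subset_closure])).antisymm (ae_le_set.2 hd)
  have hm' : F.symm '' T ⊆ 𝒯.ref := by
    rw [← hm]
    rintro _ ⟨_, ⟨x, hx, rfl⟩, rfl⟩
    simpa using hx
  have hq' := ae_comp_affine F.symm hm' hq hTo.measurableSet 𝒯.measurableSet_ref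
  have hs' := ae_comp_affine F.symm hm' hs hTo.measurableSet 𝒯.measurableSet_ref
  have hFc : Continuous F.symm := (AffineEquiv.toContinuousAffineEquiv F.symm).continuous
  have hpc : ∀ r : MvPolynomial (Fin d) ℝ,
      Continuous fun y : E d => MvPolynomial.eval (fun i => F.symm y i) r := by
    intro r
    exact (MvPolynomial.continuous_eval r).comp (by fun_prop)
  have hcont : Continuous fun y : E d => (MvPolynomial.eval (fun i => F.symm y i) q ^ 2 *
      MvPolynomial.eval (fun i => F.symm y i) s) ^ 2 :=
    (((hpc q).pow 2).mul (hpc s)).pow 2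
  have hint := (hcont.continuousOn (s := closure T)).integrableOn_compact
    (μ := (volume : Measure (E d))) hbdd.isCompact_closure
  rw [integrableOn_congr_set_ae hae] at hint ⊢
  refine hint.congr ?_
  filter_upwards [hq', hs'] with y h1 h2
  simp only [AffineEquiv.apply_symm_apply] at h1 h2
  simp [h1, h2]

/-- The product `κ² u ∈ S^0_{p+2}(𝒯)` of `κ ∈ S^0_1(𝒯)` and `u ∈ S^0_p(𝒯)`. -/
noncomputable def Mesh.sqMul (𝒯 : Mesh Ω) {p : ℕ} (κ : 𝒯.spline 1) (u : 𝒯.spline p) :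
    𝒯.spline (p + 2) :=
  ⟨(𝒯.memLp_sq_mul κ u).toLp, by
    intro T hT
    obtain ⟨q, hq1, hq⟩ := κ.2 T hT
    obtain ⟨s, hs1, hs⟩ := u.2 T hT
    refine ⟨q ^ 2 * s, ?_, ?_⟩
    · have h1 := MvPolynomial.totalDegree_mul (q ^ 2) s
      have h2 := MvPolynomial.totalDegree_pow q 2
      lia
    · filter_upwards [𝒯.ae_comp_map hT (𝒯.memLp_sq_mul κ u).coeFn_toLp, hq, hs] with x hx h1 h2
      simp [hx, h1, h2]⟩

end Spline

end HpFem

set_option linter.unusedSectionVars false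

/-! On an element, every polynomial of degree at most `q` is a unique homogeneous polynomial of
degree `q` in the `d + 1` barycentric coordinates, because their sum `s` equals 1 there. Lowering
the degree then means replacing `f` of degree `p + 2` by some `g` of degree `p` with `f - s² g`
under control. By the Dirichlet integrals (`exists_integral_simplex_eq`), the L² product of
homogeneous polynomials over a simplex is `expInt (f * g)`, up to a factor that depends only on the
simplex and the total degree. Products of Laguerre polynomials diagonalise this form, so the trace
inequality on a face (`expInt_face_compl_sq_le`) and Markov's inequality (`expInt_pderiv_sq_le`)
become Cauchy–Schwarz on finite sequences of coefficients.

The operator `reduce` treats the faces by increasing dimension. If the residual `r` vanishes on all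
faces with at most `k` vertices, then its restriction to a face `F` with `k + 1` vertices is a
bubble: its monomials involve exactly the variables of `F`. Write `s_F` for the sum of these
variables. Projecting the restriction orthogonally onto `s_F²` times the bubbles of degree `p`
produces a bubble `D_F`, which is added to the result, while `r` loses the sum over `F` of `face F r
+ (s² - s_F²) D_F`. That sum agrees with `r` on all faces with at most `k + 1` vertices. After `d +
1` stages nothing is left, and `f - s² reduce f` is the sum of the projection defects
(`sub_reduce_eq_sum`).

Stage `k` multiplies the squared norm by a trace constant of order `(p + 3) ^ (d - k)`; extending
`D_F` from `F` to the simplex costs no power of `p` (`expInt_psum_univ_sq_mul_sq_le`). The exponents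
add up to `d (d + 1) / 2`, hence `d (d + 1) / 4` for the norm. The inverse estimate for the gradient
supplies the remaining `p² / h`.

The construction reproduces `w` from `s² w` (`reduce_psum_sq_mul`), so a constant may be subtracted
from `κ²` before estimating; its oscillation gives the factor `h |κ²|` in `W^{1,∞}`. It also
commutes with permutations of the vertices (`rename_reduce`) and preserves vanishing on faces
(`face_reduce_eq_zero`), so it preserves matching along shared facets and zero values on boundary
facets. This is membership in `H¹₀`: an elementwise polynomial function in `H¹₀` has a Lipschitz
extension by zero (`MemH10.exists_lipschitz`), and conversely matching pieces glue to a Lipschitz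
function vanishing off `Ω` (`IsTriangulation.exists_lipschitz`), which lies in `H¹₀`
(`memH10_of_lipschitz`). -/

namespace HpFem

open MvPolynomial

/-! ### Laguerre expansions and Markov's inequality. -/

section Laguerre

variable {τ : Type*} [Fintype τ] [DecidableEq τ]

/-- The linear functional `x^α ↦ α!` on polynomials, that is, integration against
`exp (-∑ xᵢ)` over the positive orthant. -/
noncomputable def expInt (τ : Type*) [Fintype τ] : MvPolynomial τ ℝ →ₗ[ℝ] ℝ :=
  (basisMonomials τ ℝ).constr ℝ fun α => ∏ i, ((α i).factorial : ℝ)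

/-- The coefficients, up to sign, of a polynomial in the basis of Laguerre polynomials. -/
noncomputable def lagCoeff (κ : τ → ℕ) : MvPolynomial τ ℝ →ₗ[ℝ] ℝ :=
  (basisMonomials τ ℝ).constr ℝ fun α => ∏ i, (((α i).choose (κ i) : ℝ) * (α i).factorial)

theorem monomial_eq_smul_basis (α : τ →₀ ℕ) (c : ℝ) :
    monomial α c = c • basisMonomials τ ℝ α := by
  simp [coe_basisMonomials, smul_monomial]

theorem expInt_monomial (α : τ →₀ ℕ) (c : ℝ) :
    expInt τ (monomial α c) = c * ∏ i, ((α i).factorial : ℝ) := by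
  rw [monomial_eq_smul_basis, map_smul, expInt, Module.Basis.constr_basis, smul_eq_mul]

theorem lagCoeff_monomial (κ : τ → ℕ) (α : τ →₀ ℕ) (c : ℝ) :
    lagCoeff κ (monomial α c) =
      c * ∏ i, (((α i).choose (κ i) : ℝ) * (α i).factorial) := by
  rw [monomial_eq_smul_basis, map_smul, lagCoeff, Module.Basis.constr_basis, smul_eq_mul]

/-- All exponents of `f` are at most `N`. -/
def DegLE (N : ℕ) (f : MvPolynomial τ ℝ) : Prop := ∀ α ∈ f.support, ∀ i, α i ≤ N

/-- The box of multi-indices with entries at most `N`. -/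
def box (τ : Type*) [Fintype τ] [DecidableEq τ] (N : ℕ) : Finset (τ → ℕ) :=
  Fintype.piFinset fun _ => Finset.range (N + 1)

theorem mem_box {N : ℕ} {κ : τ → ℕ} : κ ∈ box τ N ↔ ∀ i, κ i < N + 1 := by
  simp [box, Fintype.mem_piFinset]

theorem degLE_of_isHomogeneous {q : ℕ} {f : MvPolynomial τ ℝ} (hf : f.IsHomogeneous q) :
    DegLE q f := by
  intro α hα i
  have h : α.degree = q := by
    rw [Finsupp.degree_eq_weight_one]
    exact hf (mem_support_iff.1 hα)
  rw [← h]
  exact Finsupp.le_degree i α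

/-- Vandermonde's identity `∑ C(m,k) C(n,k) = C(m+n,m)`, multiplied by `m! n!`. It is Parseval's
identity for the Laguerre expansions of `t ^ m` and `t ^ n`. -/
theorem sum_choose_mul_choose {m n N : ℕ} (hm : m ≤ N) :
    ∑ k ∈ Finset.range (N + 1), ((m.choose k : ℝ) * m.factorial) * (n.choose k * n.factorial) =
      ((m + n).factorial : ℝ) := by
  have h1 : ∑ k ∈ Finset.range (m + 1), m.choose k * n.choose k = (m + n).choose m := by
    rw [Nat.add_choose_eq, Finset.Nat.sum_antidiagonal_eq_sum_range_succ_mk,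
      ← Finset.sum_range_reflect]
    refine Finset.sum_congr rfl fun k hk => ?_
    have hk' : k ≤ m := by simpa [Nat.lt_succ_iff] using hk
    have e1 : m + 1 - 1 - k = m - k := by omega
    simp only [e1]
    rw [Nat.choose_symm hk']
  have h2 : ∑ k ∈ Finset.range (N + 1), m.choose k * n.choose k = (m + n).choose m := by
    rw [← h1]
    refine (Finset.sum_subset (Finset.range_mono (by omega)) fun k _ hk => ?_).symm
    rw [Nat.choose_eq_zero_of_lt (by simpa using hk), zero_mul]
  have h3 := Nat.add_choose_mul_factorial_mul_factorial m n
  rw [← Nat.choose_symm_add] at h3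
  rw [← h3, ← h2]
  push_cast
  rw [Finset.sum_mul, Finset.sum_mul]
  exact Finset.sum_congr rfl fun k _ => by ring

/-- Parseval's identity. Bounding the degree of one factor is enough, since its coefficients vanish
outside the box. -/
theorem expInt_mul_eq_sum {N : ℕ} {f : MvPolynomial τ ℝ} (hf : DegLE N f)
    (g : MvPolynomial τ ℝ) :
    expInt τ (f * g) = ∑ κ ∈ box τ N, lagCoeff κ f * lagCoeff κ g := by
  have key : ∀ α : τ →₀ ℕ, (∀ i, α i ≤ N) → ∀ β : τ →₀ ℕ, ∀ a b : ℝ,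
      expInt τ (monomial α a * monomial β b) =
        ∑ κ ∈ box τ N, lagCoeff κ (monomial α a) * lagCoeff κ (monomial β b) := by
    intro α hα β a b
    rw [monomial_mul, expInt_monomial]
    simp only [lagCoeff_monomial]
    have : ∏ i, (((α + β) i).factorial : ℝ) = ∏ i, ∑ k ∈ Finset.range (N + 1),
        (((α i).choose k : ℝ) * (α i).factorial) * ((β i).choose k * (β i).factorial) :=
      Finset.prod_congr rfl fun i _ => (sum_choose_mul_choose (hα i)).symm
    rw [this, Finset.prod_univ_sum, Finset.mul_sum]
    refine Finset.sum_congr rfl fun κ _ => ?_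
    rw [Finset.prod_mul_distrib]
    ring
  conv_lhs => rw [f.as_sum, g.as_sum, Finset.sum_mul_sum]
  conv_rhs => rw [f.as_sum, g.as_sum]
  simp only [map_sum, Finset.sum_mul_sum]
  rw [Finset.sum_comm]
  simp_rw [Finset.sum_comm (s := box τ N)]
  rw [Finset.sum_comm]
  refine Finset.sum_congr rfl fun α hα => Finset.sum_congr rfl fun β _ => ?_
  exact key α (hf α hα) β _ _

theorem expInt_sq_eq_sum {N : ℕ} {f : MvPolynomial τ ℝ} (hf : DegLE N f) :
    expInt τ (f * f) = ∑ κ ∈ box τ N, lagCoeff κ f ^ 2 := by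
  simp only [expInt_mul_eq_sum hf, sq]

theorem exists_degLE (f : MvPolynomial τ ℝ) : ∃ N, DegLE N f := by
  refine ⟨f.totalDegree, fun α hα i => (Finsupp.le_degree i α).trans ?_⟩
  exact le_totalDegree hα

theorem expInt_sq_nonneg (f : MvPolynomial τ ℝ) : 0 ≤ expInt τ (f * f) := by
  obtain ⟨N, hN⟩ := exists_degLE f
  rw [expInt_sq_eq_sum hN]
  positivity

/-- At an exponent `α` of maximal total degree, `lagCoeff α` sees only the monomial `α`: the
binomials vanish at `β` unless `α ≤ β`, and then maximality forces `β = α`. -/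
theorem eq_zero_of_expInt_sq {f : MvPolynomial τ ℝ} (h : expInt τ (f * f) = 0) : f = 0 := by
  by_contra hf
  obtain ⟨N, hN⟩ := exists_degLE f
  rw [expInt_sq_eq_sum hN, Finset.sum_eq_zero_iff_of_nonneg (fun _ _ => sq_nonneg _)] at h
  obtain ⟨α, hα, hmax⟩ := f.support.exists_max_image Finsupp.degree
    (by simpa [Finset.nonempty_iff_ne_empty] using hf)
  have h0 : lagCoeff (fun i => α i) f = 0 := by
    simpa using h (fun i => α i) (mem_box.2 fun i => Nat.lt_succ_of_le (hN α hα i))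
  rw [f.as_sum, map_sum, Finset.sum_eq_single α] at h0
  · simp only [lagCoeff_monomial, Nat.choose_self, Nat.cast_one, one_mul, mul_eq_zero] at h0
    rcases h0 with h0 | h0
    · exact mem_support_iff.1 hα h0
    · exact (Finset.prod_pos fun i _ => by positivity).ne' h0
  · intro β hβ hne
    rw [lagCoeff_monomial]
    by_cases hle : ∀ i, α i ≤ β i
    · exfalso
      apply hne
      have hle' : α ≤ β := hle
      obtain ⟨γ, rfl⟩ := exists_add_of_le hle'
      have := hmax _ hβ
      rw [map_add] at this
      have hγ : γ.degree = 0 := by omega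
      rw [Finsupp.degree_eq_zero_iff] at hγ
      simp [hγ]
    · push Not at hle
      obtain ⟨i, hi⟩ := hle
      rw [Finset.prod_eq_zero (Finset.mem_univ i), mul_zero]
      rw [Nat.choose_eq_zero_of_lt hi]
      simp
  · intro h'
    exact absurd hα h'

theorem expInt_sum_sq_le {ι : Type*} (s : Finset ι) (f : ι → MvPolynomial τ ℝ) :
    expInt τ ((∑ i ∈ s, f i) * ∑ i ∈ s, f i) ≤ s.card * ∑ i ∈ s, expInt τ (f i * f i) := by
  choose N hN using fun i => exists_degLE (f i)
  obtain ⟨N', hN'⟩ := exists_degLE (∑ i ∈ s, f i)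
  set M := N' + ∑ i ∈ s, N i
  have hs : DegLE M (∑ i ∈ s, f i) := fun α hα i => (hN' α hα i).trans (Nat.le_add_right _ _)
  rw [expInt_sq_eq_sum hs]
  have h2 : ∀ i ∈ s, expInt τ (f i * f i) = ∑ κ ∈ box τ M, lagCoeff κ (f i) ^ 2 := by
    intro i hi
    refine expInt_sq_eq_sum fun α hα j => (hN i α hα j).trans ?_
    exact (Finset.single_le_sum (f := N) (fun _ _ => Nat.zero_le _) hi).trans
      (Nat.le_add_left _ _)
  rw [Finset.sum_congr rfl h2, Finset.sum_comm, Finset.mul_sum]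
  refine Finset.sum_le_sum fun κ _ => ?_
  rw [map_sum]
  exact sq_sum_le_card_mul_sum_sq

theorem expInt_add_sq_le (f g : MvPolynomial τ ℝ) :
    expInt τ ((f + g) * (f + g)) ≤ 2 * (expInt τ (f * f) + expInt τ (g * g)) := by
  have h := expInt_sq_nonneg (f - g)
  have : (f - g) * (f - g) = f * f + f * f + (g * g + g * g) - (f + g) * (f + g) := by ring
  rw [this] at h
  simp only [map_sub, map_add] at h
  linarith

/-- Summation over a box, one direction at a time. -/
theorem sum_box_eq (N : ℕ) (i : τ) (G : (τ → ℕ) → ℝ) :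
    ∑ κ ∈ box τ N, G κ = ∑ κ ∈ (box τ N).filter (fun κ => κ i = 0),
      ∑ k ∈ Finset.range (N + 1), G (Function.update κ i k) := by
  rw [← Finset.sum_product']
  refine Finset.sum_nbij' (fun κ => (Function.update κ i 0, κ i))
    (fun x => Function.update x.1 i x.2) ?_ ?_ ?_ ?_ ?_
  · intro κ hκ
    rw [mem_box] at hκ
    simp only [Finset.mem_product, Finset.mem_filter, mem_box, Function.update_self, and_true,
      Finset.mem_range]
    refine ⟨fun j => ?_, hκ i⟩
    by_cases hj : j = i
    · subst hj; simp
    · simpa [hj] using hκ j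
  · rintro ⟨κ, k⟩ h
    simp only [Finset.mem_product, Finset.mem_filter, mem_box, Finset.mem_range] at h
    rw [mem_box]
    intro j
    by_cases hj : j = i
    · subst hj; simpa using h.2
    · simpa [hj] using h.1.1 j
  · intro κ _
    simp
  · rintro ⟨κ, k⟩ h
    simp only [Finset.mem_product, Finset.mem_filter, mem_box, Finset.mem_range] at h
    have : Function.update κ i 0 = κ := by
      rw [← h.1.2]; simp
    simp [this]
  · intro κ _
    simp

/-- Reduces an inequality between Laguerre coefficients to the lines in one coordinate direction, so
that Markov and trace inequalities become one-dimensional. -/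
theorem sum_box_sq_le (N : ℕ) (i : τ) (c : ℝ) (U W : (τ → ℕ) → ℝ)
    (h : ∀ κ : τ → ℕ, ∑ k ∈ Finset.range (N + 1), U (Function.update κ i k) ^ 2 ≤
      c * ∑ k ∈ Finset.range (N + 1), W (Function.update κ i k) ^ 2) :
    ∑ κ ∈ box τ N, U κ ^ 2 ≤ c * ∑ κ ∈ box τ N, W κ ^ 2 := by
  rw [sum_box_eq N i, sum_box_eq N i, Finset.mul_sum]
  exact Finset.sum_le_sum fun κ _ => h κ

/-- The Laguerre relation `L_k = L_k' - L_{k+1}'`, read on coefficients. On monomials it is Pascal's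
rule. -/
theorem lagCoeff_pderiv (κ : τ → ℕ) (i : τ) (f : MvPolynomial τ ℝ) :
    lagCoeff κ (pderiv i f) + lagCoeff (Function.update κ i (κ i + 1)) (pderiv i f) =
      lagCoeff (Function.update κ i (κ i + 1)) f := by
  induction f using MvPolynomial.induction_on' with
  | add p q hp hq =>
    simp only [map_add] at *
    linarith
  | monomial α a =>
    rw [pderiv_monomial]
    simp only [lagCoeff_monomial]
    rw [← Finset.mul_prod_erase _ _ (Finset.mem_univ i),
      ← Finset.mul_prod_erase _ _ (Finset.mem_univ i),
      ← Finset.mul_prod_erase _ _ (Finset.mem_univ i)]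
    have e1 : ∏ x ∈ Finset.univ.erase i, ((((α - Finsupp.single i 1 : τ →₀ ℕ) x).choose (κ x) : ℝ) *
        ((α - Finsupp.single i 1 : τ →₀ ℕ) x).factorial) =
        ∏ x ∈ Finset.univ.erase i, (((α x).choose (κ x) : ℝ) * (α x).factorial) := by
      refine Finset.prod_congr rfl fun x hx => ?_
      have hx' : x ≠ i := Finset.ne_of_mem_erase hx
      simp [hx'.symm]
    have e2 : ∏ x ∈ Finset.univ.erase i, ((((α - Finsupp.single i 1 : τ →₀ ℕ) x).choose
          (Function.update κ i (κ i + 1) x) : ℝ) * ((α - Finsupp.single i 1 : τ →₀ ℕ) x).factorial) =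
        ∏ x ∈ Finset.univ.erase i, (((α x).choose (κ x) : ℝ) * (α x).factorial) := by
      refine Finset.prod_congr rfl fun x hx => ?_
      have hx' : x ≠ i := Finset.ne_of_mem_erase hx
      simp [hx']
    have e3 : ∏ x ∈ Finset.univ.erase i, (((α x).choose
          (Function.update κ i (κ i + 1) x) : ℝ) * (α x).factorial) =
        ∏ x ∈ Finset.univ.erase i, (((α x).choose (κ x) : ℝ) * (α x).factorial) := by
      refine Finset.prod_congr rfl fun x hx => ?_
      have hx' : x ≠ i := Finset.ne_of_mem_erase hx
      simp [hx']
    rw [e1, e2, e3]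
    simp only [Function.update_self, Finsupp.coe_tsub, Pi.sub_apply, Finsupp.single_eq_same]
    rcases hm : α i with _ | m
    · simp
    · simp only [Nat.add_sub_cancel, Nat.choose_succ_succ, Nat.factorial_succ]
      push_cast
      ring

/-- The recursion is solved downwards from `u N = 0`, using `u k = w (k + 1) - u (k + 1)`. -/
theorem abs_le_sum_of_telescope {N : ℕ} {u w : ℕ → ℝ} (h : ∀ k, u k + u (k + 1) = w (k + 1))
    (hu : ∀ k, N ≤ k → u k = 0) (k : ℕ) : |u k| ≤ ∑ j ∈ Finset.range (N + 1), |w j| := by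
  suffices H : ∀ m, m ≤ N → |u (N - m)| ≤ ∑ j ∈ Finset.Ioc (N - m) N, |w j| by
    by_cases hk : k ≤ N
    · have := H (N - k) (Nat.sub_le _ _)
      rw [Nat.sub_sub_self hk] at this
      refine this.trans (Finset.sum_le_sum_of_subset_of_nonneg ?_ fun _ _ _ => abs_nonneg _)
      intro j hj
      simp only [Finset.mem_Ioc, Finset.mem_range] at *
      omega
    · rw [hu k (by omega), abs_zero]
      positivity
  intro m
  induction m with
  | zero => intro _; simp [hu N le_rfl]
  | succ m ih =>
    intro hm
    have ih' := ih (by omega)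
    have h1 := h (N - (m + 1))
    have e : N - (m + 1) + 1 = N - m := by omega
    rw [e] at h1
    have h2 : Finset.Ioc (N - (m + 1)) N = insert (N - m) (Finset.Ioc (N - m) N) := by
      ext j; simp only [Finset.mem_Ioc, Finset.mem_insert]; omega
    rw [h2, Finset.sum_insert (by simp)]
    have h3 : u (N - (m + 1)) = w (N - m) - u (N - m) := by linarith
    rw [h3]
    exact (abs_sub _ _).trans (by linarith)

theorem lagCoeff_eq_zero {N : ℕ} {f : MvPolynomial τ ℝ} (hf : DegLE N f) {κ : τ → ℕ} {i : τ}
    (h : N < κ i) : lagCoeff κ f = 0 := by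
  rw [f.as_sum, map_sum]
  refine Finset.sum_eq_zero fun α hα => ?_
  rw [lagCoeff_monomial, Finset.prod_eq_zero (Finset.mem_univ i), mul_zero]
  rw [Nat.choose_eq_zero_of_lt ((hf α hα i).trans_lt h)]
  simp

/-- Markov's inequality in the norm given by `expInt`. -/
theorem expInt_pderiv_sq_le {q : ℕ} {f : MvPolynomial τ ℝ} (hf : f.IsHomogeneous q) (i : τ) :
    expInt τ (pderiv i f * pderiv i f) ≤ ((q : ℝ) + 1) ^ 2 * expInt τ (f * f) := by
  have hfd := degLE_of_isHomogeneous hf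
  have hgd' : DegLE (q - 1) (pderiv i f) := degLE_of_isHomogeneous hf.pderiv
  have hgd : DegLE q (pderiv i f) := fun α hα j => (hgd' α hα j).trans (Nat.sub_le _ _)
  rw [expInt_sq_eq_sum hfd, expInt_sq_eq_sum hgd]
  refine sum_box_sq_le q i _ _ _ fun κ => ?_
  set u : ℕ → ℝ := fun k => lagCoeff (Function.update κ i k) (pderiv i f)
  set w : ℕ → ℝ := fun k => lagCoeff (Function.update κ i k) f
  have hu : ∀ k, q ≤ k → u k = 0 := by
    intro k hk
    -- The derivative has degree at most `q - 1`, which kills the coefficients from `k = q` on. For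
    -- `q = 0` the truncated subtraction loses this, but then the derivative is zero.
    rcases Nat.eq_zero_or_pos q with hq | hq
    · have : pderiv i f = 0 := by
        subst hq
        have h0 := hf.totalDegree_le
        rw [totalDegree_eq_zero_iff_eq_C.1 (Nat.le_zero.1 h0), pderiv_C]
      simp [u, this]
    · refine lagCoeff_eq_zero hgd' (i := i) ?_
      simp; omega
  have hrec : ∀ k, u k + u (k + 1) = w (k + 1) := by
    intro k
    have := lagCoeff_pderiv (Function.update κ i k) i f
    simpa [u, w] using this
  have hb := abs_le_sum_of_telescope hrec hu
  have hsq : ∀ k, u k ^ 2 ≤ (q + 1) * ∑ j ∈ Finset.range (q + 1), w j ^ 2 := by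
    intro k
    calc u k ^ 2 = |u k| ^ 2 := (sq_abs _).symm
      _ ≤ (∑ j ∈ Finset.range (q + 1), |w j|) ^ 2 := by gcongr; exact hb k
      _ ≤ (Finset.range (q + 1)).card * ∑ j ∈ Finset.range (q + 1), |w j| ^ 2 :=
        sq_sum_le_card_mul_sum_sq
      _ = _ := by simp
  calc ∑ k ∈ Finset.range (q + 1), u k ^ 2
      ≤ ∑ _k ∈ Finset.range (q + 1), (q + 1) * ∑ j ∈ Finset.range (q + 1), w j ^ 2 :=
        Finset.sum_le_sum fun k _ => hsq k
    _ = _ := by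
      rw [Finset.sum_const, Finset.card_range, nsmul_eq_mul]
      push_cast
      ring

end Laguerre

end HpFem

namespace HpFem

open MvPolynomial

/-! ### Restriction to faces, bubbles, and projection on one face. -/

section Faces

variable {τ : Type*} [Fintype τ] [DecidableEq τ]

/-- Restriction to the face spanned by `F`: the variables outside `F` are set to `0`. -/
noncomputable def face (F : Finset τ) : MvPolynomial τ ℝ →ₐ[ℝ] MvPolynomial τ ℝ :=
  aeval fun i => if i ∈ F then X i else 0

theorem face_X (F : Finset τ) (i : τ) :
    face F (X i) = if i ∈ F then (X i : MvPolynomial τ ℝ) else 0 := by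
  simp [face]

theorem face_monomial (F : Finset τ) (α : τ →₀ ℕ) (c : ℝ) :
    face F (monomial α c) = if α.support ⊆ F then monomial α c else 0 := by
  rw [face, aeval_monomial]
  split_ifs with h
  · rw [monomial_eq, algebraMap_eq]
    congr 1
    refine Finsupp.prod_congr fun i hi => ?_
    rw [if_pos (h hi)]
  · obtain ⟨i, hi, hF⟩ := Finset.not_subset.1 h
    rw [Finsupp.prod, Finset.prod_eq_zero hi, mul_zero]
    rw [if_neg hF, zero_pow (Finsupp.mem_support_iff.1 hi)]

theorem coeff_face (F : Finset τ) (f : MvPolynomial τ ℝ) (α : τ →₀ ℕ) :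
    coeff α (face F f) = if α.support ⊆ F then coeff α f else 0 := by
  induction f using MvPolynomial.induction_on' with
  | add p q hp hq =>
    rw [map_add, coeff_add, hp, hq, coeff_add]
    split_ifs <;> simp
  | monomial β b =>
    rw [face_monomial]
    by_cases hβ : β = α
    · subst hβ
      split_ifs <;> simp
    · split_ifs <;> simp [coeff_monomial, hβ]

theorem face_face (F G : Finset τ) (f : MvPolynomial τ ℝ) :
    face G (face F f) = face (G ∩ F) f := by
  ext α
  simp only [coeff_face, Finset.subset_inter_iff]
  split_ifs <;> tauto

theorem face_univ (f : MvPolynomial τ ℝ) : face Finset.univ f = f := by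
  ext α
  simp [coeff_face]

theorem isHomogeneous_face {F : Finset τ} {f : MvPolynomial τ ℝ} {m : ℕ}
    (hf : f.IsHomogeneous m) : (face F f).IsHomogeneous m := by
  intro α hα
  rw [coeff_face] at hα
  exact hf fun h => hα (by simp [h])

/-- All Laguerre polynomials equal 1 at 0, so setting `x i = 0` sums the true coefficients along
direction `i`; the sign convention of `lagCoeff` makes the sum alternating. The result is constant
in `x i`, which leaves only the index `κ i = 0`. -/
theorem lagCoeff_face_compl {N : ℕ} {f : MvPolynomial τ ℝ} (hf : DegLE N f) (i : τ)
    (κ : τ → ℕ) :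
    lagCoeff κ (face {i}ᶜ f) = if κ i = 0 then
      ∑ k ∈ Finset.range (N + 1), (-1) ^ k * lagCoeff (Function.update κ i k) f else 0 := by
  have key : ∀ α : τ →₀ ℕ, (∀ j, α j ≤ N) → ∀ a : ℝ,
      lagCoeff κ (face {i}ᶜ (monomial α a)) = if κ i = 0 then
      ∑ k ∈ Finset.range (N + 1), (-1) ^ k * lagCoeff (Function.update κ i k) (monomial α a)
      else 0 := by
    intro α hα a
    have hs : α.support ⊆ {i}ᶜ ↔ α i = 0 := by
      rw [← Finsupp.notMem_support_iff, Finset.subset_compl_comm, Finset.singleton_subset_iff,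
        Finset.mem_compl]
    rw [face_monomial]
    simp only [hs]
    have e : ∀ k, ∏ x, (((α x).choose (Function.update κ i k x) : ℝ) * (α x).factorial) =
        ((α i).choose k * (α i).factorial) *
        ∏ x ∈ Finset.univ.erase i, (((α x).choose (κ x) : ℝ) * (α x).factorial) := by
      intro k
      rw [← Finset.mul_prod_erase _ _ (Finset.mem_univ i), Function.update_self]
      congr 1
      refine Finset.prod_congr rfl fun x hx => ?_
      rw [Function.update_of_ne (Finset.ne_of_mem_erase hx)]
    have e' : ∏ x, (((α x).choose (κ x) : ℝ) * (α x).factorial) =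
        ((α i).choose (κ i) * (α i).factorial) *
        ∏ x ∈ Finset.univ.erase i, (((α x).choose (κ x) : ℝ) * (α x).factorial) :=
      (Finset.mul_prod_erase _ _ (Finset.mem_univ i)).symm
    -- The binomial expansion of `(1 - 1) ^ (α i)`.
    have hsum : ∑ k ∈ Finset.range (N + 1), (-1 : ℝ) ^ k * ((α i).choose k : ℝ) =
        if α i = 0 then 1 else 0 := by
      have h := Int.alternating_sum_range_choose (n := α i)
      rw [← Finset.sum_subset (Finset.range_mono (Nat.succ_le_succ (hα i)))]
      · exact_mod_cast h
      · intro k _ hk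
        rw [Nat.choose_eq_zero_of_lt (by simpa using hk)]
        simp
    simp only [lagCoeff_monomial, e]
    have hsum' : ∑ k ∈ Finset.range (N + 1), (-1 : ℝ) ^ k * (a * (((α i).choose k *
        (α i).factorial) * ∏ x ∈ Finset.univ.erase i,
          (((α x).choose (κ x) : ℝ) * (α x).factorial))) =
        (if α i = 0 then 1 else 0) * (a * ((α i).factorial * ∏ x ∈ Finset.univ.erase i,
          (((α x).choose (κ x) : ℝ) * (α x).factorial))) := by
      rw [← hsum, Finset.sum_mul]
      exact Finset.sum_congr rfl fun k _ => by ring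
    rw [hsum']
    by_cases h0 : α i = 0
    · rw [if_pos h0, if_pos h0, lagCoeff_monomial, e', h0]
      by_cases hκ : κ i = 0
      · simp [hκ]
      · rw [if_neg hκ, Nat.choose_eq_zero_of_lt (Nat.pos_of_ne_zero hκ)]
        simp
    · simp [h0]
  rw [f.as_sum]
  simp only [map_sum, Finset.mul_sum]
  rw [Finset.sum_congr rfl fun α hα => key α (hf α hα) _]
  split_ifs with h
  · rw [Finset.sum_comm]
  · simp

/-- The trace inequality: Cauchy–Schwarz on the `N + 1` terms of the alternating sum. Each variable
set to zero costs one power of the degree in the squared norm. -/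
theorem expInt_face_compl_sq_le {N : ℕ} {f : MvPolynomial τ ℝ} (hf : DegLE N f) (i : τ) :
    expInt τ (face {i}ᶜ f * face {i}ᶜ f) ≤ ((N : ℝ) + 1) * expInt τ (f * f) := by
  have hfd : DegLE N (face {i}ᶜ f) := by
    intro α hα
    refine hf α ?_
    rw [mem_support_iff, coeff_face] at hα
    rw [mem_support_iff]
    exact fun h => hα (by simp [h])
  rw [expInt_sq_eq_sum hf, expInt_sq_eq_sum hfd]
  refine sum_box_sq_le N i _ _ _ fun κ => ?_
  simp only [lagCoeff_face_compl hf, Function.update_self, Function.update_idem]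
  rw [Finset.sum_eq_single 0 (fun k _ hk => by simp [hk]) (by simp)]
  rw [if_pos rfl]
  refine (sq_sum_le_card_mul_sum_sq).trans ?_
  rw [Finset.card_range]
  push_cast
  refine mul_le_mul_of_nonneg_left (le_of_eq ?_) (by positivity)
  refine Finset.sum_congr rfl fun k _ => ?_
  rw [mul_pow, ← pow_mul, mul_comm k 2, pow_mul]
  simp

theorem expInt_face_sq_le {q : ℕ} {f : MvPolynomial τ ℝ} (hf : f.IsHomogeneous q)
    (F : Finset τ) :
    expInt τ (face F f * face F f) ≤ ((q : ℝ) + 1) ^ (Fᶜ.card) * expInt τ (f * f) := by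
  suffices H : ∀ S : Finset τ, expInt τ (face Sᶜ f * face Sᶜ f) ≤
      ((q : ℝ) + 1) ^ S.card * expInt τ (f * f) by
    simpa using H Fᶜ
  intro S
  induction S using Finset.induction_on with
  | empty => simp [face_univ]
  | insert i S hi ih =>
    have e : face (insert i S)ᶜ f = face {i}ᶜ (face Sᶜ f) := by
      rw [face_face]
      congr 2
      ext j
      simp
    rw [e, Finset.card_insert_of_notMem hi, pow_succ']
    refine (expInt_face_compl_sq_le (degLE_of_isHomogeneous (isHomogeneous_face hf)) i).trans ?_
    rw [mul_assoc]
    gcongr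

/-- The sum of the variables of a face. -/
noncomputable def psum (F : Finset τ) : MvPolynomial τ ℝ := ∑ i ∈ F, X i

theorem face_psum (F G : Finset τ) : face G (psum F) = psum (G ∩ F) := by
  simp only [psum, map_sum, face_X]
  rw [Finset.sum_ite_mem, Finset.inter_comm]

theorem isHomogeneous_psum (F : Finset τ) : (psum F).IsHomogeneous 1 :=
  IsHomogeneous.sum _ _ _ fun i _ => isHomogeneous_X ℝ i

theorem isHomogeneous_psum_sq_mul (F : Finset τ) {p : ℕ} {f : MvPolynomial τ ℝ}
    (hf : f.IsHomogeneous p) : (psum F ^ 2 * f).IsHomogeneous (p + 2) := by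
  have := ((isHomogeneous_psum F).pow 2).mul hf
  rwa [one_mul, add_comm] at this

theorem psum_ne_zero {F : Finset τ} (hF : F.Nonempty) : psum F ≠ 0 := by
  obtain ⟨i, hi⟩ := hF
  intro h
  have h1 := congrArg (eval fun j => if j = i then (1 : ℝ) else 0) h
  simp [psum, map_sum, hi] at h1

/-- Multiplying `x ^ α` by `x i` multiplies `α!` by `α i + 1`. If `α` is supported in `F`, summing
these factors over `F` gives `m + F.card`. -/
theorem expInt_psum_mul {m : ℕ} {F : Finset τ} {g : MvPolynomial τ ℝ} (hg : g.IsHomogeneous m)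
    (hgF : face F g = g) : expInt τ (psum F * g) = ((m : ℝ) + F.card) * expInt τ g := by
  have key : ∀ α : τ →₀ ℕ, α.support ⊆ F → α.degree = m → ∀ a : ℝ,
      expInt τ (psum F * monomial α a) = ((m : ℝ) + F.card) * expInt τ (monomial α a) := by
    intro α hα hd a
    have h1 : ∀ i, expInt τ (X i * monomial α a) = ((α i : ℝ) + 1) * expInt τ (monomial α a) := by
      intro i
      rw [X, monomial_mul, one_mul, expInt_monomial, expInt_monomial]
      rw [← Finset.mul_prod_erase _ _ (Finset.mem_univ i),
        ← Finset.mul_prod_erase Finset.univ (fun i => ((α i).factorial : ℝ)) (Finset.mem_univ i)]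
      have e1 : ∏ x ∈ Finset.univ.erase i, (((Finsupp.single i 1 + α : τ →₀ ℕ) x).factorial : ℝ) =
          ∏ x ∈ Finset.univ.erase i, ((α x).factorial : ℝ) := by
        refine Finset.prod_congr rfl fun x hx => ?_
        simp [(Finset.ne_of_mem_erase hx).symm]
      rw [e1, Finsupp.add_apply, Finsupp.single_eq_same, add_comm 1, Nat.factorial_succ]
      push_cast
      ring
    rw [psum, Finset.sum_mul, map_sum, Finset.sum_congr rfl fun i _ => h1 i, ← Finset.sum_mul,
      Finset.sum_add_distrib]
    congr 2
    · rw [← hd, Finsupp.degree_apply]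
      push_cast
      refine (Finset.sum_subset hα fun i _ hi => ?_).symm
      simpa using hi
    · simp
  rw [g.as_sum, Finset.mul_sum, map_sum, map_sum, Finset.mul_sum]
  refine Finset.sum_congr rfl fun α hα => key α ?_ ?_ _
  · by_contra h
    rw [mem_support_iff, ← hgF, coeff_face, if_neg h] at hα
    exact hα rfl
  · rw [Finsupp.degree_eq_weight_one]
    exact hg (mem_support_iff.1 hα)

theorem expInt_psum_sq_mul_sq {m : ℕ} {F : Finset τ} {b : MvPolynomial τ ℝ}
    (hb : b.IsHomogeneous m) (hbF : face F b = b) :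
    expInt τ ((psum F ^ 2 * b) * (psum F ^ 2 * b)) =
      (2 * m + 3 + F.card) * (2 * m + 2 + F.card) * (2 * m + 1 + F.card) * (2 * m + F.card) *
        expInt τ (b * b) := by
  have h0 : (b * b).IsHomogeneous (m + m) := hb.mul hb
  have hs := isHomogeneous_psum F
  have f0 : face F (b * b) = b * b := by rw [map_mul, hbF]
  have fs : face F (psum F) = psum F := by rw [face_psum, Finset.inter_self]
  have h1 := hs.mul h0
  have h2 := hs.mul h1
  have h3 := hs.mul h2
  have e : (psum F ^ 2 * b) * (psum F ^ 2 * b) = psum F * (psum F * (psum F * (psum F * (b * b))))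
    := by ring
  rw [e, expInt_psum_mul h3 (by simp only [map_mul, fs, hbF]),
    expInt_psum_mul h2 (by simp only [map_mul, fs, hbF]),
    expInt_psum_mul h1 (by simp only [map_mul, fs, hbF]), expInt_psum_mul h0 f0]
  push_cast
  ring

/-- Both sides are `expInt (b * b)` times four explicit factors. Each quotient `(2m + j + n) / (2m +
j + F.card)` is at most `n`, the number of variables, whatever `m` is; so extension from a face
costs no power of the degree. -/
theorem expInt_psum_univ_sq_mul_sq_le {m : ℕ} {F : Finset τ} (hF : F.Nonempty)
    {b : MvPolynomial τ ℝ} (hb : b.IsHomogeneous m) (hbF : face F b = b) :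
    expInt τ ((psum Finset.univ ^ 2 * b) * (psum Finset.univ ^ 2 * b)) ≤
      (Fintype.card τ : ℝ) ^ 4 * expInt τ ((psum F ^ 2 * b) * (psum F ^ 2 * b)) := by
  rw [expInt_psum_sq_mul_sq hb hbF, expInt_psum_sq_mul_sq hb (face_univ b), Finset.card_univ]
  have hn : (1 : ℝ) ≤ Fintype.card τ := by
    obtain ⟨i, -⟩ := hF
    have : Nonempty τ := ⟨i⟩
    exact_mod_cast Fintype.card_pos
  have hc : (1 : ℝ) ≤ F.card := by exact_mod_cast hF.card_pos
  set n : ℝ := (Fintype.card τ : ℝ)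
  set c : ℝ := (F.card : ℝ)
  have hb0 := expInt_sq_nonneg b
  have key : ∀ a : ℝ, 0 ≤ a → a + n ≤ n * (a + c) := by
    intro a ha
    nlinarith
  have hm : (0 : ℝ) ≤ m := by positivity
  have e : n ^ 4 * ((2 * m + 3 + c) * (2 * m + 2 + c) * (2 * m + 1 + c) * (2 * m + c) *
      expInt τ (b * b)) = (n * (2 * m + 3 + c)) * (n * (2 * m + 2 + c)) * (n * (2 * m + 1 + c)) *
        (n * (2 * m + c)) * expInt τ (b * b) := by ring
  rw [e]
  gcongr <;> exact key _ (by positivity)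

/-- The polynomials of degree `p` on the face `F` that vanish on the boundary of that face. -/
def bubble (F : Finset τ) (p : ℕ) : Submodule ℝ (MvPolynomial τ ℝ) where
  carrier := {f | ∀ α, coeff α f ≠ 0 → α.support = F ∧ α.degree = p}
  zero_mem' := by simp
  add_mem' := by
    intro f g hf hg α hα
    by_cases h : coeff α f = 0
    · exact hg α fun h' => hα (by simp [h, h'])
    · exact hf α h
  smul_mem' := by
    intro c f hf α hα
    refine hf α fun h => hα (by simp [h])

theorem isHomogeneous_of_mem_bubble {F : Finset τ} {p : ℕ} {f : MvPolynomial τ ℝ}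
    (hf : f ∈ bubble F p) : f.IsHomogeneous p := by
  intro α hα
  rw [← (hf α hα).2, Finsupp.degree_eq_weight_one]
  rfl

theorem face_eq_self_of_mem_bubble {F G : Finset τ} {p : ℕ} {f : MvPolynomial τ ℝ}
    (hf : f ∈ bubble F p) (h : F ⊆ G) : face G f = f := by
  ext α
  rw [coeff_face]
  split_ifs with hα
  · rfl
  · by_contra h0
    exact hα (((hf α (Ne.symm h0)).1).symm ▸ h)

theorem face_eq_zero_of_mem_bubble {F G : Finset τ} {p : ℕ} {f : MvPolynomial τ ℝ}
    (hf : f ∈ bubble F p) (h : ¬ F ⊆ G) : face G f = 0 := by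
  ext α
  rw [coeff_face, coeff_zero]
  split_ifs with hα
  · by_contra h0
    exact h ((hf α h0).1 ▸ hα)
  · rfl

/-- A monomial of `f` whose support is a proper subset of `F` would survive restriction to that
subset, which has at most `k` elements. -/
theorem face_mem_bubble {p k : ℕ} {f : MvPolynomial τ ℝ} (hf : f.IsHomogeneous p)
    (hk : ∀ G : Finset τ, G.card ≤ k → face G f = 0) {F : Finset τ} (hF : F.card = k + 1) :
    face F f ∈ bubble F p := by
  intro α hα
  rw [coeff_face] at hα
  have hs : α.support ⊆ F := by
    by_contra h
    rw [if_neg h] at hα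
    exact hα rfl
  rw [if_pos hs] at hα
  refine ⟨?_, ?_⟩
  · by_contra hne
    have hlt := Finset.card_lt_card (hs.ssubset_of_ne hne)
    have := congrArg (coeff α) (hk α.support (by omega))
    rw [coeff_face, if_pos subset_rfl] at this
    exact hα this
  · rw [Finsupp.degree_eq_weight_one]
    exact hf hα

theorem rename_mem_bubble {F : Finset τ} {p : ℕ} {f : MvPolynomial τ ℝ} (e : Equiv.Perm τ)
    (hf : f ∈ bubble F p) : rename e f ∈ bubble (F.map e.toEmbedding) p := by
  intro α hα
  obtain ⟨β, rfl, hβ⟩ := coeff_rename_ne_zero _ _ _ hα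
  obtain ⟨h1, h2⟩ := hf β hβ
  refine ⟨?_, ?_⟩
  · rw [Finsupp.mapDomain_support_of_injective e.injective, h1, Finset.map_eq_image]
    rfl
  · rw [← h2, Finsupp.degree_eq_sum, Finsupp.degree_eq_sum, ← Equiv.sum_comp e]
    exact Finset.sum_congr rfl fun i _ => Finsupp.mapDomain_apply e.injective _ _

theorem rename_face (F : Finset τ) (e : Equiv.Perm τ) (f : MvPolynomial τ ℝ) :
    rename e (face F f) = face (F.map e.toEmbedding) (rename e f) := by
  induction f using MvPolynomial.induction_on with
  | C a => simp [face]
  | add p q hp hq => simp [hp, hq]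
  | mul_X p i hp =>
    simp only [map_mul, hp, rename_X, face_X]
    congr 1
    by_cases h : i ∈ F <;> simp [h]

theorem rename_psum (F : Finset τ) (e : Equiv.Perm τ) :
    rename e (psum F) = psum (F.map e.toEmbedding) := by
  simp [psum, map_sum]

theorem expInt_rename (e : Equiv.Perm τ) (f : MvPolynomial τ ℝ) :
    expInt τ (rename e f) = expInt τ f := by
  induction f using MvPolynomial.induction_on' with
  | add p q hp hq => simp [hp, hq]
  | monomial α a =>
    rw [rename_monomial, expInt_monomial, expInt_monomial]
    congr 1
    rw [← Equiv.prod_comp e]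
    refine Finset.prod_congr rfl fun i _ => ?_
    rw [Finsupp.mapDomain_apply e.injective]

instance (F : Finset τ) (p : ℕ) : FiniteDimensional ℝ (bubble F p) := by
  have h : bubble F p ≤ restrictTotalDegree τ ℝ p := by
    intro f hf
    rw [mem_restrictTotalDegree]
    exact (isHomogeneous_of_mem_bubble hf).totalDegree_le
  exact Submodule.finiteDimensional_of_le h

/-- The polynomial `psum F ^ 2 * D f` is the orthogonal projection of `f` onto `psum F ^ 2` times
the bubbles. It exists because the form `(b, c) ↦ expInt (psum F ^ 2 * b * (psum F ^ 2 * c))` is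
definite on a finite-dimensional space. -/
theorem exists_reduction {F : Finset τ} (hF : F.Nonempty) (p : ℕ) :
    ∃ D : MvPolynomial τ ℝ →ₗ[ℝ] MvPolynomial τ ℝ, ∀ f, D f ∈ bubble F p ∧
      ∀ b ∈ bubble F p, expInt τ ((f - psum F ^ 2 * D f) * (psum F ^ 2 * b)) = 0 := by
  let m : MvPolynomial τ ℝ →ₗ[ℝ] MvPolynomial τ ℝ := LinearMap.mulLeft ℝ (psum F ^ 2)
  let β : LinearMap.BilinForm ℝ (MvPolynomial τ ℝ) :=
    (LinearMap.mul ℝ (MvPolynomial τ ℝ)).compr₂ (expInt τ)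
  let γ : MvPolynomial τ ℝ →ₗ[ℝ] Module.Dual ℝ (bubble F p) :=
    β.compl₂ (m ∘ₗ (bubble F p).subtype)
  let δ : LinearMap.BilinForm ℝ (bubble F p) := γ ∘ₗ (m ∘ₗ (bubble F p).subtype)
  have hδ : ∀ b c : bubble F p, δ b c = expInt τ ((psum F ^ 2 * b) * (psum F ^ 2 * c)) :=
    fun _ _ => rfl
  have hz : ∀ b : bubble F p, δ b b = 0 → b = 0 := by
    intro b hb
    rw [hδ] at hb
    have := eq_zero_of_expInt_sq hb
    rcases mul_eq_zero.1 this with h | h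
    · exact absurd h (pow_ne_zero _ (psum_ne_zero hF))
    · exact Subtype.ext h
  have hnd : δ.Nondegenerate := by
    constructor
    · intro b hb
      exact hz b (hb b)
    · intro b hb
      exact hz b (hb b)
  refine ⟨(bubble F p).subtype ∘ₗ (LinearMap.BilinForm.toDual δ hnd).symm.toLinearMap ∘ₗ γ,
    fun f => ⟨Subtype.coe_prop _, fun b hb => ?_⟩⟩
  have h := LinearMap.BilinForm.apply_toDual_symm_apply (B := δ) (hB := hnd) (γ f) ⟨b, hb⟩
  rw [hδ] at h
  rw [sub_mul, map_sub, sub_eq_zero]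
  exact h.symm

end Faces

end HpFem

namespace HpFem

open MvPolynomial

/-! ### The degree reduction: algebraic properties and stability. -/

section Reduction

variable {τ : Type*} [Fintype τ] [DecidableEq τ]

/-- Degree reduction on the bubble functions of one face, by orthogonal projection. -/
noncomputable def faceReduce (p : ℕ) (F : Finset τ) :
    MvPolynomial τ ℝ →ₗ[ℝ] MvPolynomial τ ℝ :=
  if h : F.Nonempty then (exists_reduction h p).choose else 0

theorem faceReduce_mem (p : ℕ) (F : Finset τ) (f : MvPolynomial τ ℝ) :
    faceReduce p F f ∈ bubble F p := by
  rw [faceReduce]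
  split_ifs with h
  · exact ((exists_reduction h p).choose_spec f).1
  · exact zero_mem _

theorem faceReduce_orthogonal {p : ℕ} {F : Finset τ} (hF : F.Nonempty) (f : MvPolynomial τ ℝ)
    {b : MvPolynomial τ ℝ} (hb : b ∈ bubble F p) :
    expInt τ ((f - psum F ^ 2 * faceReduce p F f) * (psum F ^ 2 * b)) = 0 := by
  rw [faceReduce, dif_pos hF]
  exact ((exists_reduction hF p).choose_spec f).2 b hb

/-- Orthogonality determines the projection. Reproduction of bubbles and equivariance under
permutations follow from this, although the projection itself is obtained by choice. -/
theorem faceReduce_unique {p : ℕ} {F : Finset τ} (hF : F.Nonempty) {f c : MvPolynomial τ ℝ}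
    (hc : c ∈ bubble F p)
    (h : ∀ b ∈ bubble F p, expInt τ ((f - psum F ^ 2 * c) * (psum F ^ 2 * b)) = 0) :
    faceReduce p F f = c := by
  have hd : faceReduce p F f - c ∈ bubble F p := sub_mem (faceReduce_mem p F f) hc
  have h1 := faceReduce_orthogonal hF f hd
  have h2 := h _ hd
  have h3 : expInt τ ((psum F ^ 2 * (faceReduce p F f - c)) *
      (psum F ^ 2 * (faceReduce p F f - c))) = 0 := by
    have e : (psum F ^ 2 * (faceReduce p F f - c)) * (psum F ^ 2 * (faceReduce p F f - c)) =
      (f - psum F ^ 2 * c) * (psum F ^ 2 * (faceReduce p F f - c)) -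
      (f - psum F ^ 2 * faceReduce p F f) * (psum F ^ 2 * (faceReduce p F f - c)) := by ring
    rw [e, map_sub, h1, h2, sub_zero]
  rcases mul_eq_zero.1 (eq_zero_of_expInt_sq h3) with h4 | h4
  · exact absurd h4 (pow_ne_zero _ (psum_ne_zero hF))
  · exact sub_eq_zero.1 h4

theorem faceReduce_psum_sq_mul {p : ℕ} {F : Finset τ} (hF : F.Nonempty) {b : MvPolynomial τ ℝ}
    (hb : b ∈ bubble F p) : faceReduce p F (psum F ^ 2 * b) = b :=
  faceReduce_unique hF hb fun c _ => by simp

theorem rename_faceReduce {p : ℕ} {F : Finset τ} (hF : F.Nonempty) (e : Equiv.Perm τ)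
    (f : MvPolynomial τ ℝ) :
    rename e (faceReduce p F f) = faceReduce p (F.map e.toEmbedding) (rename e f) := by
  symm
  refine faceReduce_unique (hF.map) (rename_mem_bubble e (faceReduce_mem p F f)) fun b hb => ?_
  have hb' : rename e.symm b ∈ bubble F p := by
    have := rename_mem_bubble e.symm hb
    rwa [Finset.map_map, show e.toEmbedding.trans e.symm.toEmbedding = Function.Embedding.refl _
      from by ext; simp, Finset.map_refl] at this
  have h := faceReduce_orthogonal hF f hb'
  rw [← expInt_rename e] at h
  simpa [rename_psum, rename_rename] using h

/-- Pythagoras: neither the projection nor its defect exceeds the norm of `f`, so projecting costs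
no constant. -/
theorem expInt_faceReduce_sq_add {p : ℕ} {F : Finset τ} (hF : F.Nonempty)
    (f : MvPolynomial τ ℝ) :
    expInt τ ((psum F ^ 2 * faceReduce p F f) * (psum F ^ 2 * faceReduce p F f)) +
      expInt τ ((f - psum F ^ 2 * faceReduce p F f) * (f - psum F ^ 2 * faceReduce p F f)) =
      expInt τ (f * f) := by
  have h := faceReduce_orthogonal hF f (faceReduce_mem p F f)
  set g := psum F ^ 2 * faceReduce p F f
  have e : f * f = g * g + (f - g) * (f - g) + 2 • ((f - g) * g) := by
    rw [two_nsmul]; ring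
  rw [e]
  simp only [map_add, map_nsmul, h]
  simp

/-- The part of a polynomial that one stage of the reduction removes: the stage treats all faces
with `k + 1` vertices. -/
noncomputable def stage (p k : ℕ) : MvPolynomial τ ℝ →ₗ[ℝ] MvPolynomial τ ℝ :=
  ∑ F ∈ Finset.powersetCard (k + 1) Finset.univ,
    ((face F).toLinearMap +
      LinearMap.mulLeft ℝ (psum Finset.univ ^ 2 - psum F ^ 2) ∘ₗ faceReduce p F ∘ₗ
        (face F).toLinearMap)

theorem stage_apply (p k : ℕ) (f : MvPolynomial τ ℝ) :
    stage p k f = ∑ F ∈ Finset.powersetCard (k + 1) Finset.univ,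
      (face F f + (psum Finset.univ ^ 2 - psum F ^ 2) * faceReduce p F (face F f)) := by
  simp [stage, LinearMap.sum_apply]

/-- What is left before stage `k` of the reduction. -/
noncomputable def resid (p : ℕ) : ℕ → (MvPolynomial τ ℝ →ₗ[ℝ] MvPolynomial τ ℝ)
  | 0 => LinearMap.id
  | k + 1 => resid p k - stage p k ∘ₗ resid p k

theorem resid_succ_apply (p k : ℕ) (f : MvPolynomial τ ℝ) :
    resid p (k + 1) f = resid p k f - stage p k (resid p k f) := rfl

/-- Degree reduction by two on homogeneous polynomials in barycentric coordinates. -/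
noncomputable def reduce (p : ℕ) : MvPolynomial τ ℝ →ₗ[ℝ] MvPolynomial τ ℝ :=
  ∑ k ∈ Finset.range (Fintype.card τ), ∑ F ∈ Finset.powersetCard (k + 1) Finset.univ,
    faceReduce p F ∘ₗ (face F).toLinearMap ∘ₗ resid p k

theorem reduce_apply (p : ℕ) (f : MvPolynomial τ ℝ) :
    reduce p f = ∑ k ∈ Finset.range (Fintype.card τ),
      ∑ F ∈ Finset.powersetCard (k + 1) Finset.univ, faceReduce p F (face F (resid p k f)) := by
  simp [reduce, LinearMap.sum_apply]

theorem isHomogeneous_reduce (p : ℕ) (f : MvPolynomial τ ℝ) : (reduce p f).IsHomogeneous p := by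
  rw [reduce_apply]
  exact IsHomogeneous.sum _ _ _ fun k _ => IsHomogeneous.sum _ _ _ fun F _ =>
    isHomogeneous_of_mem_bubble (faceReduce_mem p F _)

theorem nonempty_of_mem_powersetCard_succ {k : ℕ} {F : Finset τ}
    (hF : F ∈ Finset.powersetCard (k + 1) Finset.univ) : F.Nonempty := by
  rw [← Finset.card_pos, (Finset.mem_powersetCard.1 hF).2]
  omega

theorem isHomogeneous_stage {p k : ℕ} {f : MvPolynomial τ ℝ} (hf : f.IsHomogeneous (p + 2)) :
    (stage p k f).IsHomogeneous (p + 2) := by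
  rw [stage_apply]
  refine IsHomogeneous.sum _ _ _ fun F _ => (isHomogeneous_face hf).add ?_
  have hb := isHomogeneous_of_mem_bubble (faceReduce_mem p F (face F f))
  rw [sub_mul]
  exact (isHomogeneous_psum_sq_mul _ hb).sub (isHomogeneous_psum_sq_mul _ hb)

theorem isHomogeneous_resid {p : ℕ} {f : MvPolynomial τ ℝ} (hf : f.IsHomogeneous (p + 2))
    (k : ℕ) : (resid p k f).IsHomogeneous (p + 2) := by
  induction k with
  | zero => exact hf
  | succ k ih => exact ih.sub (isHomogeneous_stage ih)

theorem face_empty {p : ℕ} {f : MvPolynomial τ ℝ} (hf : f.IsHomogeneous p) (hp : p ≠ 0) :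
    face ∅ f = 0 := by
  ext α
  rw [coeff_face, coeff_zero]
  split_ifs with h
  · by_contra h0
    have h1 := hf h0
    rw [Finset.subset_empty, Finsupp.support_eq_empty] at h
    rw [h, map_zero] at h1
    exact hp h1.symm
  · rfl

/-- A face of at most `k + 1` vertices sees from the sum over all faces with `k + 1` vertices at
most its own term. -/
theorem face_sum_eq {k q : ℕ} {f : MvPolynomial τ ℝ} (hf : f.IsHomogeneous q)
    (hk : ∀ G : Finset τ, G.card ≤ k → face G f = 0) {G : Finset τ} (hG : G.card ≤ k + 1) :
    ∑ F ∈ Finset.powersetCard (k + 1) Finset.univ, face G (face F f) = face G f := by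
  by_cases hc : G.card = k + 1
  · rw [Finset.sum_eq_single G]
    · rw [face_face, Finset.inter_self]
    · intro F hF hne
      refine face_eq_zero_of_mem_bubble (face_mem_bubble hf hk (Finset.mem_powersetCard.1 hF).2)
        fun hs => hne ?_
      exact Finset.eq_of_subset_of_card_le hs
        (by rw [hc, (Finset.mem_powersetCard.1 hF).2])
    · intro h
      exact absurd (Finset.mem_powersetCard.2 ⟨Finset.subset_univ _, hc⟩) h
  · rw [hk G (by omega)]
    refine Finset.sum_eq_zero fun F hF => ?_
    rw [face_face]
    exact hk _ ((Finset.card_le_card Finset.inter_subset_left).trans (by omega))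

/-- The correction `(psum univ ^ 2 - psum F ^ 2) * D_F` is invisible on faces with at most `k + 1`
vertices: on `F` itself the two sums coincide, and on the other faces the bubble `D_F` vanishes. -/
theorem face_stage {p k : ℕ} {f : MvPolynomial τ ℝ} (hf : f.IsHomogeneous (p + 2))
    (hk : ∀ G : Finset τ, G.card ≤ k → face G f = 0) {G : Finset τ} (hG : G.card ≤ k + 1) :
    face G (stage p k f) = face G f := by
  rw [stage_apply, map_sum, ← face_sum_eq hf hk hG]
  refine Finset.sum_congr rfl fun F hF => ?_
  rw [map_add, map_mul, add_eq_left]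
  by_cases h : F ⊆ G
  · have : F = G := Finset.eq_of_subset_of_card_le h
      (by rw [(Finset.mem_powersetCard.1 hF).2]; exact hG)
    subst this
    rw [map_sub, map_pow, map_pow, face_psum, face_psum]
    simp
  · rw [face_eq_zero_of_mem_bubble (faceReduce_mem p F _) h, mul_zero]

theorem face_resid_eq_zero {p : ℕ} {f : MvPolynomial τ ℝ} (hf : f.IsHomogeneous (p + 2)) (k : ℕ) :
    ∀ G : Finset τ, G.card ≤ k → face G (resid p k f) = 0 := by
  induction k with
  | zero =>
    intro G hG
    rw [Nat.le_zero, Finset.card_eq_zero] at hG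
    subst hG
    exact face_empty hf (by omega)
  | succ k ih =>
    intro G hG
    rw [resid_succ_apply, map_sub, face_stage (isHomogeneous_resid hf k) ih hG, sub_self]

theorem sum_stage_resid {p : ℕ} {f : MvPolynomial τ ℝ} (hf : f.IsHomogeneous (p + 2)) :
    ∑ k ∈ Finset.range (Fintype.card τ), stage p k (resid p k f) = f := by
  have h : ∀ n, ∑ k ∈ Finset.range n, stage p k (resid p k f) = f - resid p n f := by
    intro n
    induction n with
    | zero => simp [resid]
    | succ n ih => rw [Finset.sum_range_succ, ih, resid_succ_apply]; abel
  rw [h, ← face_univ (resid p _ f), face_resid_eq_zero hf _ _ (by simp [Finset.card_univ]),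
    sub_zero]

/-- The residual vanishes after the last stage, so `f` is the sum of all the removed parts.
Subtracting `psum univ ^ 2 * D_F` from each of these leaves the projection defect on `F`. -/
theorem sub_reduce_eq_sum {p : ℕ} {f : MvPolynomial τ ℝ} (hf : f.IsHomogeneous (p + 2)) :
    f - psum Finset.univ ^ 2 * reduce p f = ∑ k ∈ Finset.range (Fintype.card τ),
      ∑ F ∈ Finset.powersetCard (k + 1) Finset.univ,
        (face F (resid p k f) - psum F ^ 2 * faceReduce p F (face F (resid p k f))) := by
  have h := sum_stage_resid hf
  rw [reduce_apply, Finset.mul_sum, ← sub_eq_zero]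
  nth_rewrite 1 [← h]
  rw [← Finset.sum_sub_distrib, sub_eq_zero]
  refine Finset.sum_congr rfl fun k _ => ?_
  rw [stage_apply, Finset.mul_sum, ← Finset.sum_sub_distrib]
  exact Finset.sum_congr rfl fun F _ => by ring

/-- All residuals keep the form `s * u`. Restricted to `F` such a residual is `psum F ^ 2` times the
bubble `face F u`, which the projection recovers exactly. For `p = 0` a constant would not vanish on
the empty face, where the induction starts. -/
theorem reduce_psum_sq_mul {p : ℕ} (hp : p ≠ 0) {w : MvPolynomial τ ℝ} (hw : w.IsHomogeneous p) :
    reduce p (psum Finset.univ ^ 2 * w) = w := by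
  set s : MvPolynomial τ ℝ := psum Finset.univ ^ 2 with hs
  have hD : ∀ k : ℕ, ∀ u : MvPolynomial τ ℝ, u.IsHomogeneous p →
      (∀ G : Finset τ, G.card ≤ k → face G u = 0) →
      ∀ F ∈ Finset.powersetCard (k + 1) Finset.univ, face F (s * u) = psum F ^ 2 * face F u ∧
        faceReduce p F (face F (s * u)) = face F u := by
    intro k u hu hk F hF
    have h1 : face F (s * u) = psum F ^ 2 * face F u := by
      rw [hs, map_mul, map_pow, face_psum, Finset.inter_univ]
    refine ⟨h1, ?_⟩
    rw [h1, faceReduce_psum_sq_mul (nonempty_of_mem_powersetCard_succ hF)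
      (face_mem_bubble hu hk (Finset.mem_powersetCard.1 hF).2)]
  have main : ∀ n, ∃ u : MvPolynomial τ ℝ, u.IsHomogeneous p ∧
      (∀ G : Finset τ, G.card ≤ n → face G u = 0) ∧ resid p n (s * w) = s * u ∧
      ∑ k ∈ Finset.range n, ∑ F ∈ Finset.powersetCard (k + 1) Finset.univ,
        faceReduce p F (face F (resid p k (s * w))) = w - u := by
    intro n
    induction n with
    | zero =>
      refine ⟨w, hw, fun G hG => ?_, rfl, by simp⟩
      rw [Nat.le_zero, Finset.card_eq_zero] at hG
      subst hG
      exact face_empty hw hp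
    | succ n ih =>
      obtain ⟨u, hu, hz, hr, hsum⟩ := ih
      -- Stage `n` transfers the restrictions of `u` to the faces with `n + 1` vertices from the
      -- residual to the result.
      refine ⟨u - ∑ F ∈ Finset.powersetCard (n + 1) Finset.univ, face F u, ?_, ?_, ?_, ?_⟩
      · exact hu.sub (IsHomogeneous.sum _ _ _ fun F _ => isHomogeneous_face hu)
      · intro G hG
        rw [map_sub, map_sum, face_sum_eq hu hz hG, sub_self]
      · rw [resid_succ_apply, hr, stage_apply, mul_sub, Finset.mul_sum]
        congr 1
        refine Finset.sum_congr rfl fun F hF => ?_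
        rw [(hD n u hu hz F hF).2, (hD n u hu hz F hF).1]
        ring
      · rw [Finset.sum_range_succ, hsum, hr,
          Finset.sum_congr rfl fun F hF => (hD n u hu hz F hF).2]
        abel
  obtain ⟨u, -, hz, -, hsum⟩ := main (Fintype.card τ)
  rw [reduce_apply, hsum, ← face_univ u, hz _ (by simp [Finset.card_univ]), sub_zero]

theorem sum_powersetCard_map {M : Type*} [AddCommMonoid M] (e : Equiv.Perm τ) (k : ℕ)
    (g : Finset τ → M) :
    ∑ F ∈ Finset.powersetCard k Finset.univ, g (F.map e.toEmbedding) =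
      ∑ F ∈ Finset.powersetCard k Finset.univ, g F := by
  refine Finset.sum_nbij' (fun F => F.map e.toEmbedding) (fun F => F.map e.symm.toEmbedding)
    ?_ ?_ ?_ ?_ ?_
  · intro F hF
    simpa [Finset.mem_powersetCard] using hF
  · intro F hF
    simpa [Finset.mem_powersetCard] using hF
  · intro F _
    ext; simp
  · intro F _
    ext; simp
  · intro F _
    rfl

theorem rename_stage (p k : ℕ) (e : Equiv.Perm τ) (f : MvPolynomial τ ℝ) :
    rename e (stage p k f) = stage p k (rename e f) := by
  rw [stage_apply, stage_apply, map_sum]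
  refine Eq.trans ?_ (sum_powersetCard_map e _ _)
  refine Finset.sum_congr rfl fun F hF => ?_
  rw [map_add, map_mul, map_sub, map_pow, map_pow, rename_psum, rename_psum, rename_face,
    rename_faceReduce (nonempty_of_mem_powersetCard_succ hF), rename_face]
  simp

theorem rename_resid (p k : ℕ) (e : Equiv.Perm τ) (f : MvPolynomial τ ℝ) :
    rename e (resid p k f) = resid p k (rename e f) := by
  induction k with
  | zero => rfl
  | succ k ih => rw [resid_succ_apply, resid_succ_apply, map_sub, rename_stage, ih]

theorem rename_reduce (p : ℕ) (e : Equiv.Perm τ) (f : MvPolynomial τ ℝ) :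
    rename e (reduce p f) = reduce p (rename e f) := by
  rw [reduce_apply, reduce_apply, map_sum]
  refine Finset.sum_congr rfl fun k _ => ?_
  rw [map_sum]
  refine Eq.trans ?_ (sum_powersetCard_map e _ _)
  refine Finset.sum_congr rfl fun F hF => ?_
  rw [rename_faceReduce (nonempty_of_mem_powersetCard_succ hF), rename_face, rename_resid]

/-- Vanishing on `G` passes to every residual. A face inside `G` then contributes nothing, and the
bubble of any other face vanishes on `G`. -/
theorem face_reduce_eq_zero {p : ℕ} {f : MvPolynomial τ ℝ} (hf : f.IsHomogeneous (p + 2))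
    {G : Finset τ} (hG : face G f = 0) : face G (reduce p f) = 0 := by
  have hsub : ∀ g : MvPolynomial τ ℝ, face G g = 0 → ∀ F ⊆ G, face F g = 0 := by
    intro g hg F hF
    rw [← Finset.inter_eq_left.2 hF, ← face_face, hg, map_zero]
  have hr : ∀ k, face G (resid p k f) = 0 := by
    intro k
    induction k with
    | zero => exact hG
    | succ k ih =>
      rw [resid_succ_apply, map_sub, ih, zero_sub, neg_eq_zero, stage_apply, map_sum]
      refine Finset.sum_eq_zero fun F hF => ?_
      by_cases h : F ⊆ G
      · rw [hsub _ ih F h]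
        simp
      · rw [map_add, map_mul, face_eq_zero_of_mem_bubble (faceReduce_mem p F _) h, mul_zero,
          add_zero]
        exact face_eq_zero_of_mem_bubble (face_mem_bubble (isHomogeneous_resid hf k)
          (face_resid_eq_zero hf k) (Finset.mem_powersetCard.1 hF).2) h
  rw [reduce_apply, map_sum]
  refine Finset.sum_eq_zero fun k _ => ?_
  rw [map_sum]
  refine Finset.sum_eq_zero fun F _ => ?_
  by_cases h : F ⊆ G
  · rw [hsub _ (hr k) F h]
    simp
  · exact face_eq_zero_of_mem_bubble (faceReduce_mem p F _) h

/-! ### Stability -/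

theorem card_powersetCard_le (k : ℕ) :
    ((Finset.powersetCard k (Finset.univ : Finset τ)).card : ℝ) ≤ 2 ^ Fintype.card τ := by
  rw [Finset.card_powersetCard, Finset.card_univ]
  exact_mod_cast Nat.choose_le_two_pow _ _

theorem expInt_face_sq_le_pow {q k : ℕ} {f : MvPolynomial τ ℝ} (hf : f.IsHomogeneous q)
    {F : Finset τ} (hF : F ∈ Finset.powersetCard (k + 1) Finset.univ) :
    expInt τ (face F f * face F f) ≤
      ((q : ℝ) + 1) ^ (Fintype.card τ - (k + 1)) * expInt τ (f * f) := by
  have h := expInt_face_sq_le hf F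
  rwa [Finset.card_compl, (Finset.mem_powersetCard.1 hF).2] at h

/-- A constant for one stage of the reduction. -/
noncomputable def stageConst (n : ℕ) : ℝ :=
  2 * (1 + 2 ^ n * (2 ^ n * (4 * (2 + (n : ℝ) ^ 4))))

theorem one_le_stageConst (n : ℕ) : 1 ≤ stageConst n := by
  have : (0 : ℝ) ≤ 2 ^ n * (2 ^ n * (4 * (2 + (n : ℝ) ^ 4))) := by positivity
  rw [stageConst]
  linarith

theorem expInt_resid_succ_sq_le {p : ℕ} {f : MvPolynomial τ ℝ} (hf : f.IsHomogeneous (p + 2))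
    (k : ℕ) :
    expInt τ (resid p (k + 1) f * resid p (k + 1) f) ≤
      stageConst (Fintype.card τ) * (((p + 2 : ℕ) : ℝ) + 1) ^ (Fintype.card τ - (k + 1)) *
        expInt τ (resid p k f * resid p k f) := by
  set r := resid p k f
  have hr : r.IsHomogeneous (p + 2) := isHomogeneous_resid hf k
  set n := Fintype.card τ
  set Y : ℝ := (((p + 2 : ℕ) : ℝ) + 1) ^ (n - (k + 1)) with hY
  have hY1 : 1 ≤ Y := one_le_pow₀ (by linarith [Nat.cast_nonneg (α := ℝ) (p + 2)])
  have hterm : ∀ F ∈ Finset.powersetCard (k + 1) (Finset.univ : Finset τ),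
      expInt τ ((face F r + (psum Finset.univ ^ 2 - psum F ^ 2) * faceReduce p F (face F r)) *
        (face F r + (psum Finset.univ ^ 2 - psum F ^ 2) * faceReduce p F (face F r))) ≤
        4 * (2 + (n : ℝ) ^ 4) * (Y * expInt τ (r * r)) := by
    intro F hF
    have hne := nonempty_of_mem_powersetCard_succ hF
    set b := faceReduce p F (face F r)
    have hb : b ∈ bubble F p := faceReduce_mem p F _
    have h1 := expInt_faceReduce_sq_add (p := p) hne (face F r)
    have h2 := expInt_psum_univ_sq_mul_sq_le hne (isHomogeneous_of_mem_bubble hb)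
      (face_eq_self_of_mem_bubble hb subset_rfl)
    have h3 := expInt_face_sq_le_pow hr hF
    have h4 := expInt_sq_nonneg (face F r - psum F ^ 2 * b)
    have h5 := expInt_sq_nonneg (psum F ^ 2 * b)
    -- The projection defect, bounded by Pythagoras, plus a bubble extended to the whole simplex,
    -- bounded by `expInt_psum_univ_sq_mul_sq_le`.
    have e : face F r + (psum Finset.univ ^ 2 - psum F ^ 2) * b =
        (face F r - psum F ^ 2 * b) + psum Finset.univ ^ 2 * b := by ring
    rw [e]
    refine (expInt_add_sq_le _ _).trans ?_
    have h6 : expInt τ ((psum F ^ 2 * b) * (psum F ^ 2 * b)) ≤ Y * expInt τ (r * r) := by linarith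
    have h7 : expInt τ ((face F r - psum F ^ 2 * b) * (face F r - psum F ^ 2 * b)) ≤
      Y * expInt τ (r * r) := by linarith
    have h8 : (n : ℝ) ^ 4 * expInt τ ((psum F ^ 2 * b) * (psum F ^ 2 * b)) ≤
      (n : ℝ) ^ 4 * (Y * expInt τ (r * r)) := by gcongr
    have h9 : 0 ≤ Y * expInt τ (r * r) := h5.trans h6
    have h10 : 0 ≤ (n : ℝ) ^ 4 * (Y * expInt τ (r * r)) := by positivity
    nlinarith
  have hst : expInt τ (stage p k r * stage p k r) ≤
      2 ^ n * (2 ^ n * (4 * (2 + (n : ℝ) ^ 4) * (Y * expInt τ (r * r)))) := by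
    rw [stage_apply]
    refine (expInt_sum_sq_le _ _).trans ?_
    have hc : ((Finset.powersetCard (k + 1) (Finset.univ : Finset τ)).card : ℝ) ≤ 2 ^ n :=
      card_powersetCard_le _
    have h0 := expInt_sq_nonneg r
    refine mul_le_mul hc ?_ (Finset.sum_nonneg fun F _ => expInt_sq_nonneg _) (by positivity)
    refine (Finset.sum_le_sum hterm).trans ?_
    rw [Finset.sum_const, nsmul_eq_mul]
    gcongr
  rw [resid_succ_apply, sub_eq_add_neg]
  refine (expInt_add_sq_le _ _).trans ?_
  rw [neg_mul_neg]
  have h0 := expInt_sq_nonneg r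
  have h1 : expInt τ (r * r) ≤ Y * expInt τ (r * r) := le_mul_of_one_le_left h0 hY1
  calc 2 * (expInt τ (r * r) + expInt τ (stage p k r * stage p k r))
      ≤ 2 * (Y * expInt τ (r * r) +
        2 ^ n * (2 ^ n * (4 * (2 + (n : ℝ) ^ 4) * (Y * expInt τ (r * r))))) := by
        gcongr
    _ = _ := by rw [stageConst]; ring

theorem expInt_resid_sq_le {p : ℕ} {f : MvPolynomial τ ℝ} (hf : f.IsHomogeneous (p + 2)) (k : ℕ) :
    expInt τ (resid p k f * resid p k f) ≤ stageConst (Fintype.card τ) ^ k *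
      (((p + 2 : ℕ) : ℝ) + 1) ^ (∑ j ∈ Finset.range k, (Fintype.card τ - (j + 1))) *
        expInt τ (f * f) := by
  induction k with
  | zero => simp [resid]
  | succ k ih =>
    refine (expInt_resid_succ_sq_le hf k).trans ?_
    rw [Finset.sum_range_succ, pow_add, pow_succ]
    have h1 := one_le_stageConst (Fintype.card τ)
    have h0 : 0 ≤ stageConst (Fintype.card τ) := by linarith
    calc _ ≤ stageConst (Fintype.card τ) *
        (((p + 2 : ℕ) : ℝ) + 1) ^ (Fintype.card τ - (k + 1)) *
        (stageConst (Fintype.card τ) ^ k * (((p + 2 : ℕ) : ℝ) + 1) ^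
          (∑ j ∈ Finset.range k, (Fintype.card τ - (j + 1))) * expInt τ (f * f)) := by gcongr
      _ = _ := by ring

/-- Stability of the reduction. -/
theorem expInt_sub_reduce_sq_le {p : ℕ} {f : MvPolynomial τ ℝ} (hf : f.IsHomogeneous (p + 2)) :
    expInt τ ((f - psum Finset.univ ^ 2 * reduce p f) * (f - psum Finset.univ ^ 2 * reduce p f)) ≤
      ((Fintype.card τ : ℝ) ^ 2 * 4 ^ Fintype.card τ *
        stageConst (Fintype.card τ) ^ Fintype.card τ) *
      (((p + 2 : ℕ) : ℝ) + 1) ^ (∑ j ∈ Finset.range (Fintype.card τ), (Fintype.card τ - (j + 1))) *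
        expInt τ (f * f) := by
  set n := Fintype.card τ
  set y : ℝ := ((p + 2 : ℕ) : ℝ) + 1
  have hy : 1 ≤ y := by linarith [Nat.cast_nonneg (α := ℝ) (p + 2)]
  set C := stageConst n
  have hC : 1 ≤ C := one_le_stageConst n
  set M : ℝ := C ^ n * y ^ (∑ j ∈ Finset.range n, (n - (j + 1))) * expInt τ (f * f) with hM
  have h0 := expInt_sq_nonneg f
  have hM0 : 0 ≤ M := by positivity
  have hterm : ∀ k ∈ Finset.range n, ∀ F ∈ Finset.powersetCard (k + 1) (Finset.univ : Finset τ),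
      expInt τ ((face F (resid p k f) - psum F ^ 2 * faceReduce p F (face F (resid p k f))) *
        (face F (resid p k f) - psum F ^ 2 * faceReduce p F (face F (resid p k f)))) ≤ M := by
    intro k hk F hF
    have hne := nonempty_of_mem_powersetCard_succ hF
    have h1 := expInt_faceReduce_sq_add (p := p) hne (face F (resid p k f))
    have h2 := expInt_sq_nonneg (psum F ^ 2 * faceReduce p F (face F (resid p k f)))
    have h3 := expInt_face_sq_le_pow (isHomogeneous_resid hf k) hF
    have h4 := expInt_resid_sq_le hf k
    have h5 : expInt τ (face F (resid p k f) * face F (resid p k f)) ≤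
        y ^ (n - (k + 1)) * (C ^ k * y ^ (∑ j ∈ Finset.range k, (n - (j + 1))) *
          expInt τ (f * f)) := h3.trans (by gcongr)
    have hk' := Finset.mem_range.1 hk
    -- The trace factor of stage `k` is the next term of the exponent sum, so the final restriction
    -- costs nothing beyond the total exponent.
    have h6 : y ^ (n - (k + 1)) * (C ^ k * y ^ (∑ j ∈ Finset.range k, (n - (j + 1))) *
          expInt τ (f * f)) = C ^ k * y ^ (∑ j ∈ Finset.range (k + 1), (n - (j + 1))) *
          expInt τ (f * f) := by
      rw [Finset.sum_range_succ, pow_add]; ring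
    have h7 : C ^ k * y ^ (∑ j ∈ Finset.range (k + 1), (n - (j + 1))) * expInt τ (f * f) ≤ M := by
      rw [hM]
      gcongr
      exact hk'
    linarith
  rw [sub_reduce_eq_sum hf]
  refine (expInt_sum_sq_le _ _).trans ?_
  rw [Finset.card_range]
  have hin : ∀ k ∈ Finset.range n, expInt τ
      ((∑ F ∈ Finset.powersetCard (k + 1) Finset.univ,
        (face F (resid p k f) - psum F ^ 2 * faceReduce p F (face F (resid p k f)))) *
      (∑ F ∈ Finset.powersetCard (k + 1) Finset.univ,
        (face F (resid p k f) - psum F ^ 2 * faceReduce p F (face F (resid p k f))))) ≤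
      2 ^ n * (2 ^ n * M) := by
    intro k hk
    refine (expInt_sum_sq_le _ _).trans ?_
    refine mul_le_mul (card_powersetCard_le _) ?_
      (Finset.sum_nonneg fun F _ => expInt_sq_nonneg _) (by positivity)
    refine (Finset.sum_le_sum (hterm k hk)).trans ?_
    rw [Finset.sum_const, nsmul_eq_mul]
    exact mul_le_mul_of_nonneg_right (card_powersetCard_le _) hM0
  calc (n : ℝ) * _ ≤ n * (∑ _k ∈ Finset.range n, 2 ^ n * (2 ^ n * M)) :=
        mul_le_mul_of_nonneg_left (Finset.sum_le_sum hin) (by positivity)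
    _ = _ := by
      rw [Finset.sum_const, Finset.card_range, nsmul_eq_mul, hM,
        show (4 : ℝ) ^ n = 2 ^ n * 2 ^ n by rw [← mul_pow]; norm_num]
      ring

end Reduction

end HpFem

namespace HpFem

open MvPolynomial

/-! ### Dirichlet integrals over the standard simplex. -/

section Dirichlet

theorem lintegral_fin_prod {n : ℕ} (f : Fin n → ℝ → ℝ≥0∞) (hf : ∀ i, Measurable (f i)) :
    ∫⁻ x : Fin n → ℝ, ∏ i, f i (x i) = ∏ i, ∫⁻ t, f i t := by
  induction n with
  | zero => simp [volume_pi]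
  | succ n ih =>
    have hm : Measurable fun y : Fin n → ℝ => ∏ i, f i.succ (y i) :=
      Finset.measurable_prod _ fun i _ => (hf i.succ).comp (measurable_pi_apply i)
    rw [← ((volume_preserving_piFinSuccAbove (fun _ : Fin (n + 1) => ℝ) 0).symm).lintegral_comp_emb
      (MeasurableEquiv.measurableEmbedding _)]
    simp_rw [MeasurableEquiv.piFinSuccAbove_symm_apply, Fin.insertNthEquiv,
      Fin.prod_univ_succ, Fin.insertNth_zero, Equiv.coe_fn_mk, Fin.cons_succ, Fin.cons_zero]
    rw [← ih (fun i => f i.succ) fun i => hf _]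
    exact lintegral_prod_mul (hf 0).aemeasurable hm.aemeasurable

/-- The monomial `t ↦ t ^ a` on the positive half-line, as an extended non-negative number. -/
noncomputable def posPow (a : ℕ) (t : ℝ) : ℝ≥0∞ := if 0 < t then ENNReal.ofReal (t ^ a) else 0

theorem measurable_posPow (a : ℕ) : Measurable (posPow a) :=
  Measurable.ite measurableSet_Ioi (by fun_prop) measurable_const

theorem posPow_mul (a : ℕ) {s : ℝ} (hs : 0 < s) (t : ℝ) :
    posPow a (s * t) = ENNReal.ofReal (s ^ a) * posPow a t := by
  rw [posPow, posPow]
  by_cases h : 0 < t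
  · rw [if_pos h, if_pos (mul_pos hs h), mul_pow, ENNReal.ofReal_mul (by positivity)]
  · rw [if_neg h, if_neg (by rwa [mul_pos_iff_of_pos_left hs]), mul_zero]

theorem lintegral_posPow_mul_exp (a : ℕ) :
    ∫⁻ t, posPow a t * ENNReal.ofReal (Real.exp (-t)) = ENNReal.ofReal (a.factorial : ℝ) := by
  have h1 : ∀ t, posPow a t * ENNReal.ofReal (Real.exp (-t)) =
      (Ioi (0 : ℝ)).indicator (fun t => ENNReal.ofReal (Real.exp (-t) * t ^ ((a : ℝ) + 1 - 1))) t := by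
    intro t
    by_cases h : 0 < t
    · rw [posPow, if_pos h, indicator_of_mem (mem_Ioi.2 h), ← ENNReal.ofReal_mul (by positivity),
        add_sub_cancel_right, Real.rpow_natCast, mul_comm]
    · rw [posPow, if_neg h, indicator_of_notMem (by simpa using h), zero_mul]
  simp_rw [h1]
  rw [lintegral_indicator measurableSet_Ioi]
  have hp : (0 : ℝ) < (a : ℝ) + 1 := by positivity
  rw [← ofReal_integral_eq_lintegral_ofReal (Real.GammaIntegral_convergent hp),
    ← Real.Gamma_eq_integral hp, Real.Gamma_nat_eq_factorial]
  filter_upwards [ae_restrict_mem measurableSet_Ioi] with t ht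
  have : (0 : ℝ) < t := ht
  positivity

theorem lintegral_comp_smul_pi {d : ℕ} (f : (Fin d → ℝ) → ℝ≥0∞) (hf : Measurable f) {s : ℝ}
    (hs : 0 < s) : ∫⁻ y, f y = ENNReal.ofReal (s ^ d) * ∫⁻ y, f (s • y) := by
  have h := Measure.map_addHaar_smul (volume : Measure (Fin d → ℝ)) hs.ne'
  rw [← lintegral_map hf (measurable_const_smul s), h, lintegral_smul_measure, smul_eq_mul,
    ← mul_assoc, ← ENNReal.ofReal_mul (by positivity), Module.finrank_fin_fun,
    abs_of_pos (by positivity), mul_inv_cancel₀ (by positivity), ENNReal.ofReal_one, one_mul]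

/-- Barycentric coordinates on the standard simplex. -/
def stdBary {d : ℕ} (s : ℝ) (y : Fin d → ℝ) : Fin (d + 1) → ℝ := Fin.cons (s - ∑ k, y k) y

theorem measurable_stdBary {d : ℕ} :
    Measurable fun z : ℝ × (Fin d → ℝ) => stdBary z.1 z.2 := by
  refine measurable_pi_iff.2 fun i => ?_
  refine Fin.cases ?_ (fun k => ?_) i
  · simp only [stdBary, Fin.cons_zero]
    fun_prop
  · simp only [stdBary, Fin.cons_succ]
    fun_prop

theorem stdBary_smul {d : ℕ} (s : ℝ) (y : Fin d → ℝ) (i : Fin (d + 1)) :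
    stdBary s (s • y) i = s * stdBary 1 y i := by
  refine Fin.cases ?_ (fun k => ?_) i
  · simp [stdBary, mul_sub, Finset.mul_sum]
  · simp [stdBary]

theorem sum_stdBary {d : ℕ} (s : ℝ) (y : Fin d → ℝ) : ∑ i, stdBary s y i = s := by
  simp [stdBary, Fin.sum_univ_succ]

/-- The Dirichlet integral of a monomial over the standard simplex. -/
theorem lintegral_stdBary {d : ℕ} (α : Fin (d + 1) → ℕ) :
    ENNReal.ofReal (((∑ i, α i) + d).factorial : ℝ) *
      ∫⁻ y : Fin d → ℝ, ∏ i, posPow (α i) (stdBary 1 y i) =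
        ENNReal.ofReal (∏ i, ((α i).factorial : ℝ)) := by
  set H : (Fin (d + 1) → ℝ) → ℝ≥0∞ :=
    fun x => ∏ i, (posPow (α i) (x i) * ENNReal.ofReal (Real.exp (-x i))) with hH
  have hHm : Measurable H := by
    refine Finset.measurable_prod _ fun i _ => ?_
    exact ((measurable_posPow _).comp (measurable_pi_apply i)).mul (by fun_prop)
  -- The function `H` is integrated in two ways: as a product of Gamma integrals, and over the
  -- slices where the coordinates sum to `s`. Each slice is the unit slice scaled by `s`, which
  -- leaves one more Gamma integral in `s`.
  have h1 : ∫⁻ x, H x = ENNReal.ofReal (∏ i, ((α i).factorial : ℝ)) := by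
    rw [hH, lintegral_fin_prod (fun i t => posPow (α i) t * ENNReal.ofReal (Real.exp (-t)))
      fun i => (measurable_posPow _).mul (by fun_prop)]
    simp_rw [lintegral_posPow_mul_exp]
    rw [ENNReal.ofReal_prod_of_nonneg fun _ _ => by positivity]
  have hcons : Measurable fun z : ℝ × (Fin d → ℝ) => (Fin.cons z.1 z.2 : Fin (d + 1) → ℝ) := by
    refine measurable_pi_iff.2 fun i => ?_
    refine Fin.cases ?_ (fun k => ?_) i
    · simp only [Fin.cons_zero]; fun_prop
    · simp only [Fin.cons_succ]; fun_prop
  have h2 : ∫⁻ x, H x = ∫⁻ s : ℝ, ∫⁻ y : Fin d → ℝ, H (stdBary s y) := by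
    rw [← ((volume_preserving_piFinSuccAbove (fun _ : Fin (d + 1) => ℝ) 0).symm).lintegral_comp_emb
      (MeasurableEquiv.measurableEmbedding _)]
    simp_rw [MeasurableEquiv.piFinSuccAbove_symm_apply, Fin.insertNthEquiv,
      Fin.insertNth_zero, Equiv.coe_fn_mk]
    have e : ∫⁻ z : ℝ × (Fin d → ℝ), H (Fin.cons z.1 z.2) =
        ∫⁻ y : Fin d → ℝ, ∫⁻ s : ℝ, H (Fin.cons s y) :=
      lintegral_prod_symm' _ (hHm.comp hcons)
    refine e.trans ?_
    rw [lintegral_lintegral_swap (f := fun s y => H (stdBary s y))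
      (hHm.comp measurable_stdBary).aemeasurable]
    refine lintegral_congr fun y => ?_
    exact (lintegral_sub_right_eq_self (fun s => H (Fin.cons s y)) (∑ k, y k)).symm
  set I := ∫⁻ y : Fin d → ℝ, ∏ i, posPow (α i) (stdBary 1 y i)
  have hprod : ∀ (s : ℝ) (y : Fin d → ℝ), H (stdBary s y) =
      (∏ i, posPow (α i) (stdBary s y i)) * ENNReal.ofReal (Real.exp (-s)) := by
    intro s y
    simp only [hH]
    rw [Finset.prod_mul_distrib, ← ENNReal.ofReal_prod_of_nonneg fun _ _ => by positivity,
      ← Real.exp_sum, Finset.sum_neg_distrib, sum_stdBary]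
  have hsm : ∀ s : ℝ, Measurable fun y : Fin d → ℝ => stdBary s y := fun s =>
    measurable_stdBary.comp measurable_prodMk_left
  have h3 : ∀ s : ℝ, ∫⁻ y : Fin d → ℝ, H (stdBary s y) =
      (posPow ((∑ i, α i) + d) s * ENNReal.ofReal (Real.exp (-s))) * I := by
    intro s
    by_cases hs : 0 < s
    · rw [lintegral_comp_smul_pi (fun y => H (stdBary s y)) (hHm.comp (hsm s)) hs]
      have : ∀ y : Fin d → ℝ, H (stdBary s (s • y)) =
          (ENNReal.ofReal (s ^ (∑ i, α i)) * ENNReal.ofReal (Real.exp (-s))) *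
            ∏ i, posPow (α i) (stdBary 1 y i) := by
        intro y
        rw [hprod]
        simp_rw [stdBary_smul, posPow_mul _ hs]
        rw [Finset.prod_mul_distrib, ← ENNReal.ofReal_prod_of_nonneg fun _ _ => by positivity,
          Finset.prod_pow_eq_pow_sum]
        ring
      simp_rw [this]
      rw [lintegral_const_mul, posPow, if_pos hs, pow_add, ENNReal.ofReal_mul (by positivity)]
      · ring
      · exact Finset.measurable_prod _ fun i _ =>
          (measurable_posPow _).comp ((measurable_pi_apply i).comp (hsm 1))
    · rw [posPow, if_neg hs, zero_mul, zero_mul]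
      refine (lintegral_congr fun y => ?_).trans lintegral_zero
      rw [hprod]
      -- Coordinates with sum `s ≤ 0` cannot all be positive, so the slice does not meet the open
      -- orthant.
      obtain ⟨i, hi⟩ : ∃ i, ¬ 0 < stdBary s y i := by
        by_contra h
        push Not at h
        have := Finset.sum_pos (fun i _ => h i) (Finset.univ_nonempty (α := Fin (d + 1)))
        rw [sum_stdBary] at this
        exact hs this
      rw [Finset.prod_eq_zero (Finset.mem_univ i) (by rw [posPow, if_neg hi]), zero_mul]
  rw [← h1, h2]
  simp_rw [h3]
  rw [lintegral_mul_const, lintegral_posPow_mul_exp]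
  exact (measurable_posPow _).mul (by fun_prop)

end Dirichlet

/-! ### Integration in barycentric coordinates over a simplex. -/

section Simplex

variable {d : ℕ}

/-- The open simplex spanned by an affine basis. -/
def simplex (b : AffineBasis (Fin (d + 1)) ℝ (E d)) : Set (E d) := {x | ∀ i, 0 < b.coord i x}

/-- The vector of barycentric coordinates. -/
noncomputable def bary (b : AffineBasis (Fin (d + 1)) ℝ (E d)) (x : E d) : Fin (d + 1) → ℝ :=
  fun i => b.coord i x

theorem continuous_coord (b : AffineBasis (Fin (d + 1)) ℝ (E d)) (i : Fin (d + 1)) :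
    Continuous (b.coord i) := continuous_barycentric_coord b i

theorem sum_bary (b : AffineBasis (Fin (d + 1)) ℝ (E d)) (x : E d) : ∑ i, bary b x i = 1 :=
  b.sum_coord_apply_eq_one x

theorem bary_eq_stdBary (b : AffineBasis (Fin (d + 1)) ℝ (E d)) (x : E d) :
    bary b x = stdBary 1 fun k => b.coord k.succ x := by
  funext i
  refine Fin.cases ?_ (fun k => rfl) i
  have := sum_bary b x
  rw [Fin.sum_univ_succ] at this
  simp only [stdBary, Fin.cons_zero]
  simp only [bary] at *
  linarith

/-- All barycentric coordinates but the first form an affine bijection onto `Fin d → ℝ`. It carries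
Lebesgue measure to a translation-invariant measure, hence to a multiple of Lebesgue measure. -/
theorem exists_map_coord_eq_smul (b : AffineBasis (Fin (d + 1)) ℝ (E d)) :
    ∃ c : ℝ≥0, Measure.map (fun x : E d => fun k : Fin d => b.coord k.succ x) volume =
      c • (volume : Measure (Fin d → ℝ)) := by
  let A : E d →ₗ[ℝ] (Fin d → ℝ) := LinearMap.pi fun k => (b.coord k.succ).linear
  have hA : Function.Injective A := by
    rw [injective_iff_map_eq_zero]
    intro v hv
    have hs : ∀ k : Fin d, (b.coord k.succ).linear v = 0 := fun k => congrFun hv k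
    have h : ∀ k : Fin d, b.coord k.succ (v +ᵥ b 0) = b.coord k.succ (b 0) := by
      intro k
      rw [AffineMap.map_vadd, hs, zero_vadd]
    have h2 : v +ᵥ b 0 = b 0 := by
      refine b.ext_elem fun i => ?_
      have := congrFun (bary_eq_stdBary b (v +ᵥ b 0)) i
      have h' := congrFun (bary_eq_stdBary b (b 0)) i
      simp only [h] at this
      exact this.trans h'.symm
    simpa using h2
  have hfr : Module.finrank ℝ (E d) = Module.finrank ℝ (Fin d → ℝ) := by simp
  let L : E d ≃L[ℝ] (Fin d → ℝ) :=
    (LinearEquiv.ofInjectiveOfFinrankEq A hA hfr).toContinuousLinearEquiv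
  have hL : ∀ x, L x = A x := fun x => rfl
  have hmap : (fun x : E d => fun k : Fin d => b.coord k.succ x) =
      (fun y => y + fun k : Fin d => b.coord k.succ 0) ∘ L := by
    funext x k
    have := (b.coord k.succ).map_vadd 0 x
    simpa [hL, A] using this
  have hh : (Measure.map L (volume : Measure (E d))).IsAddHaarMeasure :=
    L.isAddHaarMeasure_map _
  refine ⟨Measure.addHaarScalarFactor (Measure.map L (volume : Measure (E d))) volume, ?_⟩
  rw [hmap, ← Measure.map_map (measurable_add_const _) L.continuous.measurable,
    map_add_right_eq_self]
  exact Measure.isAddLeftInvariant_eq_smul _ _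

theorem isOpen_simplex (b : AffineBasis (Fin (d + 1)) ℝ (E d)) : IsOpen (simplex b) := by
  rw [simplex, ofPred_forall]
  exact isOpen_iInter_of_finite fun i => isOpen_lt continuous_const (continuous_coord b i)

theorem continuous_bary (b : AffineBasis (Fin (d + 1)) ℝ (E d)) : Continuous (bary b) :=
  continuous_pi fun i => continuous_coord b i

theorem continuous_eval_bary (b : AffineBasis (Fin (d + 1)) ℝ (E d))
    (P : MvPolynomial (Fin (d + 1)) ℝ) : Continuous fun x => eval (bary b x) P :=
  (continuous_eval P).comp (continuous_bary b)

theorem simplex_eq_interior (b : AffineBasis (Fin (d + 1)) ℝ (E d)) :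
    simplex b = interior (convexHull ℝ (range b)) := b.interior_convexHull.symm

theorem isBounded_simplex (b : AffineBasis (Fin (d + 1)) ℝ (E d)) :
    Bornology.IsBounded (simplex b) := by
  rw [simplex_eq_interior]
  exact (((Set.finite_range b).isCompact_convexHull ℝ).isBounded).subset interior_subset

theorem integrableOn_simplex (b : AffineBasis (Fin (d + 1)) ℝ (E d)) {f : E d → ℝ}
    (hf : Continuous f) : IntegrableOn f (simplex b) :=
  (hf.continuousOn.integrableOn_compact (isBounded_simplex b).isCompact_closure).mono_set
    subset_closure

/-- The integral of a homogeneous polynomial in barycentric coordinates over a simplex. -/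
theorem exists_integral_simplex_eq (b : AffineBasis (Fin (d + 1)) ℝ (E d)) :
    ∃ c : ℝ, 0 ≤ c ∧ ∀ m : ℕ, ∀ P : MvPolynomial (Fin (d + 1)) ℝ, P.IsHomogeneous m →
      ∫ x in simplex b, eval (bary b x) P = c / ((m + d).factorial : ℝ) * expInt _ P := by
  obtain ⟨c, hc⟩ := exists_map_coord_eq_smul b
  refine ⟨c, c.2, fun m P hP => ?_⟩
  have key : ∀ α : Fin (d + 1) →₀ ℕ, α.degree = m → ∀ a : ℝ,
      ∫ x in simplex b, eval (bary b x) (monomial α a) =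
        c / ((m + d).factorial : ℝ) * expInt _ (monomial α a) := by
    intro α hα a
    have hsum : ∑ i, α i = m := by rw [← hα, Finsupp.degree_eq_sum]
    have hmeas : Measurable fun y : Fin d → ℝ => ∏ i, posPow (α i) (stdBary 1 y i) :=
      Finset.measurable_prod _ fun i _ => (measurable_posPow _).comp
        ((measurable_pi_apply i).comp (measurable_stdBary.comp measurable_prodMk_left))
    have hψ : Measurable fun x : E d => fun k : Fin d => b.coord k.succ x :=
      measurable_pi_iff.2 fun k => (continuous_coord b _).measurable
    have h1 : ∫⁻ x in simplex b, ENNReal.ofReal (∏ i, bary b x i ^ α i) =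
        c * ∫⁻ y : Fin d → ℝ, ∏ i, posPow (α i) (stdBary 1 y i) := by
      rw [← lintegral_indicator (isOpen_simplex b).measurableSet]
      have : ∀ x, (simplex b).indicator (fun x => ENNReal.ofReal (∏ i, bary b x i ^ α i)) x =
          (fun y => ∏ i, posPow (α i) (stdBary 1 y i)) fun k : Fin d => b.coord k.succ x := by
        intro x
        simp only [← bary_eq_stdBary]
        by_cases hx : x ∈ simplex b
        · have hx' : ∀ i, 0 < bary b x i := hx
          rw [indicator_of_mem hx, ENNReal.ofReal_prod_of_nonneg
            fun i _ => pow_nonneg (hx' i).le _]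
          exact Finset.prod_congr rfl fun i _ => by rw [posPow, if_pos]; exact hx i
        · rw [indicator_of_notMem hx]
          simp only [simplex, mem_ofPred_eq, not_forall] at hx
          obtain ⟨i, hi⟩ := hx
          exact (Finset.prod_eq_zero (Finset.mem_univ i) (by rw [posPow, if_neg]; exact hi)).symm
      simp_rw [this]
      rw [← lintegral_map hmeas hψ, hc, lintegral_smul_measure]
      rfl
    have h2 := lintegral_stdBary (d := d) α
    rw [hsum] at h2
    set I := ∫⁻ y : Fin d → ℝ, ∏ i, posPow (α i) (stdBary 1 y i)
    have h3 : ((m + d).factorial : ℝ) * I.toReal = ∏ i, ((α i).factorial : ℝ) := by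
      have := congrArg ENNReal.toReal h2
      rwa [ENNReal.toReal_mul, ENNReal.toReal_ofReal (by positivity),
        ENNReal.toReal_ofReal (by positivity)] at this
    have h4 : ∫ x in simplex b, ∏ i, bary b x i ^ α i = c * I.toReal := by
      rw [integral_eq_lintegral_of_nonneg_ae, h1, ENNReal.toReal_mul]
      · rfl
      · filter_upwards [ae_restrict_mem (isOpen_simplex b).measurableSet] with x hx
        exact Finset.prod_nonneg fun i _ => pow_nonneg (hx i).le _
      · have hcont : Continuous fun x : E d => ∏ i, bary b x i ^ α i :=
          continuous_finsetProd _ fun i _ => ((continuous_coord b i).pow _)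
        exact hcont.aestronglyMeasurable
    have h5 : ∀ x, eval (bary b x) (monomial α a) = a * ∏ i, bary b x i ^ α i := by
      intro x
      rw [eval_monomial, Finsupp.prod_fintype _ _ fun i => pow_zero _]
    simp_rw [h5]
    rw [integral_const_mul, h4, expInt_monomial, ← h3]
    have : ((m + d).factorial : ℝ) ≠ 0 := by positivity
    field_simp
  rw [P.as_sum, map_sum]
  simp only [map_sum]
  rw [integral_finsetSum _ fun α _ => integrableOn_simplex b (continuous_eval_bary b _),
    Finset.mul_sum]
  refine Finset.sum_congr rfl fun α hα => key α ?_ _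
  rw [Finsupp.degree_eq_weight_one]
  exact hP (mem_support_iff.1 hα)

end Simplex

end HpFem

namespace HpFem

/-! ### Weak gradients: smooth functions, restriction, uniqueness. -/

section WeakGradient

open Filter

variable {d : ℕ}

theorem inner_gradient (f : E d → ℝ) (x v : E d) : inner ℝ (gradient f x) v = fderiv ℝ f x v := by
  rw [gradient, InnerProductSpace.toDual_symm_apply]

theorem norm_gradient (f : E d → ℝ) (x : E d) : ‖gradient f x‖ = ‖fderiv ℝ f x‖ := by
  rw [gradient, LinearIsometryEquiv.norm_map]

theorem gradient_of_notMem_tsupport {f : E d → ℝ} {x : E d} (hx : x ∉ tsupport f) :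
    gradient f x = 0 := by
  rw [gradient, fderiv_of_notMem_tsupport ℝ hx, map_zero]

theorem continuous_gradient {f : E d → ℝ} (hf : ContDiff ℝ 1 f) : Continuous (gradient f) :=
  (LinearIsometryEquiv.continuous _).comp (hf.continuous_fderiv one_ne_zero)

theorem measurable_gradient (f : E d → ℝ) : Measurable (gradient f) :=
  (LinearIsometryEquiv.continuous _).measurable.comp (measurable_fderiv ℝ f)

theorem hasCompactSupport_gradient {f : E d → ℝ} (hf : HasCompactSupport f) :
    HasCompactSupport (gradient f) :=
  HasCompactSupport.intro hf fun _ hx => gradient_of_notMem_tsupport hx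

variable {U : Set (E d)} {φ : E d → ℝ}

theorem IsTestFunction.contDiff_one (h : IsTestFunction U φ) : ContDiff ℝ 1 φ :=
  h.contDiff.of_le (by simp)

theorem IsTestFunction.notMem_tsupport (h : IsTestFunction U φ) {x : E d} (hx : x ∉ U) :
    x ∉ tsupport φ := fun h' => hx (h.tsupport_subset h')

theorem IsTestFunction.setIntegral_smul (h : IsTestFunction U φ) (g : E d → E d) :
    ∫ x in U, φ x • g x = ∫ x, φ x • g x :=
  setIntegral_eq_integral_of_forall_compl_eq_zero fun x hx => by
    rw [image_eq_zero_of_notMem_tsupport (h.notMem_tsupport hx), zero_smul]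

theorem IsTestFunction.setIntegral_smul_gradient (h : IsTestFunction U φ) (v : E d → ℝ) :
    ∫ x in U, v x • gradient φ x = ∫ x, v x • gradient φ x :=
  setIntegral_eq_integral_of_forall_compl_eq_zero fun x hx => by
    rw [gradient_of_notMem_tsupport (h.notMem_tsupport hx), smul_zero]

theorem IsTestFunction.mono {V : Set (E d)} (h : IsTestFunction U φ) (hUV : U ⊆ V) :
    IsTestFunction V φ := ⟨h.contDiff, h.hasCompactSupport, h.tsupport_subset.trans hUV⟩

theorem IsTestFunction.integrable_smul (h : IsTestFunction U φ) {g : E d → E d}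
    (hg : LocallyIntegrableOn g U) : Integrable fun x => φ x • g x := by
  have h1 : IntegrableOn g (tsupport φ) :=
    hg.integrableOn_compact_subset h.tsupport_subset h.hasCompactSupport
  have h2 : IntegrableOn (fun x => φ x • g x) (tsupport φ) :=
    h1.continuousOn_smul h.contDiff.continuous.continuousOn h.hasCompactSupport
  refine (integrableOn_iff_integrable_of_support_subset fun x hx => ?_).1 h2
  by_contra hx'
  exact hx (by simp [image_eq_zero_of_notMem_tsupport hx'])

theorem integral_smul_gradient_eq_neg {f ψ : E d → ℝ} (hf : ContDiff ℝ 1 f) (hψ : ContDiff ℝ 1 ψ)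
    (hs : HasCompactSupport ψ) :
    ∫ x, f x • gradient ψ x = - ∫ x, ψ x • gradient f x := by
  have hg := continuous_gradient hf
  have hgψ := continuous_gradient hψ
  have i1 : Integrable fun x => f x • gradient ψ x :=
    (hf.continuous.smul hgψ).integrable_of_hasCompactSupport
      ((hasCompactSupport_gradient hs).smul_left (f := f))
  have i2 : Integrable fun x => ψ x • gradient f x :=
    (hψ.continuous.smul hg).integrable_of_hasCompactSupport (hs.smul_right (f' := gradient f))
  refine ext_inner_right ℝ fun w => ?_
  have e : ∀ (a b : E d → ℝ), Integrable (fun x => a x • gradient b x) →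
      inner ℝ (∫ x, a x • gradient b x) w = ∫ x, a x * fderiv ℝ b x w := by
    intro a b hab
    rw [real_inner_comm, ← integral_inner hab]
    refine integral_congr_ae (Eventually.of_forall fun x => ?_)
    simp only [inner_smul_right]
    rw [real_inner_comm, inner_gradient]
  rw [inner_neg_left, e _ _ i1, e _ _ i2]
  have hfd : Continuous fun x => fderiv ℝ f x w := (hf.continuous_fderiv one_ne_zero).clm_apply
    continuous_const
  have hψd : Continuous fun x => fderiv ℝ ψ x w := (hψ.continuous_fderiv one_ne_zero).clm_apply
    continuous_const
  have hsd : HasCompactSupport fun x => fderiv ℝ ψ x w := hs.fderiv_apply ℝ w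
  rw [integral_mul_fderiv_eq_neg_fderiv_mul_of_integrable]
  · simp only [mul_comm]
  · exact (hfd.mul hψ.continuous).integrable_of_hasCompactSupport hs.mul_left
  · exact (hf.continuous.mul hψd).integrable_of_hasCompactSupport hsd.mul_left
  · exact (hf.continuous.mul hψ.continuous).integrable_of_hasCompactSupport hs.mul_left
  · exact fun x _ => hf.differentiable one_ne_zero x
  · exact fun x _ => hψ.differentiable one_ne_zero x

theorem hasWeakGradient_of_contDiff {f : E d → ℝ} (hf : ContDiff ℝ 1 f) (U : Set (E d)) :
    HasWeakGradient U f (gradient f) where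
  locallyIntegrableOn := hf.continuous.locallyIntegrable.locallyIntegrableOn U
  grad_locallyIntegrableOn := (continuous_gradient hf).locallyIntegrable.locallyIntegrableOn U
  integral_eq := fun φ h => by
    rw [h.setIntegral_smul_gradient, h.setIntegral_smul,
      integral_smul_gradient_eq_neg hf h.contDiff_one h.hasCompactSupport]

theorem HasWeakGradient.mono {V : Set (E d)} {v : E d → ℝ} {g : E d → E d}
    (h : HasWeakGradient U v g) (hVU : V ⊆ U) : HasWeakGradient V v g where
  locallyIntegrableOn := h.locallyIntegrableOn.mono_set hVU
  grad_locallyIntegrableOn := h.grad_locallyIntegrableOn.mono_set hVU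
  integral_eq := fun φ hφ => by
    have := h.integral_eq φ (hφ.mono hVU)
    rw [(hφ.mono hVU).setIntegral_smul_gradient, (hφ.mono hVU).setIntegral_smul] at this
    rw [hφ.setIntegral_smul_gradient, hφ.setIntegral_smul, this]

theorem locallyIntegrableOn_congr {F : Type*} [NormedAddCommGroup F] {f g : E d → F}
    (h : f =ᵐ[volume.restrict U] g) (hf : LocallyIntegrableOn f U) :
    LocallyIntegrableOn g U := by
  intro x hx
  obtain ⟨s, hs, hfs⟩ := hf x hx
  refine ⟨s ∩ U, Filter.inter_mem hs self_mem_nhdsWithin, ?_⟩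
  refine (hfs.mono_set inter_subset_left).congr ?_
  exact ae_mono (Measure.restrict_mono inter_subset_right le_rfl) h

theorem HasWeakGradient.congr {v w : E d → ℝ} {g k : E d → E d}
    (h : HasWeakGradient U v g) (hvw : v =ᵐ[volume.restrict U] w)
    (hgk : g =ᵐ[volume.restrict U] k) : HasWeakGradient U w k where
  locallyIntegrableOn := locallyIntegrableOn_congr hvw h.locallyIntegrableOn
  grad_locallyIntegrableOn := locallyIntegrableOn_congr hgk h.grad_locallyIntegrableOn
  integral_eq := fun φ hφ => by
    have h1 : ∫ x in U, w x • gradient φ x = ∫ x in U, v x • gradient φ x :=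
      integral_congr_ae (by filter_upwards [hvw] with x hx; rw [hx])
    have h2 : ∫ x in U, φ x • k x = ∫ x in U, φ x • g x :=
      integral_congr_ae (by filter_upwards [hgk] with x hx; rw [hx])
    rw [h1, h2, h.integral_eq φ hφ]

theorem HasWeakGradient.ae_eq {v : E d → ℝ} {g k : E d → E d} (hU : IsOpen U)
    (hg : HasWeakGradient U v g) (hk : HasWeakGradient U v k) : g =ᵐ[volume.restrict U] k := by
  have h : ∀ᵐ x, x ∈ U → g x - k x = 0 := by
    refine hU.ae_eq_zero_of_integral_contDiff_smul_eq_zero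
      (hg.grad_locallyIntegrableOn.sub hk.grad_locallyIntegrableOn) fun φ h1 h2 h3 => ?_
    have hφ : IsTestFunction U φ := ⟨h1, h2, h3⟩
    have e1 := hg.integral_eq φ hφ
    have e2 := hk.integral_eq φ hφ
    rw [hφ.setIntegral_smul] at e1 e2
    simp only [smul_sub]
    rw [integral_sub (hφ.integrable_smul hg.grad_locallyIntegrableOn)
      (hφ.integrable_smul hk.grad_locallyIntegrableOn), ← neg_neg (∫ x, φ x • g x), ← e1, e2]
    simp
  rw [Filter.EventuallyEq, ae_restrict_iff' hU.measurableSet]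
  filter_upwards [h] with x hx hxU
  exact sub_eq_zero.1 (hx hxU)

/-- Weak gradients are almost everywhere unique, so any one of them computes the infimum. -/
theorem gradSeminorm_eq {v : E d → ℝ} {g : E d → E d} (hU : IsOpen U)
    (hg : HasWeakGradient U v g) (q : ℝ≥0∞) :
    gradSeminorm q U v = eLpNorm g q (volume.restrict U) := by
  refine le_antisymm (iInf₂_le g hg) (le_iInf₂ fun k hk => ?_)
  exact (eLpNorm_congr_ae (hg.ae_eq hU hk)).le

end WeakGradient

end HpFem

namespace HpFem

/-! ### Mollification, and Lipschitz functions as functions with bounded weak gradient. -/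

section Mollify

open Filter ContinuousLinearMap Convolution

variable {d : ℕ}

theorem IsTestFunction.inner_integral_smul_gradient {U : Set (E d)} {φ : E d → ℝ}
    (h : IsTestFunction U φ) {v : E d → ℝ} (hv : LocallyIntegrable v) (w : E d) :
    inner ℝ (∫ x, v x • gradient φ x) w = ∫ x, v x * fderiv ℝ φ x w := by
  have hi : Integrable fun x => v x • gradient φ x :=
    hv.integrable_smul_right_of_hasCompactSupport (continuous_gradient h.contDiff_one)
      (hasCompactSupport_gradient h.hasCompactSupport)
  rw [real_inner_comm, ← integral_inner hi]
  refine integral_congr_ae (Eventually.of_forall fun x => ?_)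
  simp only [inner_smul_right]
  rw [real_inner_comm, inner_gradient]

/-- The weak gradient identity is tested with `t ↦ ρ (x - t)`; the sign from differentiating in `t`
cancels the one from integrating by parts. -/
theorem gradient_convolution {ρ : E d → ℝ} (hρ : ContDiff ℝ ∞ ρ) (hs : HasCompactSupport ρ)
    {v : E d → ℝ} {g : E d → E d} (h : HasWeakGradient univ v g) (x : E d) :
    gradient (ρ ⋆[lsmul ℝ ℝ, volume] v) x = (ρ ⋆[lsmul ℝ ℝ, volume] g) x := by
  have hv : LocallyIntegrable v := locallyIntegrableOn_univ.1 h.locallyIntegrableOn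
  set φ : E d → ℝ := fun t => ρ (x - t) with hφ
  have htest : IsTestFunction univ φ :=
    ⟨hρ.comp (contDiff_const.sub contDiff_id), hs.comp_homeomorph (Homeomorph.subLeft x),
      subset_univ _⟩
  have hfd : ∀ t w, fderiv ℝ φ t w = - fderiv ℝ ρ (x - t) w := by
    intro t w
    have h1 : HasFDerivAt φ ((fderiv ℝ ρ (x - t)).comp (-ContinuousLinearMap.id ℝ (E d))) t :=
      ((hρ.differentiable (by simp)) (x - t)).hasFDerivAt.comp t
        ((hasFDerivAt_id t).const_sub x)
    rw [h1.fderiv]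
    simp
  have hint := h.integral_eq φ htest
  rw [htest.setIntegral_smul_gradient, htest.setIntegral_smul] at hint
  rw [convolution_lsmul_swap, ← neg_neg (∫ t, ρ (x - t) • g t), ← hint]
  refine ext_inner_right ℝ fun w => ?_
  have hρ1 : ContDiff ℝ 1 ρ := hρ.of_le (by simp)
  rw [inner_neg_left, htest.inner_integral_smul_gradient hv, inner_gradient,
    (hs.hasFDerivAt_convolution_left (lsmul ℝ ℝ) hρ1 hv x).fderiv]
  have hex : ConvolutionExistsAt (fderiv ℝ ρ) v x ((lsmul ℝ ℝ).precompL (E d)) volume :=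
    (hs.fderiv ℝ).convolutionExists_left _ (hρ1.continuous_fderiv one_ne_zero) hv x
  rw [convolution_def, ContinuousLinearMap.integral_apply hex, ← integral_neg]
  rw [← integral_sub_left_eq_self (fun t => -(v t * fderiv ℝ φ t w)) volume x]
  refine integral_congr_ae (Eventually.of_forall fun t => ?_)
  simp only [hfd, precompL_apply, lsmul_apply, smul_eq_mul, sub_sub_cancel]
  ring

/-- A sequence of bump functions whose supports shrink to the origin. -/
noncomputable def bumpSeq (d n : ℕ) : ContDiffBump (0 : E d) where
  rIn := ((n : ℝ) + 1)⁻¹ / 2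
  rOut := ((n : ℝ) + 1)⁻¹
  rIn_pos := by positivity
  rIn_lt_rOut := by
    have : (0 : ℝ) < ((n : ℝ) + 1)⁻¹ := by positivity
    linarith

theorem bumpSeq_rOut (d n : ℕ) : (bumpSeq d n).rOut = ((n : ℝ) + 1)⁻¹ := rfl

theorem tendsto_bumpSeq_rOut (d : ℕ) : Tendsto (fun n => (bumpSeq d n).rOut) atTop (𝓝 0) := by
  have := tendsto_one_div_add_atTop_nhds_zero_nat (𝕜 := ℝ)
  simpa [bumpSeq_rOut] using this

/-- The mollification of a locally integrable function. -/
noncomputable def mollify {F : Type*} [NormedAddCommGroup F] [NormedSpace ℝ F] (n : ℕ)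
    (v : E d → F) : E d → F :=
  (bumpSeq d n).normed volume ⋆[lsmul ℝ ℝ, volume] v

theorem ae_tendsto_mollify {F : Type*} [NormedAddCommGroup F] [NormedSpace ℝ F] [CompleteSpace F]
    {v : E d → F} (hv : LocallyIntegrable v) :
    ∀ᵐ x, Tendsto (fun n => mollify n v x) atTop (𝓝 (v x)) := by
  refine ContDiffBump.ae_convolution_tendsto_right_of_locallyIntegrable (K := 2)
    (tendsto_bumpSeq_rOut d) (Eventually.of_forall fun n => ?_) hv
  change ((n : ℝ) + 1)⁻¹ ≤ 2 * (((n : ℝ) + 1)⁻¹ / 2)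
  linarith

theorem contDiff_mollify {v : E d → ℝ} (hv : LocallyIntegrable v) (n : ℕ) :
    ContDiff ℝ ∞ (mollify n v) :=
  (bumpSeq d n).hasCompactSupport_normed.contDiff_convolution_left _
    (n := ⊤) (bumpSeq d n).contDiff_normed hv

theorem gradient_mollify {v : E d → ℝ} {g : E d → E d} (h : HasWeakGradient univ v g) (n : ℕ)
    (x : E d) : gradient (mollify n v) x = mollify n g x :=
  gradient_convolution (bumpSeq d n).contDiff_normed (bumpSeq d n).hasCompactSupport_normed h x

theorem norm_mollify_le {F : Type*} [NormedAddCommGroup F] [NormedSpace ℝ F]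
    {g : E d → F} {L : ℝ} (hg : ∀ᵐ x, ‖g x‖ ≤ L) (n : ℕ) (x : E d) : ‖mollify n g x‖ ≤ L := by
  set ρ := (bumpSeq d n).normed volume with hρ
  have h1 : ∫ t, L * ρ (x - t) = L := by
    rw [integral_const_mul, integral_sub_left_eq_self, ContDiffBump.integral_normed, mul_one]
  rw [mollify, convolution_lsmul_swap, ← h1]
  refine norm_integral_le_of_norm_le ?_ ?_
  · refine Integrable.const_mul ?_ _
    exact ((bumpSeq d n).integrable_normed).comp_sub_left x
  · filter_upwards [hg] with t ht
    rw [norm_smul, Real.norm_of_nonneg ((bumpSeq d n).nonneg_normed _), mul_comm]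
    exact mul_le_mul_of_nonneg_right ht ((bumpSeq d n).nonneg_normed _)

/-- A function with a bounded weak gradient has a Lipschitz representative. -/
theorem exists_lipschitz_ae_eq {v : E d → ℝ} {g : E d → E d} (h : HasWeakGradient univ v g)
    {L : ℝ≥0} (hg : ∀ᵐ x, ‖g x‖ ≤ L) : ∃ V : E d → ℝ, LipschitzWith L V ∧ v =ᵐ[volume] V := by
  have hv : LocallyIntegrable v := locallyIntegrableOn_univ.1 h.locallyIntegrableOn
  set G := {x : E d | Tendsto (fun n => mollify n v x) atTop (𝓝 (v x))}
  have hG : ∀ᵐ x, x ∈ G := ae_tendsto_mollify hv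
  -- On `G` the function is a pointwise limit of its mollifications, which are `L`-Lipschitz because
  -- averaging preserves the bound on the gradient.
  have hL : LipschitzOnWith L v G := by
    refine LipschitzOnWith.of_dist_le_mul fun x hx y hy => ?_
    refine le_of_tendsto (hx.dist hy) (Eventually.of_forall fun n => ?_)
    have hl : LipschitzWith L (mollify n v) := by
      refine lipschitzWith_of_nnnorm_fderiv_le ((contDiff_mollify hv n).differentiable (by simp))
        fun z => ?_
      rw [← NNReal.coe_le_coe, coe_nnnorm, ← norm_gradient, gradient_mollify h]
      exact norm_mollify_le hg n z
    exact hl.dist_le_mul x y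
  obtain ⟨V, hV, hVG⟩ := hL.extend_real
  exact ⟨V, hV, by filter_upwards [hG] with x hx using hVG hx⟩

/-- By Rademacher's theorem the gradient represents the line derivatives almost everywhere, and
these can be integrated by parts for Lipschitz functions. -/
theorem hasWeakGradient_of_lipschitz {V : E d → ℝ} {L : ℝ≥0} (hV : LipschitzWith L V) :
    HasWeakGradient univ V (gradient V) where
  locallyIntegrableOn := hV.continuous.locallyIntegrable.locallyIntegrableOn _
  grad_locallyIntegrableOn := by
    refine LocallyIntegrable.locallyIntegrableOn ?_ _
    refine (locallyIntegrable_const (L : ℝ)).mono (measurable_gradient V).aestronglyMeasurable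
      (Eventually.of_forall fun x => ?_)
    rw [norm_gradient, NNReal.norm_eq]
    exact norm_fderiv_le_of_lipschitz ℝ hV
  integral_eq := fun φ hφ => by
    have hgl : LocallyIntegrableOn (gradient V) univ := by
      refine LocallyIntegrable.locallyIntegrableOn ?_ _
      refine (locallyIntegrable_const (L : ℝ)).mono (measurable_gradient V).aestronglyMeasurable
        (Eventually.of_forall fun x => ?_)
      rw [norm_gradient, NNReal.norm_eq]
      exact norm_fderiv_le_of_lipschitz ℝ hV
    rw [hφ.setIntegral_smul_gradient, hφ.setIntegral_smul]
    refine ext_inner_right ℝ fun w => ?_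
    obtain ⟨D, hD⟩ := ContDiff.lipschitzWith_of_hasCompactSupport hφ.hasCompactSupport
      hφ.contDiff (by simp)
    rw [hφ.inner_integral_smul_gradient hV.continuous.locallyIntegrable, inner_neg_left,
      real_inner_comm, ← integral_inner (hφ.integrable_smul hgl)]
    have h1 := hV.integral_lineDeriv_mul_eq (μ := volume) hD hφ.hasCompactSupport w
    have h2 : ∫ x, inner ℝ w (φ x • gradient V x) = ∫ x, lineDeriv ℝ V x w * φ x := by
      refine integral_congr_ae ?_
      filter_upwards [hV.ae_differentiableAt] with x hx
      rw [inner_smul_right, real_inner_comm, inner_gradient, hx.lineDeriv_eq_fderiv, mul_comm]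
    rw [h2, h1, ← integral_neg]
    refine integral_congr_ae (Eventually.of_forall fun x => ?_)
    simp only
    rw [((hφ.contDiff.differentiable (by simp)) x).lineDeriv_eq_fderiv, map_neg]
    ring

end Mollify

/-! ### Extension by zero of functions in `H¹₀`. -/

section ZeroBoundary

open Filter

variable {d : ℕ} {Ω : Set (E d)}

theorem enorm_setIntegral_smul_le {F : Type*} [NormedAddCommGroup F] [NormedSpace ℝ F]
    {μ : Measure (E d)} {a : E d → ℝ} {b : E d → F} {M : ℝ≥0} (hb : ∀ x, ‖b x‖₊ ≤ M) :
    ‖∫ x, a x • b x ∂μ‖ₑ ≤ M * eLpNorm a 1 μ := by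
  refine (enorm_integral_le_lintegral_enorm _).trans ?_
  rw [eLpNorm_one_eq_lintegral_enorm, ← lintegral_const_mul' _ _ ENNReal.coe_ne_top]
  refine lintegral_mono fun x => ?_
  rw [enorm_smul, mul_comm]
  exact mul_le_mul_left (ENNReal.coe_le_coe.2 (hb x)) _

theorem enorm_setIntegral_smul_le' {F : Type*} [NormedAddCommGroup F] [NormedSpace ℝ F]
    {μ : Measure (E d)} {a : E d → F} {b : E d → ℝ} {M : ℝ≥0} (hb : ∀ x, ‖b x‖₊ ≤ M) :
    ‖∫ x, b x • a x ∂μ‖ₑ ≤ M * eLpNorm a 1 μ := by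
  refine (enorm_integral_le_lintegral_enorm _).trans ?_
  rw [eLpNorm_one_eq_lintegral_enorm, ← lintegral_const_mul' _ _ ENNReal.coe_ne_top]
  refine lintegral_mono fun x => ?_
  rw [enorm_smul]
  exact mul_le_mul_left (ENNReal.coe_le_coe.2 (hb x)) _

theorem exists_nnnorm_le_of_hasCompactSupport {F : Type*} [NormedAddCommGroup F] {f : E d → F}
    (hf : Continuous f) (hs : HasCompactSupport f) : ∃ M : ℝ≥0, ∀ x, ‖f x‖₊ ≤ M := by
  obtain ⟨C, hC⟩ := hs.exists_bound_of_continuous hf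
  exact ⟨C.toNNReal, fun x => by
    rw [← NNReal.coe_le_coe, coe_nnnorm]; exact (hC x).trans (Real.le_coe_toNNReal C)⟩

/-- The extension by zero of a function in `H¹₀`. -/
theorem MemH10.exists_hasWeakGradient (hΩ : IsOpen Ω) (hb : Bornology.IsBounded Ω) {u : E d → ℝ}
    (hu : MemH10 Ω u) : ∃ g : E d → E d, HasWeakGradient Ω u g ∧
      HasWeakGradient univ (Ω.indicator u) (Ω.indicator g) := by
  obtain ⟨hu2, g, hg, hg2, happ⟩ := hu
  have hfin : volume Ω ≠ ⊤ := hb.measure_lt_top.ne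
  have : IsFiniteMeasure (volume.restrict Ω) := isFiniteMeasure_restrict.2 hfin
  have hu1 : IntegrableOn u Ω := hu2.integrable (by norm_num)
  have hg1 : IntegrableOn g Ω := hg2.integrable (by norm_num)
  refine ⟨g, hg, ⟨?_, ?_, fun ψ hψ => ?_⟩⟩
  · exact ((integrable_indicator_iff hΩ.measurableSet).2 hu1).locallyIntegrable.locallyIntegrableOn _
  · exact ((integrable_indicator_iff hΩ.measurableSet).2 hg1).locallyIntegrable.locallyIntegrableOn _
  have e1 : ∫ x in univ, Ω.indicator u x • gradient ψ x = ∫ x in Ω, u x • gradient ψ x := by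
    rw [Measure.restrict_univ, ← integral_indicator hΩ.measurableSet]
    congr 1
    funext x
    by_cases hx : x ∈ Ω <;> simp [hx]
  have e2 : ∫ x in univ, ψ x • Ω.indicator g x = ∫ x in Ω, ψ x • g x := by
    rw [Measure.restrict_univ, ← integral_indicator hΩ.measurableSet]
    congr 1
    funext x
    by_cases hx : x ∈ Ω <;> simp [hx]
  rw [e1, e2, ← sub_eq_zero, sub_neg_eq_add]
  obtain ⟨M1, hM1⟩ := exists_nnnorm_le_of_hasCompactSupport hψ.contDiff.continuous
    hψ.hasCompactSupport
  obtain ⟨M2, hM2⟩ := exists_nnnorm_le_of_hasCompactSupport (continuous_gradient hψ.contDiff_one)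
    (hasCompactSupport_gradient hψ.hasCompactSupport)
  set K : ℝ≥0∞ := volume Ω ^ (1 / (1 : ℝ≥0∞).toReal - 1 / (2 : ℝ≥0∞).toReal) with hK
  have hKfin : K ≠ ⊤ := ENNReal.rpow_ne_top_of_nonneg (by norm_num) hfin
  have hle : ∀ {F : Type} [NormedAddCommGroup F] (f : E d → F),
      AEStronglyMeasurable f (volume.restrict Ω) →
      eLpNorm f 1 (volume.restrict Ω) ≤ eLpNorm f 2 (volume.restrict Ω) * K := by
    intro F _ f hf
    have := eLpNorm_le_eLpNorm_mul_rpow_measure_univ (p := 1) (q := 2) (by norm_num) hf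
    rwa [Measure.restrict_apply_univ] at this
  -- Integration by parts against `ψ` has no boundary term when `u` is replaced by a test function
  -- `φ` of `Ω`. Approximation by such `φ` makes the defect arbitrarily small.
  have main : ∀ ε : ℝ≥0∞, 0 < ε →
      ‖(∫ x in Ω, u x • gradient ψ x) + ∫ x in Ω, ψ x • g x‖ₑ ≤ (M2 * K + M1 * K) * ε := by
    intro ε hε
    obtain ⟨φ, hφ, h1, h2⟩ := happ ε hε
    have hpart : (∫ x in Ω, φ x • gradient ψ x) + ∫ x in Ω, ψ x • gradient φ x = 0 := by
      have := (hasWeakGradient_of_contDiff hψ.contDiff_one Ω).integral_eq φ hφ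
      rw [this, add_neg_cancel]
    have hφi : IntegrableOn φ Ω :=
      (hφ.contDiff.continuous.integrable_of_hasCompactSupport hφ.hasCompactSupport).integrableOn
    have hφg : IntegrableOn (gradient φ) Ω :=
      ((continuous_gradient hφ.contDiff_one).integrable_of_hasCompactSupport
        (hasCompactSupport_gradient hφ.hasCompactSupport)).integrableOn
    have hsm : ∀ a : E d → ℝ, IntegrableOn a Ω →
        Integrable (fun x => a x • gradient ψ x) (volume.restrict Ω) := fun a ha =>
      ha.smul_bdd M2 (continuous_gradient hψ.contDiff_one).aestronglyMeasurable
        (Eventually.of_forall fun x => hM2 x)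
    have hsm' : ∀ a : E d → E d, IntegrableOn a Ω →
        Integrable (fun x => ψ x • a x) (volume.restrict Ω) := fun a ha =>
      ha.bdd_smul M1 hψ.contDiff.continuous.aestronglyMeasurable
        (Eventually.of_forall fun x => hM1 x)
    have e : (∫ x in Ω, u x • gradient ψ x) + ∫ x in Ω, ψ x • g x =
        (∫ x in Ω, (u x - φ x) • gradient ψ x) + ∫ x in Ω, ψ x • (g x - gradient φ x) := by
      simp only [sub_smul, smul_sub]
      rw [integral_sub (hsm u hu1) (hsm φ hφi), integral_sub (hsm' g hg1) (hsm' _ hφg)]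
      rw [sub_add_sub_comm, hpart, sub_zero]
    rw [e]
    refine (enorm_add_le _ _).trans ?_
    rw [add_mul]
    refine add_le_add ((enorm_setIntegral_smul_le hM2).trans ?_)
      ((enorm_setIntegral_smul_le' hM1).trans ?_)
    · rw [mul_assoc, mul_comm K]
      gcongr
      exact (hle _ (hu1.sub hφi).aestronglyMeasurable).trans (by gcongr; exact h1)
    · rw [mul_assoc, mul_comm K]
      gcongr
      exact (hle _ (hg1.sub hφg).aestronglyMeasurable).trans (by gcongr; exact h2)
  have hlim : Tendsto (fun n : ℕ => (M2 * K + M1 * K) * (n : ℝ≥0∞)⁻¹) atTop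
      (𝓝 ((M2 * K + M1 * K) * 0)) :=
    ENNReal.Tendsto.const_mul ENNReal.tendsto_inv_nat_nhds_zero (Or.inr
      (ENNReal.add_ne_top.2 ⟨ENNReal.mul_ne_top ENNReal.coe_ne_top hKfin,
        ENNReal.mul_ne_top ENNReal.coe_ne_top hKfin⟩))
  rw [mul_zero] at hlim
  rw [← enorm_eq_zero, ← nonpos_iff_eq_zero]
  exact ge_of_tendsto' hlim fun n => main _ (ENNReal.inv_pos.2 (ENNReal.natCast_ne_top n))

/-- Bounded convergence in `L²`. -/
theorem tendsto_eLpNorm_two_zero {F : Type*} [NormedAddCommGroup F] {μ : Measure (E d)}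
    [IsFiniteMeasure μ] {f : ℕ → E d → F} {M : ℝ≥0} (hm : ∀ n, AEStronglyMeasurable (f n) μ)
    (hb : ∀ n, ∀ᵐ x ∂μ, ‖f n x‖₊ ≤ M) (h : ∀ᵐ x ∂μ, Tendsto (fun n => f n x) atTop (𝓝 0)) :
    Tendsto (fun n => eLpNorm (f n) 2 μ) atTop (𝓝 0) := by
  have h1 : Tendsto (fun n => ∫⁻ x, ‖f n x‖ₑ ^ (2 : ℝ) ∂μ) atTop (𝓝 (∫⁻ _x, 0 ∂μ)) := by
    refine tendsto_lintegral_of_dominated_convergence' (fun _ => (M : ℝ≥0∞) ^ (2 : ℝ))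
      (fun n => (hm n).enorm.pow_const _) (fun n => ?_) ?_ ?_
    · filter_upwards [hb n] with x hx
      exact ENNReal.rpow_le_rpow (by exact_mod_cast hx) (by norm_num)
    · rw [lintegral_const]
      exact ENNReal.mul_ne_top (ENNReal.rpow_ne_top_of_nonneg (by norm_num) ENNReal.coe_ne_top)
        (measure_ne_top _ _)
    · filter_upwards [h] with x hx
      have := (ENNReal.continuous_rpow_const (y := 2)).tendsto _ |>.comp hx.enorm
      simpa [Function.comp_def] using this
  rw [lintegral_zero] at h1
  have h2 := (ENNReal.continuous_rpow_const (y := 1 / 2)).tendsto 0 |>.comp h1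
  simp only [ENNReal.zero_rpow_of_pos (show (0 : ℝ) < 1 / 2 by norm_num)] at h2
  refine h2.congr fun n => ?_
  rw [eLpNorm_eq_lintegral_rpow_enorm_toReal (by norm_num) (by norm_num)]
  simp

end ZeroBoundary

end HpFem

namespace HpFem

/-! ### Lipschitz functions vanishing off `Ω` belong to `H¹₀`. -/

section LipschitzZero

open Filter

variable {d : ℕ} {Ω : Set (E d)}

/-- The width to which a `K`-Lipschitz function vanishing off `Ω` is truncated. -/
noncomputable def cutWidth (Ω : Set (E d)) (K : ℝ≥0) (δ : ℝ) (x : E d) : ℝ :=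
  max 0 (2 * K * (infDist x Ωᶜ - δ))

/-- Truncation near the boundary of `Ω`. -/
noncomputable def cutoff (Ω : Set (E d)) (K : ℝ≥0) (δ : ℝ) (V : E d → ℝ) (x : E d) : ℝ :=
  max (-cutWidth Ω K δ x) (min (V x) (cutWidth Ω K δ x))

theorem cutWidth_nonneg (Ω : Set (E d)) (K : ℝ≥0) (δ : ℝ) (x : E d) : 0 ≤ cutWidth Ω K δ x :=
  le_max_left _ _

theorem lipschitz_cutWidth (Ω : Set (E d)) (K : ℝ≥0) (δ : ℝ) :
    LipschitzWith (2 * K) (cutWidth Ω K δ) := by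
  have h : LipschitzWith (2 * K) fun x => 2 * (K : ℝ) * (infDist x Ωᶜ - δ) := by
    refine LipschitzWith.of_dist_le_mul fun x y => ?_
    have h1 := (lipschitz_infDist_pt (Ωᶜ)).dist_le_mul x y
    rw [Real.dist_eq] at h1 ⊢
    have e : 2 * (K : ℝ) * (infDist x Ωᶜ - δ) - 2 * K * (infDist y Ωᶜ - δ) =
        2 * K * (infDist x Ωᶜ - infDist y Ωᶜ) := by ring
    rw [e, abs_mul, abs_of_nonneg (by positivity)]
    push_cast
    gcongr
    simpa using h1
  exact h.const_max 0

theorem lipschitz_cutoff {K : ℝ≥0} {V : E d → ℝ} (hV : LipschitzWith K V) (δ : ℝ) :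
    LipschitzWith (2 * K) (cutoff Ω K δ V) := by
  have h1 := lipschitz_cutWidth Ω K δ
  have h2 : LipschitzWith (2 * K) V := hV.weaken (by
    rw [two_mul]; exact le_add_of_nonneg_left zero_le)
  have h3 := h1.neg.max (h2.min h1)
  rw [max_self, max_self] at h3
  exact h3

theorem cutoff_eq_zero {K : ℝ≥0} {δ : ℝ} {V : E d → ℝ} {x : E d} (hx : infDist x Ωᶜ ≤ δ) :
    cutoff Ω K δ V x = 0 := by
  have h : cutWidth Ω K δ x = 0 :=
    max_eq_left (mul_nonpos_of_nonneg_of_nonpos (by positivity) (by linarith))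
  rw [cutoff, h, neg_zero]
  exact max_eq_left (min_le_right _ _)

theorem abs_le_mul_infDist (hΩ : IsOpen Ω) (hne : Ωᶜ.Nonempty) {K : ℝ≥0} {V : E d → ℝ}
    (hV : LipschitzWith K V) (h0 : ∀ x ∉ Ω, V x = 0) (x : E d) : |V x| ≤ K * infDist x Ωᶜ := by
  obtain ⟨y, hy, hxy⟩ := hΩ.isClosed_compl.exists_infDist_eq_dist hne x
  have := hV.dist_le_mul x y
  rwa [h0 y hy, ← hxy, Real.dist_eq, sub_zero] at this

/-- At distance `r ≥ 2δ` from the complement the truncation level `2K(r - δ)` is at least `K r`,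
which bounds `|V|`. This is the purpose of the factor 2 in `cutWidth`. -/
theorem cutoff_eq_self (hΩ : IsOpen Ω) (hne : Ωᶜ.Nonempty) {K : ℝ≥0} {V : E d → ℝ}
    (hV : LipschitzWith K V) (h0 : ∀ x ∉ Ω, V x = 0) {δ : ℝ} {x : E d}
    (hx : 2 * δ ≤ infDist x Ωᶜ) : cutoff Ω K δ V x = V x := by
  have h1 := abs_le.1 (abs_le_mul_infDist hΩ hne hV h0 x)
  have h2 : K * infDist x Ωᶜ ≤ cutWidth Ω K δ x := by
    refine le_trans ?_ (le_max_right _ _)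
    have : (0 : ℝ) ≤ K := K.2
    nlinarith
  rw [cutoff, min_eq_left (by linarith), max_eq_right (by linarith)]

theorem abs_cutoff_le {K : ℝ≥0} {δ : ℝ} {V : E d → ℝ} (x : E d) : |cutoff Ω K δ V x| ≤ |V x| := by
  have h := cutWidth_nonneg Ω K δ x
  rw [cutoff]
  set m := cutWidth Ω K δ x
  rw [abs_le]
  constructor
  · refine le_trans ?_ (le_max_right _ _)
    exact le_min (neg_abs_le _) ((neg_nonpos.2 (abs_nonneg _)).trans h)
  · exact max_le ((neg_nonpos.2 h).trans (abs_nonneg _)) ((min_le_left _ _).trans (le_abs_self _))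

/-- Mollification at a scale below `δ / 2` keeps the support at distance at least `δ / 2` from the
complement. Bounded convergence gives both limits in L². -/
theorem exists_testFunction_near (hb : Bornology.IsBounded Ω)
    {L : ℝ≥0} {W : E d → ℝ} (hW : LipschitzWith L W) {δ : ℝ} (hδ : 0 < δ)
    (h0 : ∀ x, infDist x Ωᶜ ≤ δ → W x = 0) {ε : ℝ≥0∞} (hε : 0 < ε) :
    ∃ φ : E d → ℝ, IsTestFunction Ω φ ∧
      eLpNorm (fun x => φ x - W x) 2 (volume.restrict Ω) ≤ ε ∧
      eLpNorm (fun x => gradient φ x - gradient W x) 2 (volume.restrict Ω) ≤ ε := by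
  have hfin : IsFiniteMeasure (volume.restrict Ω) := isFiniteMeasure_restrict.2 hb.measure_lt_top.ne
  have hloc : LocallyIntegrable W := hW.continuous.locallyIntegrable
  have hwg := hasWeakGradient_of_lipschitz hW
  have hgb : ∀ x, ‖gradient W x‖ ≤ L := fun x => by
    rw [norm_gradient]; exact norm_fderiv_le_of_lipschitz ℝ hW
  have hgloc : LocallyIntegrable (gradient W) :=
    locallyIntegrableOn_univ.1 hwg.grad_locallyIntegrableOn
  have hsupp : Function.support W ⊆ Ω := by
    intro x hx
    by_contra hxΩ
    exact hx (h0 x (by rw [infDist_zero_of_mem hxΩ]; exact hδ.le))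
  have hWc : HasCompactSupport W :=
    HasCompactSupport.of_support_subset_isCompact hb.isCompact_closure
      (hsupp.trans subset_closure)
  obtain ⟨M, hM⟩ := exists_nnnorm_le_of_hasCompactSupport hW.continuous hWc
  have hMr : ∀ x, ‖W x‖ ≤ M := fun x => hM x
  have hsmooth := contDiff_mollify hloc
  have t1 : Tendsto (fun n => eLpNorm (fun x => mollify n W x - W x) 2 (volume.restrict Ω))
      atTop (𝓝 0) := by
    refine tendsto_eLpNorm_two_zero (M := M + M) (fun n => ?_) (fun n => ?_) ?_
    · exact ((hsmooth n).continuous.sub hW.continuous).aestronglyMeasurable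
    · refine Eventually.of_forall fun x => ?_
      rw [← NNReal.coe_le_coe, coe_nnnorm, NNReal.coe_add]
      exact (norm_sub_le _ _).trans (add_le_add
        (norm_mollify_le (Eventually.of_forall hMr) n x) (hMr x))
    · filter_upwards [ae_restrict_of_ae (ae_tendsto_mollify hloc)] with x hx
      simpa using hx.sub_const (W x)
  have t2 : Tendsto (fun n => eLpNorm (fun x => gradient (mollify n W) x - gradient W x) 2
      (volume.restrict Ω)) atTop (𝓝 0) := by
    refine tendsto_eLpNorm_two_zero (M := L + L) (fun n => ?_) (fun n => ?_) ?_
    · exact ((measurable_gradient _).sub (measurable_gradient _)).aestronglyMeasurable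
    · refine Eventually.of_forall fun x => ?_
      rw [← NNReal.coe_le_coe, coe_nnnorm, NNReal.coe_add]
      refine (norm_sub_le _ _).trans (add_le_add ?_ (hgb x))
      rw [gradient_mollify hwg]
      exact norm_mollify_le (Eventually.of_forall hgb) n x
    · filter_upwards [ae_restrict_of_ae (ae_tendsto_mollify hgloc)] with x hx
      simp only [gradient_mollify hwg]
      simpa using hx.sub_const (gradient W x)
  have t3 : ∀ᶠ n in atTop, (bumpSeq d n).rOut < δ / 2 :=
    (tendsto_bumpSeq_rOut d).eventually_lt_const (by positivity)
  obtain ⟨n, hn1, hn2, hn3⟩ := ((t1.eventually_le_const hε).and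
    ((t2.eventually_le_const hε).and t3)).exists
  refine ⟨mollify n W, ⟨hsmooth n, ?_, ?_⟩, hn1, hn2⟩
  · exact (bumpSeq d n).hasCompactSupport_normed.convolution _ hWc
  · have hcl : IsClosed {x : E d | δ / 2 ≤ infDist x Ωᶜ} :=
      isClosed_le continuous_const (continuous_infDist_pt _)
    have hsub : Function.support (mollify n W) ⊆ {x : E d | δ / 2 ≤ infDist x Ωᶜ} := by
      intro x hx
      obtain ⟨y, hy, z, hz, rfl⟩ := support_convolution_subset _ hx
      rw [ContDiffBump.support_normed_eq, mem_ball_zero_iff] at hy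
      have hz' : δ < infDist z Ωᶜ := by
        by_contra h
        exact hz (h0 z (not_lt.1 h))
      have h1 := infDist_le_infDist_add_dist (s := Ωᶜ) (x := z) (y := y + z)
      rw [dist_eq_norm, sub_add_cancel_right, norm_neg] at h1
      simp only [mem_ofPred_eq]
      linarith
    refine (closure_minimal hsub hcl).trans fun x hx => ?_
    by_contra hxΩ
    have : infDist x Ωᶜ = 0 := infDist_zero_of_mem hxΩ
    simp only [mem_ofPred_eq, this] at hx
    linarith

/-- A Lipschitz function that vanishes outside a bounded open set `Ω` is in `H¹₀(Ω)`. -/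
theorem memH10_of_lipschitz (hΩ : IsOpen Ω) (hb : Bornology.IsBounded Ω) (hne : Ωᶜ.Nonempty)
    {K : ℝ≥0} {V : E d → ℝ} (hV : LipschitzWith K V) (h0 : ∀ x ∉ Ω, V x = 0) {u : E d → ℝ}
    (hu : u =ᵐ[volume.restrict Ω] V) : MemH10 Ω u := by
  have hfin : IsFiniteMeasure (volume.restrict Ω) := isFiniteMeasure_restrict.2 hb.measure_lt_top.ne
  have hgb : ∀ x, ‖gradient V x‖ ≤ K := fun x => by
    rw [norm_gradient]; exact norm_fderiv_le_of_lipschitz ℝ hV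
  have hVc : HasCompactSupport V := by
    refine HasCompactSupport.of_support_subset_isCompact hb.isCompact_closure
      (Subset.trans (fun x hx => ?_) subset_closure)
    by_contra hxΩ
    exact hx (h0 x hxΩ)
  obtain ⟨M, hM⟩ := exists_nnnorm_le_of_hasCompactSupport hV.continuous hVc
  refine ⟨?_, gradient V, ?_, ?_, fun ε hε => ?_⟩
  · rw [memLp_congr_ae hu]
    exact MemLp.of_bound hV.continuous.aestronglyMeasurable M (Eventually.of_forall hM)
  · exact ((hasWeakGradient_of_lipschitz hV).mono (subset_univ Ω)).congr hu.symm (by rfl)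
  · exact MemLp.of_bound (measurable_gradient V).aestronglyMeasurable K (Eventually.of_forall hgb)
  -- Near each point of `Ω` the truncations eventually coincide with `V`, so values and gradients
  -- converge pointwise. The common Lipschitz constant `2 * K` supplies the gradient bound.
  set W : ℕ → E d → ℝ := fun n => cutoff Ω K ((n : ℝ) + 1)⁻¹ V
  have hWl : ∀ n, LipschitzWith (2 * K) (W n) := fun n => lipschitz_cutoff hV _
  have hev : ∀ x ∈ Ω, ∀ᶠ n : ℕ in atTop, 2 * ((n : ℝ) + 1)⁻¹ < infDist x Ωᶜ := by
    intro x hx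
    have hpos : 0 < infDist x Ωᶜ :=
      (hΩ.isClosed_compl.notMem_iff_infDist_pos hne).1 (by simpa using hx)
    have := (tendsto_one_div_add_atTop_nhds_zero_nat (𝕜 := ℝ)).const_mul 2
    rw [mul_zero] at this
    simpa using this.eventually_lt_const hpos
  have t1 : Tendsto (fun n => eLpNorm (fun x => V x - W n x) 2 (volume.restrict Ω))
      atTop (𝓝 0) := by
    refine tendsto_eLpNorm_two_zero (M := M + M) (fun n => ?_) (fun n => ?_) ?_
    · exact (hV.continuous.sub (hWl n).continuous).aestronglyMeasurable
    · refine Eventually.of_forall fun x => ?_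
      rw [← NNReal.coe_le_coe, coe_nnnorm, NNReal.coe_add]
      exact (norm_sub_le _ _).trans (add_le_add (hM x) ((abs_cutoff_le x).trans (hM x)))
    · filter_upwards [ae_restrict_mem hΩ.measurableSet] with x hx
      refine tendsto_const_nhds.congr' ?_
      filter_upwards [hev x hx] with n hn
      rw [show W n x = V x from cutoff_eq_self hΩ hne hV h0 hn.le, sub_self]
  have t2 : Tendsto (fun n => eLpNorm (fun x => gradient V x - gradient (W n) x) 2
      (volume.restrict Ω)) atTop (𝓝 0) := by
    refine tendsto_eLpNorm_two_zero (M := K + 2 * K) (fun n => ?_) (fun n => ?_) ?_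
    · exact ((measurable_gradient _).sub (measurable_gradient _)).aestronglyMeasurable
    · refine Eventually.of_forall fun x => ?_
      rw [← NNReal.coe_le_coe, coe_nnnorm, NNReal.coe_add]
      refine (norm_sub_le _ _).trans (add_le_add (hgb x) ?_)
      rw [norm_gradient]
      exact norm_fderiv_le_of_lipschitz ℝ (hWl n)
    · filter_upwards [ae_restrict_mem hΩ.measurableSet] with x hx
      refine tendsto_const_nhds.congr' ?_
      filter_upwards [hev x hx] with n hn
      have : W n =ᶠ[𝓝 x] V := by
        have hopen : IsOpen {y : E d | 2 * ((n : ℝ) + 1)⁻¹ < infDist y Ωᶜ} :=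
          isOpen_lt continuous_const (continuous_infDist_pt _)
        filter_upwards [hopen.mem_nhds hn] with y hy
        exact cutoff_eq_self hΩ hne hV h0 (le_of_lt hy)
      rw [gradient, gradient, this.fderiv_eq, sub_self]
  have hε2 : 0 < ε / 2 := ENNReal.half_pos hε.ne'
  obtain ⟨n, hn1, hn2⟩ := ((t1.eventually_le_const hε2).and (t2.eventually_le_const hε2)).exists
  obtain ⟨φ, hφ, h1, h2⟩ := exists_testFunction_near hb (hWl n)
    (δ := ((n : ℝ) + 1)⁻¹) (by positivity) (fun x hx => cutoff_eq_zero hx) hε2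
  refine ⟨φ, hφ, ?_, ?_⟩
  · have e : (fun x => u x - φ x) =ᵐ[volume.restrict Ω]
        (fun x => V x - W n x) - fun x => φ x - W n x := by
      filter_upwards [hu] with x hx
      simp [hx]
    rw [eLpNorm_congr_ae e, ← ENNReal.add_halves ε]
    refine (eLpNorm_sub_le ?_ ?_ (by norm_num)).trans (add_le_add hn1 h1)
    · exact (hV.continuous.sub (hWl n).continuous).aestronglyMeasurable
    · exact (hφ.contDiff.continuous.sub (hWl n).continuous).aestronglyMeasurable
  · have e : (fun x => gradient V x - gradient φ x) =
        (fun x => gradient V x - gradient (W n) x) - fun x => gradient φ x - gradient (W n) x := by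
      funext x
      simp
    rw [e, ← ENNReal.add_halves ε]
    refine (eLpNorm_sub_le ?_ ?_ (by norm_num)).trans (add_le_add hn2 h2)
    · exact ((measurable_gradient _).sub (measurable_gradient _)).aestronglyMeasurable
    · exact ((measurable_gradient _).sub (measurable_gradient _)).aestronglyMeasurable

end LipschitzZero

end HpFem

namespace HpFem

/-! ### Barycentric coordinates of simplices sharing a facet. -/

section Geometry

variable {d : ℕ} {b b' : AffineBasis (Fin (d + 1)) ℝ (E d)} {i j : Fin (d + 1)}

theorem apply_eq_sum_coord_mul (b : AffineBasis (Fin (d + 1)) ℝ (E d)) (f : E d →ᵃ[ℝ] ℝ) (x : E d) :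
    f x = ∑ k, b.coord k x * f (b k) := by
  conv_lhs => rw [← b.affineCombination_coord_eq_self x]
  rw [Finset.map_affineCombination _ _ _ (b.sum_coord_apply_eq_one x),
    Finset.affineCombination_eq_linear_combination _ _ _ (b.sum_coord_apply_eq_one x)]
  rfl

theorem simplex_nonempty (b : AffineBasis (Fin (d + 1)) ℝ (E d)) : (simplex b).Nonempty := by
  rw [simplex_eq_interior]
  exact ⟨_, b.centroid_mem_interior_convexHull⟩

theorem convex_simplex (b : AffineBasis (Fin (d + 1)) ℝ (E d)) : Convex ℝ (simplex b) := by
  rw [simplex_eq_interior]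
  exact (convex_convexHull ℝ _).interior

theorem closure_simplex (b : AffineBasis (Fin (d + 1)) ℝ (E d)) :
    closure (simplex b) = {x | ∀ i, 0 ≤ b.coord i x} := by
  have h := simplex_nonempty b
  rw [simplex_eq_interior] at h ⊢
  rw [(convex_convexHull ℝ _).closure_interior_eq_closure_of_nonempty_interior h,
    ((Set.finite_range b).isCompact_convexHull ℝ).isClosed.closure_eq,
    b.convexHull_eq_nonneg_coord]

theorem mem_closure_simplex {x : E d} : x ∈ closure (simplex b) ↔ ∀ i, 0 ≤ b.coord i x := by
  rw [closure_simplex]; rfl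

/-- The closed facet of a simplex opposite to the vertex `i`. -/
def facet (b : AffineBasis (Fin (d + 1)) ℝ (E d)) (i : Fin (d + 1)) : Set (E d) :=
  {x | b.coord i x = 0 ∧ ∀ k, 0 ≤ b.coord k x}

theorem convexHull_image_compl (b : AffineBasis (Fin (d + 1)) ℝ (E d)) (i : Fin (d + 1)) :
    convexHull ℝ (b '' {i}ᶜ) = facet b i := by
  apply subset_antisymm
  · refine convexHull_min ?_ ?_
    · rintro _ ⟨k, hk, rfl⟩
      refine ⟨b.coord_apply_ne (Ne.symm hk), fun l => ?_⟩
      rw [b.coord_apply]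
      split_ifs <;> norm_num
    · intro x hx y hy s t hs ht hst
      have hc : ∀ k, b.coord k (s • x + t • y) = s * b.coord k x + t * b.coord k y := fun k =>
        Convex.combo_affine_apply hst
      refine ⟨by rw [hc, hx.1, hy.1]; ring, fun k => ?_⟩
      rw [hc]
      exact add_nonneg (mul_nonneg hs (hx.2 k)) (mul_nonneg ht (hy.2 k))
  · intro x hx
    have h1 := b.linear_combination_coord_eq_self x
    rw [← Finset.add_sum_erase _ _ (Finset.mem_univ i), hx.1, zero_smul, zero_add] at h1
    have h2 := b.sum_coord_apply_eq_one x
    rw [← Finset.add_sum_erase _ _ (Finset.mem_univ i), hx.1, zero_add] at h2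
    rw [← h1]
    refine (convex_convexHull ℝ _).sum_mem (fun k _ => hx.2 k) h2 fun k hk => ?_
    exact subset_convexHull ℝ _ ⟨k, by simpa using hk, rfl⟩

/-- A facet determines its vertices as extreme points. The vertex `b k` is a convex combination of
vertices of the same facet in `b'`; every `b.coord m` with `m ≠ k` is nonnegative at these and zero
at `b k`, hence zero at any `b' l` of positive weight, which forces `b' l = b k`. The remaining
vertex `i` is sent to `j`. -/
theorem exists_perm_of_facet_eq (h : facet b i = facet b' j) :
    ∃ π : Equiv.Perm (Fin (d + 1)), π i = j ∧ ∀ k, k ≠ i → b k = b' (π k) := by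
  classical
  have hv : ∀ (c : AffineBasis (Fin (d + 1)) ℝ (E d)) (m k : Fin (d + 1)), k ≠ m →
      c k ∈ facet c m := by
    intro c m k hk
    rw [← convexHull_image_compl]
    exact subset_convexHull ℝ _ ⟨k, hk, rfl⟩
  have h1 : ∀ k, k ≠ i → ∃ l, l ≠ j ∧ b k = b' l := by
    intro k hk
    have hb : b k ∈ facet b' j := h ▸ hv b i k hk
    have hs := b'.sum_coord_apply_eq_one (b k)
    obtain ⟨l, -, hl⟩ : ∃ l ∈ Finset.univ, 0 < b'.coord l (b k) := by
      by_contra! hcon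
      have := Finset.sum_nonpos hcon
      linarith
    have hlj : l ≠ j := by
      rintro rfl
      exact hl.ne' hb.1
    have hb' : b' l ∈ facet b i := h ▸ hv b' j l hlj
    have hz : ∀ m, m ≠ k → b.coord m (b' l) = 0 := by
      intro m hm
      have h2 := apply_eq_sum_coord_mul b' (b.coord m) (b k)
      rw [b.coord_apply_ne hm] at h2
      have hnn : ∀ n ∈ Finset.univ, 0 ≤ b'.coord n (b k) * b.coord m (b' n) := by
        intro n _
        by_cases hn : n = j
        · rw [hn, hb.1, zero_mul]
        · have hb'' : b' n ∈ facet b i := h ▸ hv b' j n hn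
          exact mul_nonneg (hb.2 n) (hb''.2 m)
      have h3 := (Finset.sum_eq_zero_iff_of_nonneg hnn).1 h2.symm l (Finset.mem_univ l)
      exact (mul_eq_zero.1 h3).resolve_left hl.ne'
    refine ⟨l, hlj, b.ext_elem fun m => ?_⟩
    by_cases hm : m = k
    · subst hm
      have h4 := b.sum_coord_apply_eq_one (b' l)
      rw [Finset.sum_eq_single m (fun n _ hn => hz n hn) (by simp)] at h4
      rw [h4, b.coord_apply_eq]
    · rw [hz m hm, b.coord_apply_ne hm]
  choose! φ hφ hbφ using h1
  have hinj : Function.Injective fun k => if k = i then j else φ k := by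
    intro k l hkl
    by_cases hk : k = i <;> by_cases hl : l = i
    · rw [hk, hl]
    · simp only [hk, hl, if_true, if_false] at hkl
      exact absurd hkl.symm (hφ l hl)
    · simp only [hk, hl, if_true, if_false] at hkl
      exact absurd hkl (hφ k hk)
    · simp only [hk, hl, if_false] at hkl
      have : b k = b l := by rw [hbφ k hk, hbφ l hl, hkl]
      exact b.ind.injective this
  refine ⟨Equiv.ofBijective _ (Finite.injective_iff_bijective.1 hinj), by simp, fun k hk => ?_⟩
  simp only [Equiv.ofBijective_apply, hk, if_false]
  exact hbφ k hk

/-- An affine function is determined by its values at the vertices of `b`; all of these but `b i`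
are also vertices of `b'`. -/
theorem coord_perm_apply {π : Equiv.Perm (Fin (d + 1))} (hπ : ∀ k, k ≠ i → b k = b' (π k))
    (k : Fin (d + 1)) (x : E d) :
    b'.coord (π k) x =
      (if k = i then 0 else b.coord k x) + b.coord i x * b'.coord (π k) (b i) := by
  classical
  rw [apply_eq_sum_coord_mul b (b'.coord (π k)) x,
    ← Finset.add_sum_erase _ _ (Finset.mem_univ i), add_comm]
  congr 1
  have h : ∀ l ∈ Finset.univ.erase i, b.coord l x * b'.coord (π k) (b l) =
      if l = k then b.coord k x else 0 := by
    intro l hl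
    rw [hπ l (Finset.ne_of_mem_erase hl), b'.coord_apply]
    by_cases hlk : l = k
    · simp [hlk]
    · rw [if_neg (fun h => hlk (π.injective h).symm), if_neg hlk, mul_zero]
  rw [Finset.sum_congr rfl h, Finset.sum_ite_eq']
  by_cases hk : k = i <;> simp [hk]

theorem coord_vertex_ne_zero {π : Equiv.Perm (Fin (d + 1))} (hi : π i = j)
    (hπ : ∀ k, k ≠ i → b k = b' (π k)) : b'.coord j (b i) ≠ 0 := by
  intro h0
  have h := coord_perm_apply hπ i (b' j)
  rw [hi, h0, if_pos rfl, b'.coord_apply_eq] at h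
  norm_num at h

theorem volume_zero_set_affine (f : E d →ᵃ[ℝ] ℝ) {y : E d} (hy : f y ≠ 0) :
    volume {x | f x = 0} = 0 := by
  let s : AffineSubspace ℝ (E d) := (AffineSubspace.mk' (0 : ℝ) (⊥ : Submodule ℝ ℝ)).comap f
  have hs : ∀ x, x ∈ s ↔ f x = 0 := by
    intro x
    simp [s, AffineSubspace.mem_comap]
  have h1 : s ≠ ⊤ := by
    intro h
    exact hy ((hs y).1 (h ▸ AffineSubspace.mem_top ℝ (E d) y))
  have h2 := Measure.addHaar_affineSubspace (volume : Measure (E d)) s h1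
  convert h2 using 2
  ext x
  exact (hs x).symm

end Geometry

/-! ### What is needed of a Lipschitz domain. -/

section Domain

variable {d : ℕ} {Ω : Set (E d)}

/-- If a boundary point `x` were interior to the closure, then so would be the point `x - t • e` for
small `t`. But that point lies strictly below the graph, so it has a neighbourhood disjoint from
`Ω`. -/
theorem IsLipschitzDomain.interior_closure (hΩ : IsLipschitzDomain Ω) :
    interior (closure Ω) = Ω := by
  refine subset_antisymm (fun x hx => ?_) (interior_maximal subset_closure hΩ.isOpen)
  by_contra hxΩ
  have hfr : x ∈ frontier Ω := by
    rw [frontier, hΩ.isOpen.interior_eq]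
    exact ⟨interior_subset hx, hxΩ⟩
  obtain ⟨r, hr, e, he, K, g, hg, hgr⟩ := hΩ.graph x hfr
  obtain ⟨ρ, hρ, hball⟩ := Metric.isOpen_iff.1 isOpen_interior x hx
  set t : ℝ := min r ρ / 2 with ht
  have ht0 : 0 < t := half_pos (lt_min hr hρ)
  have htr : t < r := (half_lt_self (lt_min hr hρ)).trans_le (min_le_left _ _)
  have htρ : t < ρ := (half_lt_self (lt_min hr hρ)).trans_le (min_le_right _ _)
  have hdist : dist (x - t • e) x = t := by
    rw [dist_eq_norm, sub_sub_cancel_left, norm_neg, norm_smul, he, mul_one,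
      Real.norm_of_nonneg ht0.le]
  have hee : inner ℝ e e = (1 : ℝ) := by rw [real_inner_self_eq_norm_sq, he, one_pow]
  have hx0 : inner ℝ e x ≤ g (x - inner ℝ e x • e) := by
    by_contra hcon
    exact hxΩ ((hgr x (mem_ball_self hr)).2 (not_le.1 hcon))
  have hlt : inner ℝ e (x - t • e) < g ((x - t • e) - inner ℝ e (x - t • e) • e) := by
    have h1 : inner ℝ e (x - t • e) = inner ℝ e x - t := by
      rw [inner_sub_right, inner_smul_right, hee, mul_one]
    have h2 : (x - t • e) - (inner ℝ e x - t) • e = x - inner ℝ e x • e := by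
      rw [sub_smul]; abel
    rw [h1, h2]
    linarith
  have hcl : x - t • e ∈ closure Ω := interior_subset (hball (by rw [mem_ball, hdist]; exact htρ))
  have hopen : IsOpen ({y : E d | inner ℝ e y < g (y - inner ℝ e y • e)} ∩ ball x r) := by
    refine IsOpen.inter (isOpen_lt ?_ ?_) isOpen_ball
    · fun_prop
    · exact hg.continuous.comp (by fun_prop)
  obtain ⟨y, hy, hyΩ⟩ := mem_closure_iff.1 hcl _ hopen
    ⟨hlt, by rw [mem_ball, hdist]; exact htr⟩
  exact lt_asymm hy.1 ((hgr y hy.2).1 hyΩ)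

theorem compl_nonempty_of_isBounded (hd : 1 ≤ d) (hb : Bornology.IsBounded Ω) : Ωᶜ.Nonempty := by
  have : Nonempty (Fin d) := ⟨⟨0, hd⟩⟩
  by_contra h
  rw [not_nonempty_iff_eq_empty, compl_empty_iff] at h
  rw [h] at hb
  exact NormedSpace.unbounded_univ ℝ (E d) hb

end Domain

end HpFem

/-! ### Gluing elementwise functions on a triangulation. -/

namespace HpFem

/-- The simplices with vertices `b T` form a triangulation of `Ω` without hanging nodes. -/
structure IsTriangulation {d : ℕ} {ι : Type*} (b : ι → AffineBasis (Fin (d + 1)) ℝ (E d))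
    (Ω : Set (E d)) : Prop where
  subset : ∀ T, simplex (b T) ⊆ Ω
  disjoint : ∀ T S, T ≠ S → Disjoint (simplex (b T)) (simplex (b S))
  cover : ⋃ T, closure (simplex (b T)) = closure Ω
  regular : ∀ T i, facet (b T) i ⊆ frontier Ω ∨
    ∃ S, S ≠ T ∧ ∃ j, facet (b S) j = facet (b T) i

/-- The points at which two barycentric coordinates of some element vanish. -/
def skeleton {d : ℕ} {ι : Type*} (b : ι → AffineBasis (Fin (d + 1)) ℝ (E d)) : Set (E d) :=
  {x | ∃ T i j, i ≠ j ∧ (b T).coord i x = 0 ∧ (b T).coord j x = 0}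

namespace IsTriangulation

variable {d : ℕ} {ι : Type*} {b : ι → AffineBasis (Fin (d + 1)) ℝ (E d)} {Ω : Set (E d)}

theorem exists_mem (h : IsTriangulation b Ω) {x : E d} (hx : x ∈ closure Ω) :
    ∃ T, x ∈ closure (simplex (b T)) := by
  rw [← h.cover] at hx
  exact mem_iUnion.1 hx

theorem closure_subset (h : IsTriangulation b Ω) (T : ι) :
    closure (simplex (b T)) ⊆ closure Ω := closure_mono (h.subset T)

theorem eq_of_mem (h : IsTriangulation b Ω) {T S : ι} {x : E d} (hT : x ∈ simplex (b T))
    (hS : x ∈ closure (simplex (b S))) : T = S := by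
  by_contra hne
  exact (((h.disjoint T S hne).closure_right (isOpen_simplex _)).le_bot ⟨hT, hS⟩).elim

/-- Two elements sharing a facet lie on opposite sides of it. Otherwise a short step from `z`
towards the vertex `b T i` would enter both open simplices. -/
theorem coord_vertex_neg (h : IsTriangulation b Ω) {T S : ι} (hne : T ≠ S)
    {i j : Fin (d + 1)} {π : Equiv.Perm (Fin (d + 1))} (hi : π i = j)
    (hπ : ∀ k, k ≠ i → b T k = b S (π k)) {z : E d} (hz : (b T).coord i z = 0)
    (hzk : ∀ k, k ≠ i → 0 < (b T).coord k z) : (b S).coord j (b T i) < 0 := by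
  refine lt_of_le_of_ne (not_lt.1 fun hpos => ?_) (coord_vertex_ne_zero hi hπ)
  have hev : ∀ᶠ x in 𝓝 z, ∀ k, k ≠ i → 0 < (b T).coord k x ∧ 0 < (b S).coord (π k) x := by
    refine Filter.eventually_all.2 fun k => ?_
    by_cases hk : k = i
    · exact Filter.Eventually.of_forall fun x hx => absurd hk hx
    have h1 : 0 < (b S).coord (π k) z := by
      rw [coord_perm_apply hπ, if_neg hk, hz, zero_mul, add_zero]
      exact hzk k hk
    filter_upwards [(continuous_coord (b T) k).continuousAt.eventually_const_lt (hzk k hk),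
      (continuous_coord (b S) (π k)).continuousAt.eventually_const_lt h1] with x h2 h3 _
    exact ⟨h2, h3⟩
  have hline : Filter.Tendsto (fun t : ℝ => AffineMap.lineMap z (b T i) t) (𝓝[>] 0) (𝓝 z) := by
    have : Continuous fun t : ℝ => (AffineMap.lineMap z (b T i) t : E d) :=
      AffineMap.lineMap_continuous
    have h2 := this.tendsto 0
    rw [AffineMap.lineMap_apply_zero] at h2
    exact h2.mono_left nhdsWithin_le_nhds
  obtain ⟨t, ht, ht0⟩ := ((hline.eventually hev).and self_mem_nhdsWithin).exists
  have ht0' : (0 : ℝ) < t := ht0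
  set x : E d := AffineMap.lineMap z (b T i) t with hx
  have hxi : (b T).coord i x = t := by
    rw [hx, AffineMap.apply_lineMap, hz, AffineBasis.coord_apply_eq]
    simp [AffineMap.lineMap_apply]
  have hxT : x ∈ simplex (b T) := by
    intro k
    by_cases hk : k = i
    · rw [hk, hxi]; exact ht0'
    · exact (ht k hk).1
  have hxS : x ∈ simplex (b S) := by
    intro l
    obtain ⟨k, rfl⟩ := π.surjective l
    by_cases hk : k = i
    · rw [coord_perm_apply hπ, if_pos hk, hxi, hk, hi, zero_add]
      exact mul_pos ht0' hpos
    · exact (ht k hk).2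
  exact hne (h.eq_of_mem hxT (subset_closure hxS))

/-- Near a point in the relative interior of a facet shared by two elements there are only these
two elements. -/
theorem eventually_mem_of_shared (h : IsTriangulation b Ω) {T S : ι} (hne : T ≠ S)
    {i j : Fin (d + 1)} (hf : facet (b T) i = facet (b S) j) {z : E d}
    (hz : (b T).coord i z = 0) (hzk : ∀ k, k ≠ i → 0 < (b T).coord k z) :
    ∀ᶠ x in 𝓝 z, x ∈ closure (simplex (b T)) ∪ closure (simplex (b S)) := by
  obtain ⟨π, hi, hπ⟩ := exists_perm_of_facet_eq hf
  have hc := h.coord_vertex_neg hne hi hπ hz hzk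
  have hev : ∀ᶠ x in 𝓝 z, ∀ k, k ≠ i → 0 < (b T).coord k x ∧ 0 < (b S).coord (π k) x := by
    refine Filter.eventually_all.2 fun k => ?_
    by_cases hk : k = i
    · exact Filter.Eventually.of_forall fun x hx => absurd hk hx
    have h1 : 0 < (b S).coord (π k) z := by
      rw [coord_perm_apply hπ, if_neg hk, hz, zero_mul, add_zero]
      exact hzk k hk
    filter_upwards [(continuous_coord (b T) k).continuousAt.eventually_const_lt (hzk k hk),
      (continuous_coord (b S) (π k)).continuousAt.eventually_const_lt h1] with x h2 h3 _
    exact ⟨h2, h3⟩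
  filter_upwards [hev] with x hx
  rcases le_total 0 ((b T).coord i x) with hx0 | hx0
  · left
    refine mem_closure_simplex.2 fun k => ?_
    by_cases hk : k = i
    · rw [hk]; exact hx0
    · exact (hx k hk).1.le
  · right
    refine mem_closure_simplex.2 fun l => ?_
    obtain ⟨k, rfl⟩ := π.surjective l
    by_cases hk : k = i
    · rw [coord_perm_apply hπ, if_pos hk, hk, hi, zero_add]
      exact mul_nonneg_of_nonpos_of_nonpos hx0 hc.le
    · exact (hx k hk).2.le

theorem exists_coord_eq_zero {z : E d} {T : ι} (hz : z ∉ skeleton b)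
    (hT : z ∈ closure (simplex (b T))) (hT' : z ∉ simplex (b T)) :
    ∃ i, (b T).coord i z = 0 ∧ z ∈ facet (b T) i ∧ ∀ k, k ≠ i → 0 < (b T).coord k z := by
  rw [mem_closure_simplex] at hT
  have : ∃ i, (b T).coord i z = 0 := by
    by_contra! hcon
    exact hT' fun i => lt_of_le_of_ne (hT i) (hcon i).symm
  obtain ⟨i, hi⟩ := this
  refine ⟨i, hi, ⟨hi, hT⟩, fun k hk => lt_of_le_of_ne (hT k) fun h0 => hz ⟨T, i, k, hk.symm, hi, h0.symm⟩⟩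

section Glue

variable {f : ι → E d → ℝ}

theorem mem_interior_of_shared (h : IsTriangulation b Ω) (hΩ : interior (closure Ω) = Ω) {T S : ι}
    (hne : T ≠ S) {i j : Fin (d + 1)} (hf : facet (b T) i = facet (b S) j) {z : E d}
    (hz : (b T).coord i z = 0) (hzk : ∀ k, k ≠ i → 0 < (b T).coord k z) : z ∈ Ω := by
  rw [← hΩ, mem_interior_iff_mem_nhds]
  filter_upwards [h.eventually_mem_of_shared hne hf hz hzk] with x hx
  exact hx.elim (fun hx => h.closure_subset T hx) (fun hx => h.closure_subset S hx)

theorem eq_zero_of_notMem (h : IsTriangulation b Ω) (hΩ : interior (closure Ω) = Ω)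
    (h0 : ∀ T i, facet (b T) i ⊆ frontier Ω → ∀ x ∈ facet (b T) i, f T x = 0)
    {z : E d} {T : ι} (hz : z ∉ skeleton b) (hzΩ : z ∉ Ω) (hT : z ∈ closure (simplex (b T))) :
    f T z = 0 := by
  obtain ⟨i, hi, hif, hik⟩ := exists_coord_eq_zero hz hT fun h' => hzΩ (h.subset T h')
  rcases h.regular T i with hfr | ⟨S, hST, j, hSj⟩
  · exact h0 T i hfr z hif
  · exact absurd (h.mem_interior_of_shared hΩ hST.symm hSj.symm hi hik) hzΩ

/-- Off the skeleton, a point of `Ω` is inside one element or in the relative interior of a facet.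
Such a facet is not in the boundary, so it is shared, and near the point there are only its two
elements. -/
theorem eq_of_mem_closure (h : IsTriangulation b Ω) (hΩ : interior (closure Ω) = Ω)
    (h0 : ∀ T i, facet (b T) i ⊆ frontier Ω → ∀ x ∈ facet (b T) i, f T x = 0)
    (h1 : ∀ T S i j, T ≠ S → facet (b S) j = facet (b T) i → ∀ x ∈ facet (b T) i, f T x = f S x)
    {z : E d} {T S : ι} (hz : z ∉ skeleton b) (hT : z ∈ closure (simplex (b T)))
    (hS : z ∈ closure (simplex (b S))) : f T z = f S z := by
  by_cases hzΩ : z ∈ Ω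
  swap
  · rw [h.eq_zero_of_notMem hΩ h0 hz hzΩ hT, h.eq_zero_of_notMem hΩ h0 hz hzΩ hS]
  by_cases hTz : z ∈ simplex (b T)
  · rw [h.eq_of_mem hTz hS]
  obtain ⟨i, hi, hif, hik⟩ := exists_coord_eq_zero hz hT hTz
  rcases h.regular T i with hfr | ⟨S', hST, j, hSj⟩
  · have hint := (hfr hif).2
    have hΩo : IsOpen Ω := hΩ ▸ isOpen_interior
    exact absurd hzΩ (hΩo.interior_eq ▸ hint)
  have hS' : S = T ∨ S = S' := by
    by_contra! hcon
    have hev := h.eventually_mem_of_shared hST.symm hSj.symm hi hik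
    obtain ⟨U, hU, hUo, hzU⟩ := _root_.eventually_nhds_iff.1 hev
    obtain ⟨y, hyU, hyS⟩ := mem_closure_iff.1 hS U hUo hzU
    rcases hU y hyU with hy | hy
    · exact hcon.1 (h.eq_of_mem hyS hy)
    · exact hcon.2 (h.eq_of_mem hyS hy)
  rcases hS' with rfl | rfl
  · rfl
  · exact h1 T S i j hST.symm hSj z hif

/-- A selection of the elementwise functions `f T`, extended by zero. -/
noncomputable def select (b : ι → AffineBasis (Fin (d + 1)) ℝ (E d)) (f : ι → E d → ℝ)
    (x : E d) : ℝ :=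
  open Classical in if h : ∃ T, x ∈ closure (simplex (b T)) then f h.choose x else 0

theorem select_eq (h : IsTriangulation b Ω) (hΩ : interior (closure Ω) = Ω)
    (h0 : ∀ T i, facet (b T) i ⊆ frontier Ω → ∀ x ∈ facet (b T) i, f T x = 0)
    (h1 : ∀ T S i j, T ≠ S → facet (b S) j = facet (b T) i → ∀ x ∈ facet (b T) i, f T x = f S x)
    {z : E d} {T : ι} (hz : z ∉ skeleton b) (hT : z ∈ closure (simplex (b T))) :
    select b f z = f T z := by
  have hex : ∃ T, z ∈ closure (simplex (b T)) := ⟨T, hT⟩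
  rw [select, dif_pos hex]
  exact h.eq_of_mem_closure hΩ h0 h1 hz hex.choose_spec hT

theorem select_eq_zero (h : IsTriangulation b Ω) (hΩ : interior (closure Ω) = Ω)
    (h0 : ∀ T i, facet (b T) i ⊆ frontier Ω → ∀ x ∈ facet (b T) i, f T x = 0)
    {z : E d} (hz : z ∉ skeleton b) (hzΩ : z ∉ Ω) : select b f z = 0 := by
  by_cases hex : ∃ T, z ∈ closure (simplex (b T))
  · rw [select, dif_pos hex]
    exact h.eq_zero_of_notMem hΩ h0 hz hzΩ hex.choose_spec
  · rw [select, dif_neg hex]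

/-- Every closed element containing a point `w` near `z` also contains `z`, and any of these may be
used to evaluate the selection at `z`. So the estimate takes place within one element; if no element
contains `w`, both values are zero. -/
theorem eventually_dist_select_le [Finite ι] (h : IsTriangulation b Ω)
    (hΩ : interior (closure Ω) = Ω) {L : ℝ≥0}
    (hL : ∀ T, LipschitzOnWith L (f T) (closure (simplex (b T))))
    (h0 : ∀ T i, facet (b T) i ⊆ frontier Ω → ∀ x ∈ facet (b T) i, f T x = 0)
    (h1 : ∀ T S i j, T ≠ S → facet (b S) j = facet (b T) i → ∀ x ∈ facet (b T) i, f T x = f S x)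
    {z : E d} (hz : z ∉ skeleton b) :
    ∀ᶠ w in 𝓝 z, dist (select b f w) (select b f z) ≤ L * dist w z := by
  have hΩo : IsOpen Ω := hΩ ▸ isOpen_interior
  have e1 : ∀ᶠ w in 𝓝 z, ∀ T, w ∈ closure (simplex (b T)) → z ∈ closure (simplex (b T)) := by
    refine Filter.eventually_all.2 fun T => ?_
    by_cases hT : z ∈ closure (simplex (b T))
    · exact Filter.Eventually.of_forall fun _ _ => hT
    · filter_upwards [isClosed_closure.isOpen_compl.mem_nhds hT] with w hw hw'
      exact absurd hw' hw
  have e2 : ∀ᶠ w in 𝓝 z, z ∈ Ω → w ∈ Ω := by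
    by_cases hzΩ : z ∈ Ω
    · filter_upwards [hΩo.mem_nhds hzΩ] with w hw _ using hw
    · exact Filter.Eventually.of_forall fun _ h => absurd h hzΩ
  filter_upwards [e1, e2] with w hw1 hw2
  by_cases hex : ∃ T, w ∈ closure (simplex (b T))
  · have hw := hex.choose_spec
    have hzT := hw1 _ hw
    rw [h.select_eq hΩ h0 h1 hz hzT]
    conv_lhs => rw [select, dif_pos hex]
    exact (hL _).dist_le_mul w hw z hzT
  · have hzΩ : z ∉ Ω := fun hzΩ => hex (h.exists_mem (subset_closure (hw2 hzΩ)))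
    rw [h.select_eq_zero hΩ h0 hz hzΩ, select, dif_neg hex, dist_self]
    positivity

end Glue

end IsTriangulation

/-- Continuous induction along the segment: the parameters at which the bound holds form a closed
set that can always be continued to the right. -/
theorem dist_le_of_segment {d : ℕ} {F : E d → ℝ} {L : ℝ≥0} {x y : E d}
    (h : ∀ z ∈ segment ℝ x y, ∀ᶠ w in 𝓝 z, dist (F w) (F z) ≤ L * dist w z) :
    dist (F x) (F y) ≤ L * dist x y := by
  let γ : ℝ → E d := fun t => AffineMap.lineMap x y t
  have hγc : Continuous γ := AffineMap.lineMap_continuous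
  have hγd : ∀ s t, dist (γ s) (γ t) = dist s t * dist x y := fun s t =>
    dist_lineMap_lineMap x y s t
  have hγm : ∀ t ∈ Icc (0 : ℝ) 1, γ t ∈ segment ℝ x y := by
    intro t ht
    rw [segment_eq_image_lineMap]
    exact ⟨t, ht, rfl⟩
  have hFc : ContinuousOn (F ∘ γ) (Icc 0 1) := by
    intro t ht
    refine (ContinuousAt.comp ?_ hγc.continuousAt).continuousWithinAt
    rw [ContinuousAt, tendsto_iff_dist_tendsto_zero]
    have h2 : Filter.Tendsto (fun w => L * dist w (γ t)) (𝓝 (γ t)) (𝓝 0) := by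
      have : Continuous fun w => L * dist w (γ t) := by fun_prop
      simpa using this.tendsto (γ t)
    exact squeeze_zero' (Filter.Eventually.of_forall fun _ => dist_nonneg) (h _ (hγm t ht)) h2
  let s : Set ℝ := {t | dist (F (γ 0)) (F (γ t)) ≤ L * (t * dist x y)}
  have hs : IsClosed (s ∩ Icc 0 1) := by
    have h3 : ContinuousOn (fun t => dist (F (γ 0)) (F (γ t)) - L * (t * dist x y)) (Icc 0 1) :=
      ((continuous_const.dist continuous_id).comp_continuousOn hFc).sub (by fun_prop)
    have h4 := h3.preimage_isClosed_of_isClosed isClosed_Icc (isClosed_Iic (a := (0 : ℝ)))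
    convert h4 using 1
    ext t
    simp [s, and_comm]
  have hsub := hs.Icc_subset_of_forall_exists_gt (by simp [s]) (by
    rintro t ⟨hts, ht0, ht1⟩ u hu
    have hev := hγc.continuousAt.eventually (h _ (hγm t ⟨ht0, ht1.le⟩))
    have hev2 : ∀ᶠ v in 𝓝[>] t, v ∈ Ioc t u := Ioc_mem_nhdsGT hu
    obtain ⟨v, hv, hv'⟩ := ((hev.filter_mono nhdsWithin_le_nhds).and hev2).exists
    refine ⟨v, ?_, hv'⟩
    have h5 : dist (F (γ 0)) (F (γ t)) ≤ L * (t * dist x y) := hts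
    rw [hγd, Real.dist_eq v t, abs_of_pos (sub_pos.2 hv'.1), dist_comm (F (γ v))] at hv
    calc dist (F (γ 0)) (F (γ v)) ≤ dist (F (γ 0)) (F (γ t)) + dist (F (γ t)) (F (γ v)) :=
          dist_triangle _ _ _
      _ ≤ L * (t * dist x y) + L * ((v - t) * dist x y) := add_le_add h5 hv
      _ = L * (v * dist x y) := by ring)
  have h6 : dist (F (γ 0)) (F (γ 1)) ≤ L * (1 * dist x y) := hsub (right_mem_Icc.2 zero_le_one)
  simpa [γ] using h6

/-! ### The skeleton has codimension two and is avoided by almost all segments. -/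

section Skeleton

variable {d : ℕ} {ι : Type*} [Finite ι] {b : ι → AffineBasis (Fin (d + 1)) ℝ (E d)}

theorem ae_notMem_skeleton (b : ι → AffineBasis (Fin (d + 1)) ℝ (E d)) :
    ∀ᵐ x, x ∉ skeleton b := by
  have h : ∀ᵐ x, ∀ T i, (b T).coord i x ≠ 0 := by
    have := Fintype.ofFinite ι
    refine ae_all_iff.2 fun T => ae_all_iff.2 fun i => ?_
    have := volume_zero_set_affine ((b T).coord i) (y := b T i) (by simp)
    simpa [ae_iff] using this
  filter_upwards [h] with x hx
  rintro ⟨T, i, -, -, h0, -⟩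
  exact hx T i h0

/-- From a point off the skeleton, almost every point can be reached by a segment which avoids the
skeleton. -/
theorem ae_segment_disjoint_skeleton {x : E d} (hx : x ∉ skeleton b) :
    ∀ᵐ y, ∀ z ∈ segment ℝ x y, z ∉ skeleton b := by
  -- If both coordinates vanish at one point of the segment, this determinant of the coordinates of
  -- `x` and `y` is zero. It is affine in `y` and not identically zero, because the two coordinates
  -- of `x` do not both vanish.
  have h : ∀ᵐ y, ∀ T i j, i ≠ j →
      (b T).coord i x * (b T).coord j y - (b T).coord j x * (b T).coord i y ≠ 0 := by
    refine ae_all_iff.2 fun T => ae_all_iff.2 fun i => ae_all_iff.2 fun j => ?_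
    by_cases hij : i = j
    · exact Filter.Eventually.of_forall fun _ hn => absurd hij hn
    let g : E d →ᵃ[ℝ] ℝ := (b T).coord i x • (b T).coord j - (b T).coord j x • (b T).coord i
    have hg : ∀ y, g y =
        (b T).coord i x * (b T).coord j y - (b T).coord j x * (b T).coord i y := fun y => rfl
    have hne : ∃ y, g y ≠ 0 := by
      by_contra! hcon
      have h1 := hcon (b T i)
      have h2 := hcon (b T j)
      rw [hg, AffineBasis.coord_apply_eq, AffineBasis.coord_apply_ne _ (Ne.symm hij)] at h1
      rw [hg, AffineBasis.coord_apply_eq, AffineBasis.coord_apply_ne _ hij] at h2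
      exact hx ⟨T, i, j, hij, by linarith, by linarith⟩
    obtain ⟨y, hy⟩ := hne
    have h3 := volume_zero_set_affine g hy
    have h4 : ∀ᵐ y, g y ≠ 0 := by simpa [ae_iff] using h3
    filter_upwards [h4] with y hy _
    rw [← hg]
    exact hy
  filter_upwards [h] with y hy z hz hzs
  obtain ⟨T, i, j, hij, hi, hj⟩ := hzs
  rw [segment_eq_image_lineMap] at hz
  obtain ⟨t, -, rfl⟩ := hz
  rw [AffineMap.apply_lineMap, AffineMap.lineMap_apply_ring'] at hi hj
  have h5 : t * ((b T).coord i x * (b T).coord j y - (b T).coord j x * (b T).coord i y) = 0 := by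
    linear_combination (b T).coord i x * hj - (b T).coord j x * hi
  rcases mul_eq_zero.1 h5 with ht | h6
  · rw [ht] at hi hj
    exact hx ⟨T, i, j, hij, by linarith, by linarith⟩
  · exact hy T i j hij h6

end Skeleton

/-- Elementwise Lipschitz functions which agree on common facets and vanish on boundary facets can be
glued to a Lipschitz function which vanishes outside of the domain. -/
theorem IsTriangulation.exists_lipschitz {d : ℕ} {ι : Type*} [Finite ι]
    {b : ι → AffineBasis (Fin (d + 1)) ℝ (E d)} {Ω : Set (E d)} (h : IsTriangulation b Ω)
    (hΩ : interior (closure Ω) = Ω) {L : ℝ≥0} {f : ι → E d → ℝ}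
    (hL : ∀ T, LipschitzOnWith L (f T) (closure (simplex (b T))))
    (h0 : ∀ T i, facet (b T) i ⊆ frontier Ω → ∀ x ∈ facet (b T) i, f T x = 0)
    (h1 : ∀ T S i j, T ≠ S → facet (b S) j = facet (b T) i → ∀ x ∈ facet (b T) i, f T x = f S x) :
    ∃ V : E d → ℝ, LipschitzWith L V ∧ (∀ T, EqOn V (f T) (simplex (b T))) ∧ ∀ x ∉ Ω, V x = 0 := by
  have hloc : ∀ z ∉ skeleton b, ∀ᶠ w in 𝓝 z,
      dist (select b f w) (select b f z) ≤ L * dist w z :=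
    fun z hz => h.eventually_dist_select_le hΩ hL h0 h1 hz
  have hdense : Dense (skeleton b)ᶜ := Measure.dense_of_ae (ae_notMem_skeleton b)
  have hlip : LipschitzOnWith L (select b f) (skeleton b)ᶜ := by
    refine LipschitzOnWith.of_dist_le_mul fun x hx y hy => ?_
    have hd2 := Measure.dense_of_ae (ae_segment_disjoint_skeleton hx)
    obtain ⟨u, hu, hlim⟩ := mem_closure_iff_seq_limit.1 (hd2 y)
    -- The segment from `x` to `y` may meet the skeleton, so `y` is approached by points whose
    -- segments from `x` avoid it.
    have hest : ∀ n, dist (select b f x) (select b f (u n)) ≤ L * dist x (u n) := fun n =>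
      dist_le_of_segment fun z hz => hloc z (hu n z hz)
    have hcont : ContinuousAt (select b f) y := by
      rw [ContinuousAt, tendsto_iff_dist_tendsto_zero]
      have h2 : Filter.Tendsto (fun w => L * dist w y) (𝓝 y) (𝓝 0) := by
        have : Continuous fun w => L * dist w y := by fun_prop
        simpa using this.tendsto y
      exact squeeze_zero' (Filter.Eventually.of_forall fun _ => dist_nonneg) (hloc y hy) h2
    exact le_of_tendsto_of_tendsto' (tendsto_const_nhds.dist (hcont.tendsto.comp hlim))
      ((tendsto_const_nhds.dist hlim).const_mul _) hest
  obtain ⟨V, hV, hVeq⟩ := hlip.extend_real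
  refine ⟨V, hV, fun T x hx => ?_, fun x hx => ?_⟩
  · have hTf : ContinuousOn (f T) (simplex (b T)) := (hL T).continuousOn.mono subset_closure
    obtain ⟨u, hu, hlim⟩ := mem_closure_iff_seq_limit.1
      (hdense.open_subset_closure_inter (isOpen_simplex (b T)) hx)
    have hlim' : Filter.Tendsto u Filter.atTop (𝓝[simplex (b T)] x) :=
      tendsto_nhdsWithin_iff.2 ⟨hlim, Filter.Eventually.of_forall fun n => (hu n).1⟩
    refine tendsto_nhds_unique ((hV.continuous.tendsto x).comp hlim) ?_
    refine ((hTf x hx).tendsto.comp hlim').congr fun n => ?_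
    exact ((hVeq (hu n).2).symm.trans (h.select_eq hΩ h0 h1 (hu n).2 (subset_closure (hu n).1))).symm
  · have hx' : x ∈ closure ((closure Ω)ᶜ) := by
      rw [closure_compl, hΩ]
      exact hx
    have hcl : closure ((closure Ω)ᶜ) ⊆ closure ((closure Ω)ᶜ ∩ (skeleton b)ᶜ) :=
      closure_minimal (hdense.open_subset_closure_inter isClosed_closure.isOpen_compl)
        isClosed_closure
    obtain ⟨u, hu, hlim⟩ := mem_closure_iff_seq_limit.1 (hcl hx')
    refine tendsto_nhds_unique ((hV.continuous.tendsto x).comp hlim) ?_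
    refine tendsto_const_nhds.congr fun n => ?_
    refine ((hVeq (hu n).2).symm.trans (h.select_eq_zero hΩ h0 (hu n).2 fun hm => ?_)).symm
    exact (hu n).1 (subset_closure hm)

end HpFem

namespace HpFem

open MvPolynomial

/-! ### Vanishing and matching of polynomials on facets. -/

section FacetPolynomial

theorem eval_smul_of_isHomogeneous {τ : Type*} [Fintype τ] {q : ℕ} {Q : MvPolynomial τ ℝ}
    (hQ : Q.IsHomogeneous q) (s : ℝ) (y : τ → ℝ) : eval (s • y) Q = s ^ q * eval y Q := by
  rw [eval_eq', eval_eq', Finset.mul_sum]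
  refine Finset.sum_congr rfl fun α hα => ?_
  have h1 : ∑ i, α i = q := by
    rw [← Finsupp.degree_eq_sum, Finsupp.degree_eq_weight_one]
    exact hQ (mem_support_iff.1 hα)
  simp only [Pi.smul_apply, smul_eq_mul, mul_pow, Finset.prod_mul_distrib]
  rw [Finset.prod_pow_eq_pow_sum, h1]
  ring

theorem eval_face {τ : Type*} [Fintype τ] [DecidableEq τ] (F : Finset τ) (Q : MvPolynomial τ ℝ)
    (y : τ → ℝ) : eval y (face F Q) = eval (fun i => if i ∈ F then y i else 0) Q := by
  induction Q using MvPolynomial.induction_on with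
  | C a => simp [face]
  | add p q hp hq => rw [map_add, map_add, map_add, hp, hq]
  | mul_X p i hp =>
    rw [map_mul, map_mul, map_mul, hp, face_X, eval_X]
    split_ifs <;> simp

variable {d : ℕ} {b b' : AffineBasis (Fin (d + 1)) ℝ (E d)} {i j : Fin (d + 1)}

theorem exists_bary_eq (b : AffineBasis (Fin (d + 1)) ℝ (E d)) {w : Fin (d + 1) → ℝ}
    (hw : ∑ k, w k = 1) : ∃ x, bary b x = w :=
  ⟨Finset.univ.affineCombination ℝ b w, funext fun k =>
    b.coord_apply_combination_of_mem (Finset.mem_univ k) hw⟩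

/-- Homogeneity spreads vanishing from the facet, where the coordinates sum to 1, to the cone over
it; a polynomial vanishing on the positive orthant is zero. The scaling needs a second vertex, hence
`1 ≤ d`. -/
theorem face_compl_eq_zero_iff (hd : 1 ≤ d) {q : ℕ} {Q : MvPolynomial (Fin (d + 1)) ℝ}
    (hQ : Q.IsHomogeneous q) :
    (∀ x ∈ facet b i, eval (bary b x) Q = 0) ↔ face {i}ᶜ Q = 0 := by
  have hsub : ∀ y : Fin (d + 1) → ℝ, y i = 0 →
      (fun k => if k ∈ ({i}ᶜ : Finset (Fin (d + 1))) then y k else 0) = y := by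
    intro y hy
    funext k
    by_cases hk : k = i
    · simp [hk, hy]
    · simp [hk]
  constructor
  · intro h
    refine MvPolynomial.funext_set (fun _ => Ioi (0 : ℝ)) (fun _ => Ioi_infinite 0) fun y hy => ?_
    rw [map_zero, eval_face]
    set y' : Fin (d + 1) → ℝ := fun k => if k ∈ ({i}ᶜ : Finset (Fin (d + 1))) then y k else 0
      with hy'
    have hy0 : ∀ k, 0 < y k := fun k => hy k (mem_univ k)
    have hy'0 : ∀ k, 0 ≤ y' k := by
      intro k
      simp only [hy']
      split_ifs
      exacts [(hy0 k).le, le_rfl]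
    have hs : 0 < ∑ k, y' k := by
      have : Nontrivial (Fin (d + 1)) := Fin.nontrivial_iff_two_le.2 (by omega)
      obtain ⟨k, hk⟩ := exists_ne i
      refine Finset.sum_pos' (fun k _ => hy'0 k) ⟨k, Finset.mem_univ k, ?_⟩
      simp [hy', hk, hy0]
    set s := ∑ k, y' k with hs'
    obtain ⟨x, hx⟩ := exists_bary_eq b (w := s⁻¹ • y') (by
      simp only [Pi.smul_apply, smul_eq_mul]
      rw [← Finset.mul_sum, ← hs', inv_mul_cancel₀ hs.ne'])
    have hxk : ∀ k, b.coord k x = s⁻¹ * y' k := fun k => congrFun hx k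
    have h1 := h x ⟨by rw [hxk]; simp [hy'], fun k => by
      rw [hxk]; exact mul_nonneg (inv_nonneg.2 hs.le) (hy'0 k)⟩
    have h2 : y' = s • bary b x := by rw [hx, smul_smul, mul_inv_cancel₀ hs.ne', one_smul]
    rw [h2, eval_smul_of_isHomogeneous hQ, h1, mul_zero]
  · intro h x hx
    rw [← hsub (bary b x) hx.1, ← eval_face, h, map_zero]

theorem eval_bary_eq_of_mem_facet {π : Equiv.Perm (Fin (d + 1))}
    (hπ : ∀ k, k ≠ i → b k = b' (π k)) {x : E d} (hx : x ∈ facet b i)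
    (Q : MvPolynomial (Fin (d + 1)) ℝ) :
    eval (bary b' x) Q = eval (bary b x) (rename π.symm Q) := by
  have h : bary b' x = bary b x ∘ π.symm := by
    funext l
    obtain ⟨k, rfl⟩ := π.surjective l
    have h1 := coord_perm_apply hπ k x
    rw [hx.1, zero_mul, add_zero] at h1
    simp only [Function.comp_apply, Equiv.symm_apply_apply]
    refine h1.trans ?_
    by_cases hk : k = i
    · rw [if_pos hk, hk]; exact hx.1.symm
    · rw [if_neg hk]; rfl
  rw [h, eval_rename]

/-- Elementwise application of `reduce` preserves matching along a common facet. -/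
theorem eval_reduce_eq_of_facet (hd : 1 ≤ d) {p : ℕ} {P P' : MvPolynomial (Fin (d + 1)) ℝ}
    (hP : P.IsHomogeneous (p + 2)) (hP' : P'.IsHomogeneous (p + 2)) (hf : facet b' j = facet b i)
    (h : ∀ x ∈ facet b i, eval (bary b x) P = eval (bary b' x) P') :
    ∀ x ∈ facet b i, eval (bary b x) (reduce p P) = eval (bary b' x) (reduce p P') := by
  obtain ⟨π, -, hπ⟩ := exists_perm_of_facet_eq hf.symm
  -- In the numbering of `b`, both polynomials agree on the facet exactly if this difference
  -- vanishes there. That property survives `reduce`, which commutes with the renumbering.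
  have hD : (P - rename π.symm P').IsHomogeneous (p + 2) := hP.sub hP'.rename_isHomogeneous
  have h0 : face {i}ᶜ (P - rename π.symm P') = 0 := by
    rw [← face_compl_eq_zero_iff (b := b) hd hD]
    intro x hx
    rw [map_sub, h x hx, eval_bary_eq_of_mem_facet hπ hx, sub_self]
  have h1 := face_reduce_eq_zero hD h0
  rw [← face_compl_eq_zero_iff (b := b) hd (isHomogeneous_reduce p _)] at h1
  intro x hx
  have h2 := h1 x hx
  rw [map_sub, map_sub, sub_eq_zero, ← rename_reduce] at h2
  rw [h2, eval_bary_eq_of_mem_facet hπ hx]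

theorem eval_reduce_eq_zero_of_facet (hd : 1 ≤ d) {p : ℕ} {P : MvPolynomial (Fin (d + 1)) ℝ}
    (hP : P.IsHomogeneous (p + 2)) (h : ∀ x ∈ facet b i, eval (bary b x) P = 0) :
    ∀ x ∈ facet b i, eval (bary b x) (reduce p P) = 0 :=
  (face_compl_eq_zero_iff hd (isHomogeneous_reduce p _)).2
    (face_reduce_eq_zero hP ((face_compl_eq_zero_iff hd hP).1 h))

end FacetPolynomial

/-! ### Elementwise reduction preserves `H¹₀`. -/

section Trace

variable {d : ℕ}

theorem contDiff_eval_bary (b : AffineBasis (Fin (d + 1)) ℝ (E d))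
    (P : MvPolynomial (Fin (d + 1)) ℝ) {n : WithTop ℕ∞} :
    ContDiff ℝ n fun x => eval (bary b x) P := by
  have hc : ∀ i, ContDiff ℝ n (fun x => bary b x i) := fun i =>
    (⟨b.coord i, continuous_coord b i⟩ : E d →ᴬ[ℝ] ℝ).contDiff
  simp only [eval_eq']
  exact ContDiff.sum fun α _ => contDiff_const.mul (contDiff_prod fun i _ => (hc i).pow _)

theorem isCompact_closure_simplex (b : AffineBasis (Fin (d + 1)) ℝ (E d)) :
    IsCompact (closure (simplex b)) := (isBounded_simplex b).isCompact_closure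

variable {ι : Type*} [Finite ι] {b : ι → AffineBasis (Fin (d + 1)) ℝ (E d)} {Ω : Set (E d)}

theorem exists_norm_gradient_le {f : ι → E d → ℝ} (hf : ∀ T, ContDiff ℝ 1 (f T)) :
    ∃ L : ℝ≥0, ∀ T, ∀ x ∈ closure (simplex (b T)), ‖gradient (f T) x‖ ≤ L := by
  have := Fintype.ofFinite ι
  have h : ∀ T, ∃ L : ℝ, ∀ x ∈ closure (simplex (b T)), ‖gradient (f T) x‖ ≤ L := fun T =>
    (isCompact_closure_simplex (b T)).exists_bound_of_continuousOn
      (continuous_gradient (hf T)).continuousOn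
  choose L hL using h
  refine ⟨∑ T, (L T).toNNReal, fun T x hx => (hL T x hx).trans ((Real.le_coe_toNNReal _).trans ?_)⟩
  exact_mod_cast Finset.single_le_sum (f := fun T => (L T).toNNReal) (fun _ _ => zero_le)
    (Finset.mem_univ T)

theorem exists_lipschitzOnWith {f : ι → E d → ℝ} (hf : ∀ T, ContDiff ℝ 1 (f T)) :
    ∃ L : ℝ≥0, ∀ T, LipschitzOnWith L (f T) (closure (simplex (b T))) := by
  obtain ⟨L, hL⟩ := exists_norm_gradient_le (b := b) hf
  refine ⟨L, fun T => (convex_simplex (b T)).closure.lipschitzOnWith_of_nnnorm_fderiv_le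
    (fun x _ => (hf T).differentiable one_ne_zero x) fun x hx => ?_⟩
  have := hL T x hx
  rw [norm_gradient] at this
  exact_mod_cast this

theorem IsTriangulation.ae_mem_iUnion (h : IsTriangulation b Ω) :
    ∀ᵐ x, x ∈ Ω → ∃ T, x ∈ simplex (b T) := by
  have h1 : ∀ᵐ x, ∀ T, x ∉ frontier (simplex (b T)) := by
    refine ae_all_iff.2 fun T => ?_
    have := (convex_simplex (b T)).addHaar_frontier (volume : Measure (E d))
    rwa [measure_eq_zero_iff_ae_notMem] at this
  filter_upwards [h1] with x hx hxΩ
  obtain ⟨T, hT⟩ := h.exists_mem (subset_closure hxΩ)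
  refine ⟨T, ?_⟩
  by_contra hn
  exact hx T ⟨hT, by rwa [(isOpen_simplex _).interior_eq]⟩

/-- An elementwise smooth function in `H¹₀` extends by zero to a Lipschitz function. -/
theorem MemH10.exists_lipschitz (h : IsTriangulation b Ω) (hΩ : interior (closure Ω) = Ω)
    (hb : Bornology.IsBounded Ω) {v : E d → ℝ} (hv : MemH10 Ω v) {f : ι → E d → ℝ}
    (hf : ∀ T, ContDiff ℝ 1 (f T)) (hvf : ∀ T, v =ᵐ[volume.restrict (simplex (b T))] f T) :
    ∃ V : E d → ℝ, (∀ T, EqOn V (f T) (closure (simplex (b T)))) ∧ ∀ x ∉ Ω, V x = 0 := by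
  have hΩo : IsOpen Ω := hΩ ▸ isOpen_interior
  obtain ⟨g, hg, hg0⟩ := hv.exists_hasWeakGradient hΩo hb
  obtain ⟨L, hL⟩ := exists_norm_gradient_le (b := b) hf
  have hgT : ∀ T, g =ᵐ[volume.restrict (simplex (b T))] gradient (f T) := fun T =>
    ((hg.mono (h.subset T)).congr (hvf T) Filter.EventuallyEq.rfl).ae_eq (isOpen_simplex _)
      (hasWeakGradient_of_contDiff (hf T) _)
  -- The weak gradient of the zero extension is elementwise the classical gradient, and so is
  -- bounded; this gives a Lipschitz representative on the whole space and thereby traces on facets.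
  have hbd : ∀ᵐ x, ‖Ω.indicator g x‖ ≤ L := by
    have h1 : ∀ᵐ x, ∀ T, x ∈ simplex (b T) → g x = gradient (f T) x :=
      ae_all_iff.2 fun T => ae_imp_of_ae_restrict (hgT T)
    filter_upwards [h1, h.ae_mem_iUnion] with x hx1 hx2
    by_cases hx : x ∈ Ω
    · obtain ⟨T, hT⟩ := hx2 hx
      rw [indicator_of_mem hx, hx1 T hT]
      exact hL T x (subset_closure hT)
    · rw [indicator_of_notMem hx, norm_zero]
      exact L.2
  obtain ⟨V, hV, hvV⟩ := exists_lipschitz_ae_eq hg0 hbd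
  refine ⟨V, fun T => ?_, fun x hx => ?_⟩
  · refine EqOn.closure ?_ hV.continuous (hf T).continuous
    refine Measure.eqOn_open_of_ae_eq (μ := volume) ?_ (isOpen_simplex _)
      hV.continuous.continuousOn (hf T).continuous.continuousOn
    filter_upwards [hvf T, ae_restrict_of_ae hvV, ae_restrict_mem (isOpen_simplex _).measurableSet]
      with x h1 h2 h3
    rw [← h2, indicator_of_mem (h.subset T h3), h1]
  · have h1 : EqOn V (fun _ => 0) (closure ((closure Ω)ᶜ)) := by
      refine EqOn.closure ?_ hV.continuous continuous_const
      refine Measure.eqOn_open_of_ae_eq (μ := volume) ?_ isClosed_closure.isOpen_compl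
        hV.continuous.continuousOn continuousOn_const
      filter_upwards [ae_restrict_of_ae hvV,
        ae_restrict_mem isClosed_closure.isOpen_compl.measurableSet] with x h2 h3
      rw [← h2, indicator_of_notMem fun hm => h3 (subset_closure hm)]
    refine h1 ?_
    rw [closure_compl, hΩ]
    exact hx

/-- Elementwise application of `reduce` preserves `H¹₀`. -/
theorem MemH10.of_reduce (hd : 1 ≤ d) (h : IsTriangulation b Ω) (hΩ : interior (closure Ω) = Ω)
    (hb : Bornology.IsBounded Ω) {p : ℕ} {v w : E d → ℝ} (hv : MemH10 Ω v)
    {P : ι → MvPolynomial (Fin (d + 1)) ℝ} (hP : ∀ T, (P T).IsHomogeneous (p + 2))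
    (hvP : ∀ T, v =ᵐ[volume.restrict (simplex (b T))] fun x => eval (bary (b T) x) (P T))
    (hwP : ∀ T, w =ᵐ[volume.restrict (simplex (b T))]
      fun x => eval (bary (b T) x) (reduce p (P T))) : MemH10 Ω w := by
  have hΩo : IsOpen Ω := hΩ ▸ isOpen_interior
  have hc : ∀ (Q : ι → MvPolynomial (Fin (d + 1)) ℝ) (T : ι),
      ContDiff ℝ 1 fun x => eval (bary (b T) x) (Q T) := fun Q T =>
    contDiff_eval_bary (b T) (Q T)
  have hcl : ∀ T i, facet (b T) i ⊆ closure (simplex (b T)) := fun T i x hx =>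
    mem_closure_simplex.2 hx.2
  obtain ⟨V, hVf, hV0⟩ := hv.exists_lipschitz h hΩ hb (hc P) hvP
  obtain ⟨L, hL⟩ := exists_lipschitzOnWith (b := b) (hc fun T => reduce p (P T))
  obtain ⟨W, hW, hWf, hW0⟩ := h.exists_lipschitz hΩ hL
    (by
      intro T i hi
      refine eval_reduce_eq_zero_of_facet hd (hP T) fun x hx => ?_
      exact (hVf T (hcl T i hx)).symm.trans
        (hV0 x fun hm => (hi hx).2 (by rwa [hΩo.interior_eq])))
    (by
      intro T S i j _ hf
      refine eval_reduce_eq_of_facet hd (hP T) (hP S) hf fun x hx => ?_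
      exact (hVf T (hcl T i hx)).symm.trans (hVf S (hcl S j (hf ▸ hx))))
  refine memH10_of_lipschitz hΩo hb (compl_nonempty_of_isBounded hd hb) hW hW0 ?_
  have h1 : ∀ᵐ x, ∀ T, x ∈ simplex (b T) → w x = eval (bary (b T) x) (reduce p (P T)) :=
    ae_all_iff.2 fun T => ae_imp_of_ae_restrict (hwP T)
  rw [Filter.EventuallyEq, ae_restrict_iff' hΩo.measurableSet]
  filter_upwards [h1, h.ae_mem_iUnion] with x hx1 hx2 hx
  obtain ⟨T, hT⟩ := hx2 hx
  rw [hx1 T hT, hWf T hT]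

end Trace

end HpFem

namespace HpFem

open MvPolynomial

/-! ### Norm estimates on one simplex. -/

section Estimates

variable {d : ℕ} (b : AffineBasis (Fin (d + 1)) ℝ (E d))

/-- The square of the `L²`-norm over a simplex of a polynomial in barycentric coordinates. -/
noncomputable def sqNorm (Q : MvPolynomial (Fin (d + 1)) ℝ) : ℝ :=
  ∫ x in simplex b, eval (bary b x) Q ^ 2

theorem exists_sqNorm_eq : ∃ c, 0 ≤ c ∧ ∀ (m : ℕ) (Q : MvPolynomial (Fin (d + 1)) ℝ),
    Q.IsHomogeneous m → sqNorm b Q = c / ((m + m + d).factorial : ℝ) * expInt _ (Q * Q) := by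
  obtain ⟨c, hc, h⟩ := exists_integral_simplex_eq b
  refine ⟨c, hc, fun m Q hQ => ?_⟩
  rw [← h (m + m) (Q * Q) (hQ.mul hQ), sqNorm]
  simp only [map_mul, sq]

/-- The exponent `d (d + 1) / 2` in the stability estimate for `reduce`. -/
def reduceExponent (d : ℕ) : ℕ :=
  ∑ j ∈ Finset.range (d + 1), (d + 1 - (j + 1))

theorem reduceExponent_mul_two (d : ℕ) : reduceExponent d * 2 = (d + 1) * d := by
  have h1 : reduceExponent d = ∑ j ∈ Finset.range (d + 1), j := by
    rw [← Finset.sum_range_reflect, reduceExponent]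
    refine Finset.sum_congr rfl fun j _ => ?_
    omega
  rw [h1, Finset.sum_range_id_mul_two, Nat.add_sub_cancel]

/-- The constant in the stability estimate for `reduce`. -/
noncomputable def reduceConst (d : ℕ) : ℝ :=
  ((d + 1 : ℕ) : ℝ) ^ 2 * 4 ^ (d + 1) * stageConst (d + 1) ^ (d + 1)

theorem one_le_reduceConst (d : ℕ) : 1 ≤ reduceConst d := by
  have h1 : (1 : ℝ) ≤ ((d + 1 : ℕ) : ℝ) := by push_cast; linarith [(Nat.cast_nonneg d : (0 : ℝ) ≤ d)]
  exact one_le_mul_of_one_le_of_one_le (one_le_mul_of_one_le_of_one_le (one_le_pow₀ h1)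
    (one_le_pow₀ (by norm_num))) (one_le_pow₀ (one_le_stageConst _))

theorem sqNorm_sub_reduce_le {p : ℕ} {f : MvPolynomial (Fin (d + 1)) ℝ}
    (hf : f.IsHomogeneous (p + 2)) :
    sqNorm b (f - psum Finset.univ ^ 2 * reduce p f) ≤
      reduceConst d * ((p : ℝ) + 3) ^ reduceExponent d * sqNorm b f := by
  obtain ⟨c, hc, h⟩ := exists_sqNorm_eq b
  have hQ : (f - psum Finset.univ ^ 2 * reduce p f).IsHomogeneous (p + 2) := by
    refine hf.sub ?_
    have h1 := isHomogeneous_psum_sq_mul (F := Finset.univ) (isHomogeneous_reduce p f)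
    exact h1
  rw [h _ _ hQ, h _ _ hf]
  have h2 := expInt_sub_reduce_sq_le hf
  rw [Fintype.card_fin] at h2
  have h3 : (((p + 2 : ℕ) : ℝ) + 1) = (p : ℝ) + 3 := by push_cast; ring
  rw [h3] at h2
  have h4 : 0 ≤ c / ((p + 2 + (p + 2) + d).factorial : ℝ) := by positivity
  calc _ ≤ c / ((p + 2 + (p + 2) + d).factorial : ℝ) * (reduceConst d *
        ((p : ℝ) + 3) ^ reduceExponent d * expInt _ (f * f)) := mul_le_mul_of_nonneg_left h2 h4
    _ = _ := by ring

/-- Markov's inequality for `expInt` gives `(m + 2) ^ 2`. Because differentiation lowers the degree,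
the Dirichlet factorials change by `(2m + d + 2)(2m + d + 1)`. Together they give the usual two
powers of the degree in the norm. -/
theorem sqNorm_pderiv_le {m : ℕ} {Q : MvPolynomial (Fin (d + 1)) ℝ} (hQ : Q.IsHomogeneous (m + 1))
    (i : Fin (d + 1)) : sqNorm b (pderiv i Q) ≤
      ((2 * (m : ℝ) + d + 2) * ((m : ℝ) + 2)) ^ 2 * sqNorm b Q := by
  obtain ⟨c, hc, h⟩ := exists_sqNorm_eq b
  rw [h m _ hQ.pderiv, h _ _ hQ]
  have h1 := expInt_pderiv_sq_le hQ i
  have h0 := expInt_sq_nonneg Q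
  have hfac : ((m + 1 + (m + 1) + d).factorial : ℝ) =
      (2 * (m : ℝ) + d + 2) * ((2 * (m : ℝ) + d + 1) * ((m + m + d).factorial : ℝ)) := by
    rw [show m + 1 + (m + 1) + d = (m + m + d + 1) + 1 by omega, Nat.factorial_succ,
      Nat.factorial_succ]
    push_cast
    ring
  have hpos : (0 : ℝ) < ((m + m + d).factorial : ℝ) := by positivity
  have ha : 0 ≤ c / ((m + m + d).factorial : ℝ) := by positivity
  have hb : c / ((m + m + d).factorial : ℝ) =
      (2 * (m : ℝ) + d + 2) * (2 * (m : ℝ) + d + 1) * (c / ((m + 1 + (m + 1) + d).factorial : ℝ)) := by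
    rw [hfac]
    field_simp
  have hc' : 0 ≤ c / ((m + 1 + (m + 1) + d).factorial : ℝ) := by positivity
  calc c / ((m + m + d).factorial : ℝ) * expInt _ (pderiv i Q * pderiv i Q)
      ≤ c / ((m + m + d).factorial : ℝ) * (((m + 1 : ℕ) + 1 : ℝ) ^ 2 * expInt _ (Q * Q)) :=
        mul_le_mul_of_nonneg_left h1 ha
    _ = (2 * (m : ℝ) + d + 2) * (2 * (m : ℝ) + d + 1) * (((m + 1 : ℕ) + 1 : ℝ) ^ 2 *
          (c / ((m + 1 + (m + 1) + d).factorial : ℝ) * expInt _ (Q * Q))) := by rw [hb]; ring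
    _ ≤ (2 * (m : ℝ) + d + 2) * (2 * (m : ℝ) + d + 2) * (((m + 1 : ℕ) + 1 : ℝ) ^ 2 *
          (c / ((m + 1 + (m + 1) + d).factorial : ℝ) * expInt _ (Q * Q))) := by
        refine mul_le_mul_of_nonneg_right ?_ (by positivity)
        refine mul_le_mul_of_nonneg_left ?_ (by positivity)
        linarith
    _ = _ := by push_cast; ring

/-- The derivative of a barycentric coordinate. -/
noncomputable def coordDeriv (i : Fin (d + 1)) : E d →L[ℝ] ℝ :=
  LinearMap.toContinuousLinearMap (b.coord i).linear

theorem coordDeriv_apply (i : Fin (d + 1)) (x v : E d) :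
    coordDeriv b i v = b.coord i (x + v) - b.coord i x := by
  have := (b.coord i).map_vadd x v
  rw [vadd_eq_add, vadd_eq_add, add_comm v] at this
  rw [this, add_sub_cancel_right]
  rfl

theorem hasFDerivAt_coord (i : Fin (d + 1)) (x : E d) :
    HasFDerivAt (b.coord i) (coordDeriv b i) x := by
  have h : (b.coord i : E d → ℝ) = fun y => coordDeriv b i y + b.coord i 0 := by
    funext y
    rw [coordDeriv_apply b i 0, zero_add, sub_add_cancel]
  rw [h]
  exact (coordDeriv b i).hasFDerivAt.add_const _

theorem hasFDerivAt_eval_bary (Q : MvPolynomial (Fin (d + 1)) ℝ) (x : E d) :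
    HasFDerivAt (fun x => eval (bary b x) Q)
      (∑ i, eval (bary b x) (pderiv i Q) • coordDeriv b i) x := by
  induction Q using MvPolynomial.induction_on with
  | C a => simpa using hasFDerivAt_const a x
  | add P Q hP hQ =>
    simp only [map_add, add_smul, Finset.sum_add_distrib]
    exact hP.add hQ
  | mul_X P j hP =>
    simp only [map_mul, eval_X, pderiv_mul, map_add, add_smul, Finset.sum_add_distrib]
    have h := hP.mul (hasFDerivAt_coord b j x)
    refine h.congr_fderiv ?_
    rw [add_comm, Finset.smul_sum]
    congr 1
    · refine Finset.sum_congr rfl fun i _ => ?_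
      rw [smul_smul, mul_comm]
      rfl
    · rw [Finset.sum_eq_single j]
      · simp
      · intro i _ hij
        rw [pderiv_X_of_ne hij.symm]
        simp
      · simp

theorem norm_gradient_eval_bary_sq_le (Q : MvPolynomial (Fin (d + 1)) ℝ) {G : ℝ}
    (hG : ∀ i, ‖coordDeriv b i‖ ≤ G) (x : E d) :
    ‖gradient (fun x => eval (bary b x) Q) x‖ ^ 2 ≤
      ((d : ℝ) + 1) * G ^ 2 * ∑ i, eval (bary b x) (pderiv i Q) ^ 2 := by
  have hG0 : 0 ≤ G := (norm_nonneg _).trans (hG 0)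
  rw [norm_gradient, (hasFDerivAt_eval_bary b Q x).fderiv]
  have h1 : ‖∑ i, eval (bary b x) (pderiv i Q) • coordDeriv b i‖ ≤
      ∑ i, |eval (bary b x) (pderiv i Q)| * G := by
    refine (norm_sum_le _ _).trans (Finset.sum_le_sum fun i _ => ?_)
    rw [norm_smul, Real.norm_eq_abs]
    exact mul_le_mul_of_nonneg_left (hG i) (abs_nonneg _)
  refine (pow_le_pow_left₀ (norm_nonneg _) h1 2).trans ?_
  rw [← Finset.sum_mul, mul_pow]
  have h2 := sq_sum_le_card_mul_sum_sq (s := Finset.univ)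
    (f := fun i => |eval (bary b x) (pderiv i Q)|)
  simp only [sq_abs, Finset.card_univ, Fintype.card_fin] at h2
  push_cast at h2
  calc _ ≤ (((d : ℝ) + 1) * ∑ i, eval (bary b x) (pderiv i Q) ^ 2) * G ^ 2 :=
        mul_le_mul_of_nonneg_right h2 (sq_nonneg _)
    _ = _ := by ring

/-- The inverse estimate for polynomials in barycentric coordinates. -/
theorem integral_norm_gradient_sq_le {m : ℕ} {Q : MvPolynomial (Fin (d + 1)) ℝ}
    (hQ : Q.IsHomogeneous (m + 1)) {G : ℝ} (hG : ∀ i, ‖coordDeriv b i‖ ≤ G) :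
    ∫ x in simplex b, ‖gradient (fun x => eval (bary b x) Q) x‖ ^ 2 ≤
      (((d : ℝ) + 1) * G * ((2 * (m : ℝ) + d + 2) * ((m : ℝ) + 2))) ^ 2 * sqNorm b Q := by
  have hi : ∀ i, IntegrableOn (fun x => eval (bary b x) (pderiv i Q) ^ 2) (simplex b) := fun i =>
    integrableOn_simplex b ((continuous_eval_bary b _).pow 2)
  calc ∫ x in simplex b, ‖gradient (fun x => eval (bary b x) Q) x‖ ^ 2
      ≤ ∫ x in simplex b, ((d : ℝ) + 1) * G ^ 2 * ∑ i, eval (bary b x) (pderiv i Q) ^ 2 := by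
        refine integral_mono (integrableOn_simplex b
          ((continuous_gradient (contDiff_eval_bary b Q)).norm.pow 2))
          ((integrable_finsetSum _ fun i _ => hi i).const_mul _)
          fun x => norm_gradient_eval_bary_sq_le b Q hG x
    _ = ((d : ℝ) + 1) * G ^ 2 * ∑ i, sqNorm b (pderiv i Q) := by
        rw [integral_const_mul, integral_finsetSum _ fun i _ => hi i]
        rfl
    _ ≤ ((d : ℝ) + 1) * G ^ 2 * ∑ _i : Fin (d + 1),
          ((2 * (m : ℝ) + d + 2) * ((m : ℝ) + 2)) ^ 2 * sqNorm b Q :=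
        mul_le_mul_of_nonneg_left (Finset.sum_le_sum fun i _ => sqNorm_pderiv_le b hQ i)
          (by positivity)
    _ = _ := by
        rw [Finset.sum_const, Finset.card_univ, Fintype.card_fin, nsmul_eq_mul]
        push_cast
        ring

/-- Barycentric coordinates take values between 0 and 1 on the ball, so they change by at most 1
over a displacement of length at most `r / 2`. -/
theorem norm_coordDeriv_le {x₀ : E d} {r : ℝ} (hr : 0 < r) (hball : ball x₀ r ⊆ simplex b)
    (i : Fin (d + 1)) : ‖coordDeriv b i‖ ≤ 2 / r := by
  have hle : ∀ x ∈ simplex b, b.coord i x ≤ 1 := by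
    intro x hx
    rw [← b.sum_coord_apply_eq_one x]
    exact Finset.single_le_sum (f := fun i => b.coord i x) (fun k _ => (hx k).le)
      (Finset.mem_univ i)
  have h := ContinuousLinearMap.opNorm_bound_of_ball_bound (half_pos hr) 1 (coordDeriv b i)
    fun v hv => by
      have hx : x₀ ∈ simplex b := hball (mem_ball_self hr)
      have hxv : x₀ + v ∈ simplex b := hball (by
        rw [mem_ball, dist_eq_norm, add_sub_cancel_left]
        rw [mem_closedBall, dist_zero_right] at hv
        linarith)
      rw [coordDeriv_apply b i x₀, Real.norm_eq_abs, abs_le]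
      constructor <;> linarith [hx i, hxv i, hle _ hx, hle _ hxv]
  refine h.trans (le_of_eq ?_)
  field_simp

theorem diam_simplex_pos (hd : 1 ≤ d) : 0 < diam (simplex b) := by
  have : Nonempty (Fin d) := ⟨⟨0, hd⟩⟩
  obtain ⟨x, hx⟩ := simplex_nonempty b
  have h1 : ∀ᶠ y in 𝓝[≠] x, y ∈ simplex b :=
    nhdsWithin_le_nhds ((isOpen_simplex b).mem_nhds hx)
  obtain ⟨y, hy, hyx⟩ := (h1.and self_mem_nhdsWithin).exists
  exact (dist_pos.2 hyx).trans_le (dist_le_diam_of_mem (isBounded_simplex b) hy hx)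

theorem eLpNorm_two_eq_ofReal_sqrt {F : Type*} [NormedAddCommGroup F] {f : E d → F}
    (hf : Continuous f) : eLpNorm f 2 (volume.restrict (simplex b)) =
      ENNReal.ofReal (√(∫ x in simplex b, ‖f x‖ ^ 2)) := by
  have hc : MemLp f 2 (volume.restrict (simplex b)) := by
    obtain ⟨C, hC⟩ := (isCompact_closure_simplex b).exists_bound_of_continuousOn hf.continuousOn
    have : IsFiniteMeasure (volume.restrict (simplex b)) :=
      isFiniteMeasure_restrict.2 (isBounded_simplex b).measure_lt_top.ne
    have hms : AEStronglyMeasurable f (volume.restrict (closure (simplex b))) :=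
      hf.continuousOn.aestronglyMeasurable_of_isCompact (isCompact_closure_simplex b)
        (isCompact_closure_simplex b).measurableSet
    refine MemLp.of_bound (hms.mono_measure (Measure.restrict_mono subset_closure le_rfl)) C ?_
    filter_upwards [ae_restrict_mem (isOpen_simplex b).measurableSet] with x hx
    exact hC x (subset_closure hx)
  rw [hc.eLpNorm_eq_integral_rpow_norm (by norm_num) (by norm_num), Real.sqrt_eq_rpow]
  norm_num

/-- The essential supremum of the gradient over a simplex is a bound for the oscillation. -/
theorem abs_sub_le_of_eLpNorm_gradient {φ : E d → ℝ} (hφ : ContDiff ℝ 1 φ) :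
    ∃ M : ℝ, 0 ≤ M ∧ eLpNorm (gradient φ) ∞ (volume.restrict (simplex b)) = ENNReal.ofReal M ∧
      ∀ x ∈ simplex b, ∀ y ∈ simplex b, |φ x - φ y| ≤ M * diam (simplex b) := by
  set N := eLpNorm (gradient φ) ⊤ (volume.restrict (simplex b)) with hN
  have hfin : N ≠ ⊤ := by
    obtain ⟨C, hC⟩ := (isCompact_closure_simplex b).exists_bound_of_continuousOn
      (continuous_gradient hφ).continuousOn
    rw [hN, eLpNorm_exponent_top]
    refine (eLpNormEssSup_lt_top_of_ae_bound (C := C) ?_).ne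
    filter_upwards [ae_restrict_mem (isOpen_simplex b).measurableSet] with x hx
    exact hC x (subset_closure hx)
  refine ⟨N.toReal, ENNReal.toReal_nonneg, (ENNReal.ofReal_toReal hfin).symm, ?_⟩
  have hae : ∀ᵐ x ∂volume.restrict (simplex b), ‖gradient φ x‖ ≤ N.toReal := by
    filter_upwards [enorm_ae_le_eLpNormEssSup (gradient φ) (volume.restrict (simplex b))] with x hx
    rw [← eLpNorm_exponent_top, ← hN] at hx
    rw [← toReal_enorm]
    exact ENNReal.toReal_mono hfin hx
  have hall : ∀ x ∈ simplex b, ‖gradient φ x‖ ≤ N.toReal := by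
    intro x hx
    -- An almost everywhere bound on a continuous function holds everywhere on an open set; it is
    -- phrased as equality of the maximum with the bound.
    have h1 := Measure.eqOn_open_of_ae_eq (μ := volume)
      (f := fun x => max ‖gradient φ x‖ N.toReal) (g := fun _ => N.toReal) (U := simplex b)
      (by filter_upwards [hae] with x hx using max_eq_right hx) (isOpen_simplex b)
      ((continuous_gradient hφ).norm.max continuous_const).continuousOn continuousOn_const hx
    exact max_eq_right_iff.1 h1
  intro x hx y hy
  have h2 := (convex_simplex b).norm_image_sub_le_of_norm_fderiv_le (𝕜 := ℝ)
    (fun x _ => hφ.differentiable one_ne_zero x)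
    (fun x hx => by rw [← norm_gradient]; exact hall x hx) hy hx
  rw [← Real.norm_eq_abs]
  refine h2.trans (mul_le_mul_of_nonneg_left ?_ ENNReal.toReal_nonneg)
  rw [← dist_eq_norm]
  exact dist_le_diam_of_mem (isBounded_simplex b) hx hy

end Estimates

end HpFem

namespace HpFem

open MvPolynomial

/-! ### The error bound on one element. -/

section LocalEstimate

variable {d : ℕ} (b : AffineBasis (Fin (d + 1)) ℝ (E d))

theorem eLpNorm_eval_bary (Q : MvPolynomial (Fin (d + 1)) ℝ) :
    eLpNorm (fun x => eval (bary b x) Q) 2 (volume.restrict (simplex b)) =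
      ENNReal.ofReal (√(sqNorm b Q)) := by
  rw [eLpNorm_two_eq_ofReal_sqrt b (continuous_eval_bary b Q)]
  simp only [Real.norm_eq_abs, sq_abs, sqNorm]

theorem eval_bary_psum_univ (x : E d) : eval (bary b x) (psum Finset.univ) = 1 := by
  rw [psum, map_sum]
  simp only [eval_X]
  exact sum_bary b x

theorem sqNorm_mul_le {g w : MvPolynomial (Fin (d + 1)) ℝ} {B : ℝ}
    (hB : ∀ x ∈ simplex b, |eval (bary b x) g| ≤ B) :
    sqNorm b (g * w) ≤ B ^ 2 * sqNorm b w := by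
  rw [sqNorm, sqNorm, ← integral_const_mul]
  refine setIntegral_mono_on (integrableOn_simplex b ((continuous_eval_bary b _).pow 2))
    ((integrableOn_simplex b ((continuous_eval_bary b _).pow 2)).const_mul _)
    (isOpen_simplex b).measurableSet fun x hx => ?_
  rw [map_mul, mul_pow, ← sq_abs (eval (bary b x) g)]
  exact mul_le_mul_of_nonneg_right (pow_le_pow_left₀ (abs_nonneg _) (hB x hx) 2) (sq_nonneg _)

/-- The constant in the error bound. -/
noncomputable def errorConst (d : ℕ) (σ : ℝ) : ℝ :=
  √(reduceConst d) * 2 ^ reduceExponent d * (1 + 8 * σ * (d + 1) * (d + 6))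

theorem errorConst_pos (d : ℕ) {σ : ℝ} (hσ : 1 ≤ σ) : 0 < errorConst d σ := by
  have := (zero_lt_one.trans_le (one_le_reduceConst d))
  have h2 := zero_lt_one.trans_le hσ
  rw [errorConst]
  positivity

theorem rpow_exponent_eq (d : ℕ) {p : ℝ} (hp : 1 ≤ p) :
    p ^ ((d : ℝ) * ((d : ℝ) + 1) / 4 + 2) = √(p ^ reduceExponent d) * p ^ 2 := by
  have hp0 : 0 < p := zero_lt_one.trans_le hp
  have h1 : (reduceExponent d : ℝ) * 2 = ((d : ℝ) + 1) * d := by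
    exact_mod_cast reduceExponent_mul_two d
  rw [Real.rpow_add hp0, Real.sqrt_eq_rpow, ← Real.rpow_natCast, ← Real.rpow_mul hp0.le]
  congr 1
  · congr 1
    linarith
  · exact Real.rpow_natCast p 2

/-- The error bound on a single element, with both norms expressed by real numbers. -/
theorem sqrt_sqNorm_add_le {σ h : ℝ} (hσ : 1 ≤ σ) (hh : 0 < h) {x₀ : E d}
    (hball : ball x₀ (σ⁻¹ * h) ⊆ simplex b) {p : ℕ} (hp : 1 ≤ p) {f : MvPolynomial (Fin (d + 1)) ℝ}
    (hf : f.IsHomogeneous (p + 2)) :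
    √(sqNorm b (f - psum Finset.univ ^ 2 * reduce p f)) +
        h * √(∫ x in simplex b,
          ‖gradient (fun x => eval (bary b x) (f - psum Finset.univ ^ 2 * reduce p f)) x‖ ^ 2) ≤
      errorConst d σ * (p : ℝ) ^ ((d : ℝ) * ((d : ℝ) + 1) / 4 + 2) * √(sqNorm b f) := by
  set Q := f - psum Finset.univ ^ 2 * reduce p f with hQdef
  have hQ : Q.IsHomogeneous (p + 1 + 1) :=
    hf.sub (isHomogeneous_psum_sq_mul (F := Finset.univ) (isHomogeneous_reduce p f))
  have hp1 : (1 : ℝ) ≤ p := by exact_mod_cast hp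
  have hd0 : (0 : ℝ) ≤ d := Nat.cast_nonneg d
  have hσ0 : 0 < σ := zero_lt_one.trans_le hσ
  have hr : 0 < σ⁻¹ * h := by positivity
  have hG : ∀ i, ‖coordDeriv b i‖ ≤ 2 / (σ⁻¹ * h) := norm_coordDeriv_le b hr hball
  have hgrad := integral_norm_gradient_sq_le b hQ hG
  set A := ((d : ℝ) + 1) * (2 / (σ⁻¹ * h)) *
    ((2 * ((p + 1 : ℕ) : ℝ) + d + 2) * (((p + 1 : ℕ) : ℝ) + 2)) with hA
  have hA0 : 0 ≤ A := by positivity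
  have hgrad' := Real.sqrt_le_sqrt hgrad
  rw [Real.sqrt_mul (sq_nonneg A), Real.sqrt_sq hA0] at hgrad'
  -- The factor `h` cancels the inverse inradius `σ / h` in the gradients of the barycentric
  -- coordinates. The remaining linear factors are bounded by multiples of `p` because `1 ≤ p`.
  have hAh : h * A ≤ 8 * σ * (d + 1) * (d + 6) * (p : ℝ) ^ 2 := by
    have e1 : h * A = 2 * σ * (d + 1) * ((2 * (p : ℝ) + d + 4) * ((p : ℝ) + 3)) := by
      rw [hA]
      push_cast
      field_simp
      ring
    have e2 : 2 * (p : ℝ) + d + 4 ≤ (d + 6) * p := by nlinarith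
    have e3 : (p : ℝ) + 3 ≤ 4 * p := by linarith
    have e4 : (2 * (p : ℝ) + d + 4) * ((p : ℝ) + 3) ≤ ((d + 6) * p) * (4 * p) :=
      mul_le_mul e2 e3 (by positivity) (by positivity)
    calc h * A = 2 * σ * (d + 1) * ((2 * (p : ℝ) + d + 4) * ((p : ℝ) + 3)) := e1
      _ ≤ 2 * σ * (d + 1) * (((d + 6) * p) * (4 * p)) :=
        mul_le_mul_of_nonneg_left e4 (by positivity)
      _ = _ := by ring
  have hQf := Real.sqrt_le_sqrt (sqNorm_sub_reduce_le b hf)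
  have hR : 0 ≤ reduceConst d := zero_le_one.trans (one_le_reduceConst d)
  rw [Real.sqrt_mul (by positivity), Real.sqrt_mul hR] at hQf
  -- From `p + 3 ≤ 4 * p`; the square root turns the power of 4 into a power of 2.
  have h4 : √(((p : ℝ) + 3) ^ reduceExponent d) ≤
      2 ^ reduceExponent d * √((p : ℝ) ^ reduceExponent d) := by
    have e1 : ((p : ℝ) + 3) ^ reduceExponent d ≤
        (2 ^ reduceExponent d) ^ 2 * (p : ℝ) ^ reduceExponent d := by
      rw [← pow_mul, mul_comm (reduceExponent d) 2, pow_mul, ← mul_pow]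
      exact pow_le_pow_left₀ (by positivity) (by norm_num; linarith) _
    refine (Real.sqrt_le_sqrt e1).trans (le_of_eq ?_)
    rw [Real.sqrt_mul (sq_nonneg _), Real.sqrt_sq (by positivity)]
  have hp2 : (1 : ℝ) ≤ (p : ℝ) ^ 2 := one_le_pow₀ hp1
  have hfac : 1 + h * A ≤ (1 + 8 * σ * (d + 1) * (d + 6)) * (p : ℝ) ^ 2 := by
    rw [add_mul, one_mul]
    exact add_le_add hp2 hAh
  calc √(sqNorm b Q) + h * √(∫ x in simplex b, ‖gradient (fun x => eval (bary b x) Q) x‖ ^ 2)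
      ≤ √(sqNorm b Q) + h * (A * √(sqNorm b Q)) :=
        add_le_add le_rfl (mul_le_mul_of_nonneg_left hgrad' hh.le)
    _ = (1 + h * A) * √(sqNorm b Q) := by ring
    _ ≤ ((1 + 8 * σ * (d + 1) * (d + 6)) * (p : ℝ) ^ 2) *
        (√(reduceConst d) * √(((p : ℝ) + 3) ^ reduceExponent d) * √(sqNorm b f)) :=
        mul_le_mul hfac hQf (Real.sqrt_nonneg _) (by positivity)
    _ ≤ ((1 + 8 * σ * (d + 1) * (d + 6)) * (p : ℝ) ^ 2) *
        (√(reduceConst d) * (2 ^ reduceExponent d * √((p : ℝ) ^ reduceExponent d)) *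
          √(sqNorm b f)) := by gcongr
    _ = _ := by
        rw [rpow_exponent_eq d hp1, errorConst]
        ring

/-- The error does not change if a constant multiple of `psum univ ^ 2 * w` is subtracted, as
`reduce` reproduces `w`. So `k ^ 2` may be replaced by its deviation from its value at one point,
which is at most the diameter times the supremum of its gradient. -/
theorem error_bound (hd : 1 ≤ d) {σ : ℝ} (hσ : 1 ≤ σ) {x₀ : E d}
    (hball : ball x₀ (σ⁻¹ * diam (simplex b)) ⊆ simplex b) {p : ℕ} (hp : 1 ≤ p)
    {k w : MvPolynomial (Fin (d + 1)) ℝ} (hk : k.IsHomogeneous 1) (hw : w.IsHomogeneous p) :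
    eLpNorm (fun x => eval (bary b x) (k ^ 2 * w - psum Finset.univ ^ 2 * reduce p (k ^ 2 * w))) 2
          (volume.restrict (simplex b)) +
        ENNReal.ofReal (diam (simplex b)) * gradSeminorm 2 (simplex b)
          (fun x => eval (bary b x) (k ^ 2 * w - psum Finset.univ ^ 2 * reduce p (k ^ 2 * w))) ≤
      ENNReal.ofReal (errorConst d σ * (p : ℝ) ^ ((d : ℝ) * ((d : ℝ) + 1) / 4 + 2) *
          diam (simplex b)) *
        gradSeminorm ∞ (simplex b) (fun x => eval (bary b x) k ^ 2) *
        eLpNorm (fun x => eval (bary b x) w) 2 (volume.restrict (simplex b)) := by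
  have hh := diam_simplex_pos b hd
  set h := diam (simplex b) with hhdef
  have hφ : ContDiff ℝ 1 fun x => eval (bary b x) k ^ 2 := (contDiff_eval_bary b k).pow 2
  obtain ⟨M, hM, hMeq, hosc⟩ := abs_sub_le_of_eLpNorm_gradient b hφ
  obtain ⟨y, hy⟩ := simplex_nonempty b
  set c := eval (bary b y) k ^ 2 with hc
  set g : MvPolynomial (Fin (d + 1)) ℝ := k ^ 2 - C c * psum Finset.univ ^ 2 with hg
  have hs2 : (psum (Finset.univ : Finset (Fin (d + 1))) ^ 2).IsHomogeneous 2 :=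
    (isHomogeneous_psum _).pow 2
  have hghom : g.IsHomogeneous 2 := (hk.pow 2).sub (by simpa using (isHomogeneous_C _ c).mul hs2)
  have hf : (g * w).IsHomogeneous (p + 2) := by
    simpa only [add_comm 2 p] using hghom.mul hw
  have hgB : ∀ x ∈ simplex b, |eval (bary b x) g| ≤ M * h := by
    intro x hx
    have e1 : eval (bary b x) g = eval (bary b x) k ^ 2 - c := by
      rw [hg]
      simp only [map_sub, map_mul, map_pow, eval_bary_psum_univ, eval_C, one_pow, mul_one]
    rw [e1]
    exact hosc x hx y hy
  have hfw : √(sqNorm b (g * w)) ≤ M * h * √(sqNorm b w) := by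
    refine (Real.sqrt_le_sqrt (sqNorm_mul_le b hgB)).trans (le_of_eq ?_)
    rw [Real.sqrt_mul (sq_nonneg _), Real.sqrt_sq (by positivity)]
  have hQ : k ^ 2 * w - psum Finset.univ ^ 2 * reduce p (k ^ 2 * w) =
      g * w - psum Finset.univ ^ 2 * reduce p (g * w) := by
    have e1 : g * w = k ^ 2 * w - c • (psum Finset.univ ^ 2 * w) := by
      rw [hg, smul_eq_C_mul]
      ring
    rw [e1, map_sub, map_smul, reduce_psum_sq_mul (by omega) hw, smul_eq_C_mul, smul_eq_C_mul]
    ring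
  rw [hQ]
  have hest := sqrt_sqNorm_add_le b hσ hh hball hp hf
  set Q := g * w - psum Finset.univ ^ 2 * reduce p (g * w) with hQdef
  have hQc : ContDiff ℝ 1 _ := contDiff_eval_bary b Q
  rw [gradSeminorm_eq (isOpen_simplex b) (hasWeakGradient_of_contDiff hQc _),
    gradSeminorm_eq (isOpen_simplex b) (hasWeakGradient_of_contDiff hφ _), hMeq,
    eLpNorm_eval_bary, eLpNorm_eval_bary, eLpNorm_two_eq_ofReal_sqrt b (continuous_gradient hQc),
    ← ENNReal.ofReal_mul hh.le, ← ENNReal.ofReal_add (Real.sqrt_nonneg _) (by positivity)]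
  have hC := errorConst_pos d hσ
  rw [← ENNReal.ofReal_mul (by positivity), ← ENNReal.ofReal_mul (by positivity)]
  refine ENNReal.ofReal_le_ofReal (hest.trans ?_)
  calc _ ≤ errorConst d σ * (p : ℝ) ^ ((d : ℝ) * ((d : ℝ) + 1) / 4 + 2) *
        (M * h * √(sqNorm b w)) := mul_le_mul_of_nonneg_left hfw (by positivity)
    _ = _ := by ring

end LocalEstimate

end HpFem

namespace HpFem

open MvPolynomial

/-! ### Between polynomials in Cartesian and in barycentric coordinates. -/

section Conversion

variable {d : ℕ}

/-- Affine functions are linear forms in the barycentric coordinates. Lower-order terms are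
homogenised by powers of `psum univ`, which takes the value 1. -/
theorem exists_isHomogeneous_eval_bary_eq (b : AffineBasis (Fin (d + 1)) ℝ (E d))
    (F : E d →ᵃ[ℝ] E d) {p : ℕ} {q : MvPolynomial (Fin d) ℝ} (hq : q.totalDegree ≤ p) :
    ∃ P : MvPolynomial (Fin (d + 1)) ℝ, P.IsHomogeneous p ∧
      ∀ y, eval (bary b y) P = eval (fun i => F y i) q := by
  let g : Fin d → E d →ᵃ[ℝ] ℝ := fun i =>
    ((EuclideanSpace.proj i : E d →L[ℝ] ℝ) : E d →ₗ[ℝ] ℝ).toAffineMap.comp F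
  let ℓ : Fin d → MvPolynomial (Fin (d + 1)) ℝ := fun i => ∑ k, C (g i (b k)) * X k
  have hℓ : ∀ i, (ℓ i).IsHomogeneous 1 := fun i =>
    IsHomogeneous.sum _ _ _ fun k _ => by simpa using (isHomogeneous_C _ _).mul (isHomogeneous_X ℝ k)
  have hℓe : ∀ i y, eval (bary b y) (ℓ i) = F y i := by
    intro i y
    have h : F y i = g i y := rfl
    rw [h, apply_eq_sum_coord_mul b (g i) y, map_sum]
    refine Finset.sum_congr rfl fun k _ => ?_
    rw [map_mul, eval_C, eval_X, mul_comm]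
    rfl
  refine ⟨∑ α ∈ q.support, C (q.coeff α) * (psum Finset.univ ^ (p - ∑ i, α i) * ∏ i, ℓ i ^ α i),
    IsHomogeneous.sum _ _ _ fun α hα => ?_, fun y => ?_⟩
  · have h1 : ∑ i, α i ≤ p := by
      rw [← Finsupp.sum_fintype α (fun _ e => e) (fun _ => rfl)]
      exact (le_totalDegree hα).trans hq
    have h2 : (∏ i, ℓ i ^ α i).IsHomogeneous (∑ i, α i) :=
      IsHomogeneous.prod _ _ _ fun i _ => by simpa using (hℓ i).pow (α i)
    have h3 : (psum (Finset.univ : Finset (Fin (d + 1))) ^ (p - ∑ i, α i)).IsHomogeneous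
        (p - ∑ i, α i) := by simpa using (isHomogeneous_psum Finset.univ).pow (p - ∑ i, α i)
    have h4 := (isHomogeneous_C (Fin (d + 1)) (q.coeff α)).mul (h3.mul h2)
    rwa [zero_add, Nat.sub_add_cancel h1] at h4
  · conv_rhs => rw [eval_eq']
    rw [map_sum]
    refine Finset.sum_congr rfl fun α _ => ?_
    simp only [map_mul, map_pow, map_prod, eval_C, eval_bary_psum_univ, one_pow, one_mul, hℓe]

theorem exists_totalDegree_le_eval_eq (b : AffineBasis (Fin (d + 1)) ℝ (E d))
    (F : E d →ᵃ[ℝ] E d) {p : ℕ} {P : MvPolynomial (Fin (d + 1)) ℝ} (hP : P.IsHomogeneous p) :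
    ∃ q : MvPolynomial (Fin d) ℝ, q.totalDegree ≤ p ∧
      ∀ x : E d, eval (fun i => x i) q = eval (bary b (F x)) P := by
  let g : Fin (d + 1) → E d →ᵃ[ℝ] ℝ := fun k => (b.coord k).comp F
  let ℓ : Fin (d + 1) → MvPolynomial (Fin d) ℝ := fun k =>
    C (g k 0) + ∑ i, C ((g k).linear (EuclideanSpace.basisFun (Fin d) ℝ i)) * X i
  have hℓ : ∀ k, (ℓ k).totalDegree ≤ 1 := by
    intro k
    refine (totalDegree_add _ _).trans (max_le (by simp) (totalDegree_finsetSum_le fun i _ => ?_))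
    refine (totalDegree_mul _ _).trans ?_
    simp
  have hℓe : ∀ k (x : E d), eval (fun i => x i) (ℓ k) = bary b (F x) k := by
    intro k x
    have h1 : bary b (F x) k = g k x := rfl
    have h2 := (g k).map_vadd 0 x
    rw [vadd_eq_add, add_zero, vadd_eq_add] at h2
    have h3 := congrArg (g k).linear ((EuclideanSpace.basisFun (Fin d) ℝ).sum_repr x)
    rw [map_sum] at h3
    rw [h1, h2, ← h3, map_add, eval_C, map_sum, add_comm]
    congr 1
    refine Finset.sum_congr rfl fun i _ => ?_
    rw [map_mul, eval_C, eval_X, map_smul, smul_eq_mul, mul_comm]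
    rfl
  refine ⟨∑ α ∈ P.support, C (P.coeff α) * ∏ k, ℓ k ^ α k,
    totalDegree_finsetSum_le fun α hα => ?_, fun x => ?_⟩
  · have h1 : ∑ k, α k = p := by
      rw [← Finsupp.degree_eq_sum, Finsupp.degree_eq_weight_one]
      exact hP (mem_support_iff.1 hα)
    refine (totalDegree_mul _ _).trans ?_
    rw [totalDegree_C, zero_add, ← h1]
    refine (totalDegree_finsetProd _ _).trans (Finset.sum_le_sum fun k _ => ?_)
    refine (totalDegree_pow _ _).trans ?_
    simpa using Nat.mul_le_mul_left (α k) (hℓ k)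
  · conv_rhs => rw [eval_eq']
    rw [map_sum]
    refine Finset.sum_congr rfl fun α _ => ?_
    simp only [map_mul, map_pow, map_prod, eval_C, hℓe]

/-- Continuity gives vanishing on all of `U`, analyticity on the whole space, and homogeneity on the
positive orthant of coordinate vectors. The representing polynomial of given degree is therefore
unique. -/
theorem eq_zero_of_ae_eval_bary (b : AffineBasis (Fin (d + 1)) ℝ (E d)) {p : ℕ}
    {P : MvPolynomial (Fin (d + 1)) ℝ} (hP : P.IsHomogeneous p) {U : Set (E d)} (hU : IsOpen U)
    (hne : U.Nonempty) (h : ∀ᵐ x ∂volume.restrict U, eval (bary b x) P = 0) : P = 0 := by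
  have h1 : EqOn (fun x => eval (bary b x) P) (fun _ => 0) U :=
    Measure.eqOn_open_of_ae_eq h hU (continuous_eval_bary b P).continuousOn continuousOn_const
  obtain ⟨z, hz⟩ := hne
  have h2 : AnalyticOnNhd ℝ (fun x => eval (bary b x) P) univ :=
    contDiff_omega_iff_analyticOnNhd.1 (contDiff_eval_bary b P)
  have h3 := h2.eqOn_zero_of_preconnected_of_eventuallyEq_zero isPreconnected_univ (mem_univ z)
    (by filter_upwards [hU.mem_nhds hz] with x hx using h1 hx)
  refine MvPolynomial.funext_set (fun _ => Ioi (0 : ℝ)) (fun _ => Ioi_infinite 0) fun y hy => ?_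
  have hs : 0 < ∑ k, y k := Finset.sum_pos (fun k _ => hy k (mem_univ k)) Finset.univ_nonempty
  obtain ⟨x, hx⟩ := exists_bary_eq b (w := (∑ k, y k)⁻¹ • y) (by
    simp only [Pi.smul_apply, smul_eq_mul]
    rw [← Finset.mul_sum, inv_mul_cancel₀ hs.ne'])
  have h4 : y = (∑ k, y k) • bary b x := by rw [hx, smul_smul, mul_inv_cancel₀ hs.ne', one_smul]
  have h5 : eval (bary b x) P = 0 := h3 (mem_univ x)
  rw [h4, eval_smul_of_isHomogeneous hP, h5, mul_zero, map_zero]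

theorem eq_of_ae_eval_bary (b : AffineBasis (Fin (d + 1)) ℝ (E d)) {p : ℕ}
    {P Q : MvPolynomial (Fin (d + 1)) ℝ} (hP : P.IsHomogeneous p) (hQ : Q.IsHomogeneous p)
    {v : E d → ℝ} (hvP : v =ᵐ[volume.restrict (simplex b)] fun x => eval (bary b x) P)
    (hvQ : v =ᵐ[volume.restrict (simplex b)] fun x => eval (bary b x) Q) : P = Q := by
  refine sub_eq_zero.1 (eq_zero_of_ae_eval_bary b (hP.sub hQ) (isOpen_simplex b)
    (simplex_nonempty b) ?_)
  filter_upwards [hvP, hvQ] with x h1 h2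
  rw [map_sub, ← h1, ← h2, sub_self]

end Conversion

/-! ### The operator on a mesh. -/

namespace Mesh

variable {d : ℕ} {Ω : Set (E d)} (𝒯 : Mesh Ω)

/-- The vertices of the element `T` as an affine basis. -/
noncomputable def basis (T : Set (E d)) : AffineBasis (Fin (d + 1)) ℝ (E d) where
  toFun := 𝒯.map T ∘ 𝒯.refVertex
  ind' := (AffineEquiv.affineIndependent_iff (𝒯.map T)).2 𝒯.affineIndependent
  tot' := by
    have h : AffineIndependent ℝ (𝒯.map T ∘ 𝒯.refVertex) :=
      (AffineEquiv.affineIndependent_iff (𝒯.map T)).2 𝒯.affineIndependent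
    rw [h.affineSpan_eq_top_iff_card_eq_finrank_add_one]
    simp

theorem simplex_basis {T : Set (E d)} (hT : T ∈ 𝒯.elements) : simplex (𝒯.basis T) = T := by
  conv_rhs => rw [← 𝒯.map_image T hT]
  have h1 : range (𝒯.basis T) = 𝒯.map T '' range 𝒯.refVertex :=
    range_comp (𝒯.map T) 𝒯.refVertex
  have h2 := (AffineEquiv.toContinuousAffineEquiv (𝒯.map T)).toHomeomorph.image_interior
    (convexHull ℝ (range 𝒯.refVertex))
  have h3 := AffineMap.image_convexHull (𝒯.map T).toAffineMap (range 𝒯.refVertex)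
  rw [simplex_eq_interior, h1]
  exact (congrArg interior h3.symm).trans h2.symm

theorem facet_basis (T : Set (E d)) (i : Fin (d + 1)) :
    facet (𝒯.basis T) i = 𝒯.map T '' convexHull ℝ (𝒯.refVertex '' {i}ᶜ) := by
  rw [← convexHull_image_compl]
  have h1 : 𝒯.basis T '' {i}ᶜ = 𝒯.map T '' (𝒯.refVertex '' {i}ᶜ) :=
    image_comp (𝒯.map T) 𝒯.refVertex _
  rw [h1]
  exact (AffineMap.image_convexHull (𝒯.map T).toAffineMap _).symm

theorem isOpen_of_mem {T : Set (E d)} (hT : T ∈ 𝒯.elements) : IsOpen T := by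
  rw [← 𝒯.simplex_basis hT]
  exact isOpen_simplex _

theorem disjoint_of_ne {T S : Set (E d)} (hT : T ∈ 𝒯.elements) (hS : S ∈ 𝒯.elements)
    (hne : T ≠ S) : Disjoint T S := by
  rw [disjoint_iff_inter_eq_empty]
  exact (((𝒯.isOpen_of_mem hT).inter (𝒯.isOpen_of_mem hS)).measure_eq_zero_iff volume).1
    (𝒯.disjoint T hT S hS hne)

theorem isTriangulation : IsTriangulation (fun T : 𝒯.elements => 𝒯.basis T) Ω where
  subset T := by
    rw [𝒯.simplex_basis T.2]
    exact 𝒯.subset T T.2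
  disjoint T S hne := by
    rw [𝒯.simplex_basis T.2, 𝒯.simplex_basis S.2]
    exact 𝒯.disjoint_of_ne T.2 S.2 fun h => hne (Subtype.ext h)
  cover := by
    rw [← 𝒯.cover, biUnion_eq_iUnion]
    exact iUnion_congr fun T => by rw [𝒯.simplex_basis T.2]
  regular T i := by
    simp only [facet_basis]
    rcases 𝒯.regular T T.2 i with h | ⟨S, hS, hne, j, hj⟩
    · exact Or.inl h
    · exact Or.inr ⟨⟨S, hS⟩, fun h => hne (congrArg Subtype.val h), j, hj⟩

theorem ae_mem_iUnion : ∀ᵐ x ∂volume.restrict Ω, ∃ T ∈ 𝒯.elements, x ∈ T := by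
  have := 𝒯.finite.to_subtype
  have h1 : ∀ᵐ x, ∀ T : 𝒯.elements, x ∉ frontier (simplex (𝒯.basis T)) := by
    refine ae_all_iff.2 fun T => ?_
    have := (convex_simplex (𝒯.basis T)).addHaar_frontier (volume : Measure (E d))
    rwa [measure_eq_zero_iff_ae_notMem] at this
  refine ae_restrict_of_ae_restrict_of_subset subset_closure ?_
  filter_upwards [ae_restrict_of_ae h1, ae_restrict_mem isClosed_closure.measurableSet] with x hx hxΩ
  rw [← 𝒯.cover] at hxΩ
  obtain ⟨T, hT, hxT⟩ := mem_iUnion₂.1 hxΩ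
  refine ⟨T, hT, ?_⟩
  by_contra hn
  have h2 := hx ⟨T, hT⟩
  rw [𝒯.simplex_basis hT] at h2
  exact h2 ⟨hxT, by rwa [(𝒯.isOpen_of_mem hT).interior_eq]⟩

theorem ae_restrict_of_mem {T : Set (E d)} (hT : T ∈ 𝒯.elements) {P : E d → Prop}
    (h : ∀ᵐ x ∂volume.restrict Ω, P x) : ∀ᵐ x ∂volume.restrict T, P x :=
  ae_restrict_of_ae_restrict_of_subset (𝒯.subset T hT) h

/-- An almost everywhere property holds on `Ω` if it holds on all elements. -/
theorem ae_of_forall_mem {P : E d → Prop}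
    (h : ∀ T ∈ 𝒯.elements, ∀ᵐ x ∂volume.restrict T, P x) : ∀ᵐ x ∂volume.restrict Ω, P x := by
  have := 𝒯.finite.to_subtype
  have h1 : ∀ᵐ x, ∀ T : 𝒯.elements, x ∈ (T : Set (E d)) → P x :=
    ae_all_iff.2 fun T => ae_imp_of_ae_restrict (h T T.2)
  filter_upwards [ae_restrict_of_ae h1, 𝒯.ae_mem_iUnion] with x hx ⟨T, hT, hxT⟩
  exact hx ⟨T, hT⟩ hxT

/-- `P` represents `v` on the element `T`. -/
def Represents (T : Set (E d)) (P : MvPolynomial (Fin (d + 1)) ℝ) (v : E d → ℝ) : Prop :=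
  v =ᵐ[volume.restrict T] fun x => eval (bary (𝒯.basis T) x) P

theorem exists_represents {p : ℕ} (v : 𝒯.spline p) {T : Set (E d)} (hT : T ∈ 𝒯.elements) :
    ∃ P : MvPolynomial (Fin (d + 1)) ℝ, P.IsHomogeneous p ∧
      𝒯.Represents T P (v : Lp ℝ 2 (volume.restrict Ω)) := by
  obtain ⟨q, hq, hvq⟩ := v.2 T hT
  obtain ⟨P, hP, hPq⟩ :=
    exists_isHomogeneous_eval_bary_eq (𝒯.basis T) (𝒯.map T).symm.toAffineMap hq
  refine ⟨P, hP, ?_⟩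
  have hm : (𝒯.map T).symm '' T ⊆ 𝒯.ref := by
    rintro _ ⟨y, hy, rfl⟩
    obtain ⟨x, hx, rfl⟩ := (𝒯.map_image T hT).ge hy
    rw [AffineEquiv.symm_apply_apply]
    exact hx
  have h := ae_comp_affine (𝒯.map T).symm hm hvq (𝒯.isOpen_of_mem hT).measurableSet
    𝒯.measurableSet_ref
  filter_upwards [h] with x hx
  rw [AffineEquiv.apply_symm_apply] at hx
  rw [hx, hPq]
  rfl

theorem Represents.unique {p : ℕ} {T : Set (E d)} (hT : T ∈ 𝒯.elements)
    {P Q : MvPolynomial (Fin (d + 1)) ℝ} (hP : P.IsHomogeneous p) (hQ : Q.IsHomogeneous p)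
    {v : E d → ℝ} (hvP : 𝒯.Represents T P v) (hvQ : 𝒯.Represents T Q v) : P = Q := by
  rw [Represents] at hvP hvQ
  nth_rw 1 [← 𝒯.simplex_basis hT] at hvP hvQ
  exact eq_of_ae_eval_bary (𝒯.basis T) hP hQ hvP hvQ

theorem exists_spline {p : ℕ} {P : Set (E d) → MvPolynomial (Fin (d + 1)) ℝ}
    (hP : ∀ T ∈ 𝒯.elements, (P T).IsHomogeneous p) : ∃ v : 𝒯.spline p, ∀ T ∈ 𝒯.elements,
      𝒯.Represents T (P T) (v : Lp ℝ 2 (volume.restrict Ω)) := by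
  classical
  let f : E d → ℝ := fun x => ∑ T ∈ 𝒯.finite.toFinset,
    T.indicator (fun x => eval (bary (𝒯.basis T) x) (P T)) x
  have hfT : ∀ T ∈ 𝒯.elements, ∀ x ∈ T, f x = eval (bary (𝒯.basis T) x) (P T) := by
    intro T hT x hx
    simp only [f]
    rw [Finset.sum_eq_single T]
    · exact indicator_of_mem hx _
    · intro S hS hne
      refine indicator_of_notMem (fun hxS => ?_) _
      exact ((𝒯.disjoint_of_ne ((𝒯.finite.mem_toFinset).1 hS) hT hne).le_bot ⟨hxS, hx⟩).elim
    · intro h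
      exact absurd ((𝒯.finite.mem_toFinset).2 hT) h
  have hf : MemLp f 2 (volume.restrict Ω) := by
    refine memLp_finsetSum _ fun T hT => ?_
    have hT' : T ∈ 𝒯.elements := (𝒯.finite.mem_toFinset).1 hT
    have hTm : MeasurableSet T := (𝒯.isOpen_of_mem hT').measurableSet
    rw [memLp_indicator_iff_restrict hTm, Measure.restrict_restrict hTm,
      inter_eq_self_of_subset_left (𝒯.subset T hT')]
    have hTs : T = simplex (𝒯.basis T) := (𝒯.simplex_basis hT').symm
    have hb : Bornology.IsBounded T := by
      rw [hTs]
      exact isBounded_simplex _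
    have : IsFiniteMeasure (volume.restrict T) :=
      isFiniteMeasure_restrict.2 hb.measure_lt_top.ne
    obtain ⟨c, hc⟩ := hb.isCompact_closure.exists_bound_of_continuousOn
      (continuous_eval_bary (𝒯.basis T) (P T)).continuousOn
    refine MemLp.of_bound (continuous_eval_bary (𝒯.basis T) (P T)).aestronglyMeasurable c ?_
    filter_upwards [ae_restrict_mem hTm] with x hx
    exact hc x (subset_closure hx)
  have hrep : ∀ T ∈ 𝒯.elements, 𝒯.Represents T (P T) (hf.toLp f) := by
    intro T hT
    filter_upwards [𝒯.ae_restrict_of_mem hT hf.coeFn_toLp,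
      ae_restrict_mem (𝒯.isOpen_of_mem hT).measurableSet] with x h1 h2
    rw [h1, hfT T hT x h2]
  refine ⟨⟨hf.toLp f, fun T hT => ?_⟩, hrep⟩
  obtain ⟨q, hq, hqP⟩ :=
    exists_totalDegree_le_eval_eq (𝒯.basis T) (𝒯.map T).toAffineMap (hP T hT)
  refine ⟨q, hq, ?_⟩
  filter_upwards [ae_comp_affine (𝒯.map T) (𝒯.map_image T hT).subset (hrep T hT)
    𝒯.measurableSet_ref (𝒯.isOpen_of_mem hT).measurableSet] with x hx
  rw [hx, hqP]
  rfl

theorem spline_ext {p : ℕ} {v w : 𝒯.spline p}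
    (h : ∀ T ∈ 𝒯.elements, (v : Lp ℝ 2 (volume.restrict Ω)) =ᵐ[volume.restrict T]
      (w : Lp ℝ 2 (volume.restrict Ω))) : v = w :=
  Subtype.ext (Lp.ext (𝒯.ae_of_forall_mem h))

/-- If `v` vanishes near a point, then on each element meeting that neighbourhood its polynomial
vanishes on an open set and so is zero; hence `w` is zero on the whole element. -/
theorem essSupport_subset {v w : E d → ℝ}
    (h : ∀ T ∈ 𝒯.elements, ∃ (p : ℕ) (P Q : MvPolynomial (Fin (d + 1)) ℝ), P.IsHomogeneous p ∧
      𝒯.Represents T P v ∧ 𝒯.Represents T Q w ∧ (P = 0 → Q = 0)) :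
    essSupport Ω w ⊆ essSupport Ω v := by
  intro x hx
  by_contra hxv
  simp only [essSupport, mem_ofPred_eq, not_forall, not_not] at hxv
  obtain ⟨U, hU, hUv⟩ := hxv
  obtain ⟨W, hWU, hWo, hxW⟩ := _root_.mem_nhds_iff.1 hU
  refine hx W (hWo.mem_nhds hxW) ?_
  have h1 : ∀ᵐ y, y ∈ U ∩ Ω → v y = 0 := by
    rw [measure_eq_zero_iff_ae_notMem] at hUv
    filter_upwards [hUv] with y hy hyU
    by_contra hne
    exact hy ⟨hyU, hne⟩
  have h2 : ∀ᵐ y ∂volume.restrict Ω, y ∈ W → w y = 0 := by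
    refine 𝒯.ae_of_forall_mem fun T hT => ?_
    have hTo := 𝒯.isOpen_of_mem hT
    by_cases hne : (W ∩ T).Nonempty
    · obtain ⟨p, P, Q, hP, hvP, hwQ, hPQ⟩ := h T hT
      have hP0 : P = 0 := by
        refine eq_zero_of_ae_eval_bary (𝒯.basis T) hP (hWo.inter hTo) hne ?_
        filter_upwards [ae_restrict_of_ae_restrict_of_subset inter_subset_right hvP,
          ae_restrict_of_ae h1, ae_restrict_mem (hWo.inter hTo).measurableSet] with y h3 h4 h5
        rw [← h3, h4 ⟨hWU h5.1, 𝒯.subset T hT h5.2⟩]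
      rw [Represents, hPQ hP0] at hwQ
      filter_upwards [hwQ] with y hy _
      rw [hy, map_zero]
    · filter_upwards [ae_restrict_mem hTo.measurableSet] with y hy hyW
      exact absurd ⟨y, hyW, hy⟩ hne
  rw [measure_eq_zero_iff_ae_notMem]
  filter_upwards [ae_imp_of_ae_restrict h2] with y hy hyW
  exact hyW.2 (hy hyW.1.2 hyW.1.1)

/-- The operator given on each element by `reduce`. -/
theorem exists_linearMap (p : ℕ) : ∃ J : 𝒯.spline (p + 2) →ₗ[ℝ] 𝒯.spline p,
    ∀ (v : 𝒯.spline (p + 2)), ∀ T ∈ 𝒯.elements, ∀ P : MvPolynomial (Fin (d + 1)) ℝ,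
      P.IsHomogeneous (p + 2) → 𝒯.Represents T P (v : Lp ℝ 2 (volume.restrict Ω)) →
        𝒯.Represents T (reduce p P) (J v : Lp ℝ 2 (volume.restrict Ω)) := by
  have h1 : ∀ v : 𝒯.spline (p + 2), ∃ w : 𝒯.spline p, ∀ T ∈ 𝒯.elements,
      ∀ P : MvPolynomial (Fin (d + 1)) ℝ, P.IsHomogeneous (p + 2) →
        𝒯.Represents T P (v : Lp ℝ 2 (volume.restrict Ω)) →
          𝒯.Represents T (reduce p P) (w : Lp ℝ 2 (volume.restrict Ω)) := by
    intro v
    have h2 : ∀ T, ∃ P : MvPolynomial (Fin (d + 1)) ℝ, T ∈ 𝒯.elements → P.IsHomogeneous (p + 2) ∧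
        𝒯.Represents T P (v : Lp ℝ 2 (volume.restrict Ω)) := by
      intro T
      by_cases hT : T ∈ 𝒯.elements
      · obtain ⟨P, hP⟩ := 𝒯.exists_represents v hT
        exact ⟨P, fun _ => hP⟩
      · exact ⟨0, fun h => absurd h hT⟩
    choose P hP using h2
    obtain ⟨w, hw⟩ := 𝒯.exists_spline (p := p) (P := fun T => reduce p (P T))
      fun T _ => isHomogeneous_reduce p _
    refine ⟨w, fun T hT Q hQ hQv => ?_⟩
    -- Uniqueness of the representing polynomial makes the result independent of the choice, which
    -- also yields linearity below.
    rw [← Represents.unique 𝒯 hT (hP T hT).1 hQ (hP T hT).2 hQv]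
    exact hw T hT
  choose J hJ using h1
  refine ⟨{ toFun := J, map_add' := fun v w => ?_, map_smul' := fun c v => ?_ }, hJ⟩
  · refine 𝒯.spline_ext fun T hT => ?_
    obtain ⟨P, hP, hvP⟩ := 𝒯.exists_represents v hT
    obtain ⟨Q, hQ, hwQ⟩ := 𝒯.exists_represents w hT
    have hsum : 𝒯.Represents T (P + Q) ((v + w : 𝒯.spline (p + 2)) :
        Lp ℝ 2 (volume.restrict Ω)) := by
      filter_upwards [𝒯.ae_restrict_of_mem hT (Lp.coeFn_add (v : Lp ℝ 2 (volume.restrict Ω))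
        (w : Lp ℝ 2 (volume.restrict Ω))), hvP, hwQ] with x h1 h2 h3
      rw [Submodule.coe_add, h1, Pi.add_apply, h2, h3, map_add]
    filter_upwards [hJ _ T hT _ (hP.add hQ) hsum, hJ _ T hT _ hP hvP, hJ _ T hT _ hQ hwQ,
      𝒯.ae_restrict_of_mem hT (Lp.coeFn_add (J v : Lp ℝ 2 (volume.restrict Ω))
        (J w : Lp ℝ 2 (volume.restrict Ω)))] with x h1 h2 h3 h4
    rw [h1, Submodule.coe_add, h4, Pi.add_apply, h2, h3, map_add, map_add]
  · refine 𝒯.spline_ext fun T hT => ?_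
    obtain ⟨P, hP, hvP⟩ := 𝒯.exists_represents v hT
    have hcP : (c • P).IsHomogeneous (p + 2) := by
      rw [smul_eq_C_mul]
      simpa using (isHomogeneous_C _ c).mul hP
    have hsmul : 𝒯.Represents T (c • P) ((c • v : 𝒯.spline (p + 2)) :
        Lp ℝ 2 (volume.restrict Ω)) := by
      filter_upwards [𝒯.ae_restrict_of_mem hT (Lp.coeFn_smul c
        (v : Lp ℝ 2 (volume.restrict Ω))), hvP] with x h1 h2
      rw [Submodule.coe_smul, h1, Pi.smul_apply, h2, smul_eval, smul_eq_mul]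
    filter_upwards [hJ _ T hT _ hcP hsmul, hJ _ T hT _ hP hvP,
      𝒯.ae_restrict_of_mem hT (Lp.coeFn_smul c (J v : Lp ℝ 2 (volume.restrict Ω)))]
      with x h1 h2 h3
    rw [h1, RingHom.id_apply, Submodule.coe_smul, h3, Pi.smul_apply, h2, map_smul, smul_eval,
      smul_eq_mul]

end Mesh

variable {d : ℕ} {Ω : Set (E d)} (𝒯 : Mesh Ω)

theorem gradSeminorm_congr {U : Set (E d)} {v w : E d → ℝ} (q : ℝ≥0∞)
    (h : v =ᵐ[volume.restrict U] w) : gradSeminorm q U v = gradSeminorm q U w := by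
  refine iInf_congr fun g => ?_
  have h1 : HasWeakGradient U v g ↔ HasWeakGradient U w g :=
    ⟨fun hv => hv.congr h Filter.EventuallyEq.rfl,
      fun hw => hw.congr h.symm Filter.EventuallyEq.rfl⟩
  simp only [h1]

theorem Mesh.error_bound (hd : 1 ≤ d) {σ : ℝ} (hσ : 1 ≤ σ) (hreg : 𝒯.IsShapeRegular σ) {p : ℕ}
    (hp : 1 ≤ p) {J : 𝒯.spline (p + 2) →ₗ[ℝ] 𝒯.spline p}
    (hJ : ∀ (v : 𝒯.spline (p + 2)), ∀ T ∈ 𝒯.elements, ∀ P : MvPolynomial (Fin (d + 1)) ℝ,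
      P.IsHomogeneous (p + 2) → 𝒯.Represents T P (v : Lp ℝ 2 (volume.restrict Ω)) →
        𝒯.Represents T (reduce p P) (J v : Lp ℝ 2 (volume.restrict Ω)))
    (κ : 𝒯.spline 1) (u : 𝒯.spline p) {T : Set (E d)} (hT : T ∈ 𝒯.elements) :
    eLpNorm (fun x => (𝒯.sqMul κ u : Lp ℝ 2 (volume.restrict Ω)) x -
          (J (𝒯.sqMul κ u) : Lp ℝ 2 (volume.restrict Ω)) x) 2 (volume.restrict T) +
        ENNReal.ofReal (diam T) * gradSeminorm 2 T
          (fun x => (𝒯.sqMul κ u : Lp ℝ 2 (volume.restrict Ω)) x -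
            (J (𝒯.sqMul κ u) : Lp ℝ 2 (volume.restrict Ω)) x) ≤
      ENNReal.ofReal (errorConst d σ * (p : ℝ) ^ ((d : ℝ) * ((d : ℝ) + 1) / 4 + 2) * diam T) *
        gradSeminorm ∞ T (fun x => (κ : Lp ℝ 2 (volume.restrict Ω)) x ^ 2) *
        eLpNorm (u : Lp ℝ 2 (volume.restrict Ω)) 2 (volume.restrict T) := by
  obtain ⟨x₀, -, hball, -⟩ := hreg T hT
  obtain ⟨k, hk, hκk⟩ := 𝒯.exists_represents κ hT
  obtain ⟨w, hw, huw⟩ := 𝒯.exists_represents u hT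
  have hkw : (k ^ 2 * w).IsHomogeneous (p + 2) := by
    simpa only [add_comm p 2, one_mul] using (hk.pow 2).mul hw
  have hsq : 𝒯.Represents T (k ^ 2 * w) (𝒯.sqMul κ u : Lp ℝ 2 (volume.restrict Ω)) := by
    filter_upwards [𝒯.ae_restrict_of_mem hT (𝒯.memLp_sq_mul κ u).coeFn_toLp, hκk, huw]
      with x h1 h2 h3
    rw [map_mul, map_pow, ← h2, ← h3, ← h1]
    rfl
  have he : (fun x => (𝒯.sqMul κ u : Lp ℝ 2 (volume.restrict Ω)) x -
      (J (𝒯.sqMul κ u) : Lp ℝ 2 (volume.restrict Ω)) x) =ᵐ[volume.restrict T]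
      fun x => eval (bary (𝒯.basis T) x)
        (k ^ 2 * w - psum Finset.univ ^ 2 * reduce p (k ^ 2 * w)) := by
    filter_upwards [hsq, hJ _ T hT _ hkw hsq] with x h1 h2
    rw [h1, h2, map_sub, map_mul (eval _) (psum _ ^ 2), map_pow (eval _) (psum _),
      eval_bary_psum_univ, one_pow, one_mul]
  have hκ : (fun x => (κ : Lp ℝ 2 (volume.restrict Ω)) x ^ 2) =ᵐ[volume.restrict T]
      fun x => eval (bary (𝒯.basis T) x) k ^ 2 := by
    filter_upwards [hκk] with x hx
    rw [hx]
  rw [eLpNorm_congr_ae he, gradSeminorm_congr 2 he, gradSeminorm_congr ∞ hκ, eLpNorm_congr_ae huw]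
  have hS := 𝒯.simplex_basis hT
  have h := HpFem.error_bound (𝒯.basis T) hd hσ (x₀ := x₀) (by rwa [hS]) hp hk hw
  rwa [hS] at h

end HpFem

theorem mainTheorem3 (d : ℕ) (hd : 1 ≤ d) (Ω : Set (HpFem.E d))
    (hΩ : HpFem.IsLipschitzDomain Ω) (σ : ℝ) (hσ : 1 ≤ σ) :
    ∃ C : ℝ, 0 < C ∧ ∀ 𝒯 : HpFem.Mesh Ω, 𝒯.IsShapeRegular σ → ∀ p : ℕ, 1 ≤ p →
      ∃ J : 𝒯.spline (p + 2) →ₗ[ℝ] 𝒯.spline p,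
        -- the operator acts elementwise
        (∀ v w : 𝒯.spline (p + 2), ∀ T ∈ 𝒯.elements,
          (v : Lp ℝ 2 (volume.restrict Ω)) =ᵐ[volume.restrict T]
            (w : Lp ℝ 2 (volume.restrict Ω)) →
          (J v : Lp ℝ 2 (volume.restrict Ω)) =ᵐ[volume.restrict T]
            (J w : Lp ℝ 2 (volume.restrict Ω))) ∧
        -- continuity and boundary values
        (∀ v : 𝒯.spline (p + 2), (v : Lp ℝ 2 (volume.restrict Ω)) ∈ 𝒯.spline10 (p + 2) →
          (J v : Lp ℝ 2 (volume.restrict Ω)) ∈ 𝒯.spline10 p) ∧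
        -- supports
        (∀ v : 𝒯.spline (p + 2),
          HpFem.essSupport Ω (J v : Lp ℝ 2 (volume.restrict Ω)) ⊆
            HpFem.essSupport Ω (v : Lp ℝ 2 (volume.restrict Ω))) ∧
        -- error bound
        (∀ (κ : 𝒯.spline 1) (u : 𝒯.spline p), ∀ T ∈ 𝒯.elements,
          let e : HpFem.E d → ℝ := fun x =>
            (𝒯.sqMul κ u : Lp ℝ 2 (volume.restrict Ω)) x -
              (J (𝒯.sqMul κ u) : Lp ℝ 2 (volume.restrict Ω)) x
          eLpNorm e 2 (volume.restrict T) +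
              ENNReal.ofReal (diam T) * HpFem.gradSeminorm 2 T e ≤
            ENNReal.ofReal (C * (p : ℝ) ^ ((d : ℝ) * ((d : ℝ) + 1) / 4 + 2) * diam T) *
              HpFem.gradSeminorm ∞ T
                (fun x => (κ : Lp ℝ 2 (volume.restrict Ω)) x ^ 2) *
              eLpNorm (u : Lp ℝ 2 (volume.restrict Ω)) 2 (volume.restrict T)) := by
  -- The constant depends on `d` and `σ` only; the domain enters just through membership in `H¹₀`.
  refine ⟨HpFem.errorConst d σ, HpFem.errorConst_pos d hσ, fun 𝒯 hreg p hp => ?_⟩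
  obtain ⟨J, hJ⟩ := 𝒯.exists_linearMap p
  refine ⟨J, fun v w T hT hvw => ?_, fun v hv => ?_, fun v => 𝒯.essSupport_subset fun T hT => ?_,
    fun κ u T hT => ?_⟩
  · obtain ⟨P, hP, hwP⟩ := 𝒯.exists_represents w hT
    exact (hJ v T hT P hP (hvw.trans hwP)).trans (hJ w T hT P hP hwP).symm
  · have := 𝒯.finite.to_subtype
    choose P hP hvP using fun T : 𝒯.elements => 𝒯.exists_represents v T.2
    refine ⟨hv.1.of_reduce hd 𝒯.isTriangulation hΩ.interior_closure hΩ.isBounded hP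
      (fun T => ?_) fun T => ?_, (J v).2⟩
    · rw [𝒯.simplex_basis T.2]
      exact hvP T
    · rw [𝒯.simplex_basis T.2]
      exact hJ v T T.2 (P T) (hP T) (hvP T)
  · obtain ⟨P, hP, hvP⟩ := 𝒯.exists_represents v hT
    exact ⟨p + 2, P, _, hP, hvP, hJ v T hT P hP hvP, fun h => by rw [h, map_zero]⟩
  · exact 𝒯.error_bound hd hσ hreg hp hJ κ u hT
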